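/- **Setting.** Circles are circles of the Riemann sphere $\widehat{\mathbb C}=\mathbb C\cup\{\infty\}$ (Euclidean circles, with curvature $1/r$, and lines completed by $\infty$, with curvature $0$); two different circles are tangent if they meet in exactly one point. $C(z,r)$ is the circle with centre $z$ and radius $r$. Let $\mathcal K$ be a generalized Ford configuration: it consists of the lines $C_0=\mathbb R$ and $\mathbb R+\mathbf i$, of two different circles $C(\frac{\mathbf i}2,\frac12)$ and $C(\frac t2+\frac{\mathbf i}2,\frac12)$ with $t>0$, and of finitely many (possibly no) further circles lying in the strip $0\le \operatorname{Im} z\le 1$ between these two; the associated discs (for the lines: $\operatorname{Im}z\le 0$ and $\operatorname{Im}z\ge 1$) have disjoint interiors, and every gap of $\mathcal K$ (component of the complement of the closed discs) is a curvilinear triangle bounded by three mutually tangent circles of $\mathcal K$. The dual circle of a gap is the circle through its three vertices. Let $\mathfrak S$ be the group generated by the reflections in the dual circles of all gaps, let $\mathcal P=\mathfrak S\mathcal K$, and let $\Gamma\subset \mathrm{PSL}(2,\mathbb R)$ be the group of orientation preserving elements of $\mathfrak S$ that fix $C_0$. For $T>0$, let $\mathcal A_T\subset\mathbb R$ be the set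 of finite points of tangency with $\mathbb R$ of those circles of $\mathcal P$ tangent to $\mathbb R$ whose curvature is at most $T$. Two such circles are *neighbours in $\mathcal A_T$* if their points of tangency are finite, different, and have no further element of $\mathcal A_T$ between them. Let $\mathcal K_0=\{C_k\}$ be the set of circles of $\mathcal K$ tangent to $C_0$, and $\alpha_k$ the point of tangency of $C_k$ with $C_0$. For the line $\mathbb R+\mathbf i$, $\alpha_k=\infty$; otherwise $C_k=C(\alpha_k+r_k\mathbf i,r_k)$. Put $q_k(c,d)=(c\alpha_k+d)^2/r_k$ if $\alpha_k\ne\infty$, and $q_k(c,d)=2c^2$ if $\alpha_k=\infty$. Call $C_i,C_j\in\mathcal K_0$ *adjacent* if they are tangent and bound a triangular gap of $\mathcal K$ together with $C_0$; in this case let $S_{i,j}$ be the reflection in the dual circle of that gap, and for $C_k\in\mathcal K_0$, $k\neq i,j$, write $S_{i,j}C_k=C(\alpha_{i,j}^{(k)}+ r_{i,j}^{(k)}\mathbf i,r_{i,j}^{(k)})$ and $q_{i,j}^{(k)}(c,d)=(c\alpha_{i,j}^{(k)}+d)^2/r_{i,j}^{(k)}$. For different $C_i,C_j\in\mathcal K_0$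 and $T>0$ let $\Omega_T^{i,j}=\Omega_T^{j,i}$ be the set of $(c,d)\in\mathbb R^2$ with $c\ge 0$, $q_i(c,d)\le T$, $q_j(c,d)\le T$, and the following (where $k$ runs over the circles of $\mathcal K_0$). (a) $\alpha_i,\alpha_j\neq\infty$. - (i) If $C_i,C_j$ are adjacent: if $(c\alpha_i+d)(c\alpha_j+d)<0$, then $q_k(c,d)>T$ for all $k\ne i,j$; and if $(c\alpha_i+d)(c\alpha_j+d)>0$, then $q_{i,j}^{(k)}(c,d)>T$ for all $k\neq i,j$. - (ii) If $C_i,C_j$ are not adjacent: $q_k(c,d)>T$ for every $k\ne i,j$ such that either $\alpha_k$ lies strictly between $\alpha_i$ and $\alpha_j$ and $(c\alpha_i+d)(c\alpha_j+d)>0$, or $\alpha_k$ does not lie between $\alpha_i$ and $\alpha_j$ (in particular if $\alpha_k=\infty$) and $(c\alpha_i+d)(c\alpha_j+d)<0$. (b) $\alpha_j=\infty$. - (i) If $C_i,C_j$ are adjacent: if $\alpha_i=0$ and $d>0$, or $\alpha_i=\frac t2$ and $\frac{ct}2+d<0$, then $q_k(c,d)>T$ for all $k\ne i,j$; and if $\alpha_i=0$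 and $d<0$, or $\alpha_i=\frac t2$ and $\frac{ct}2+d>0$, then $q_{i,j}^{(k)}(c,d)>T$ for all $k\neq i,j$. - (ii) If $C_i,C_j$ are not adjacent: $q_k(c,d)>T$ for every $k\ne i,j$ such that either $\alpha_k>\alpha_i$ and $c\alpha_i+d>0$, or $\alpha_k<\alpha_i$ and $c\alpha_i+d<0$. **Proposition.** Let $C_i,C_j\in\mathcal K_0$ be different and let $T>0$. For every $\gamma=\begin{pmatrix}a&b\\c&d\end{pmatrix}\in \mathrm{SL}(2,\mathbb R)$ that represents an element of $\Gamma$, with the sign chosen such that $c\ge 0$, the circles $\gamma(C_i)$ and $\gamma(C_j)$ are neighbours in $\mathcal A_T$ if and only if $(c,d)\in\Omega_T^{i,j}$. Moreover $\Omega_T^{i,j}=\sqrt T\,\Omega_1^{i,j}$. -/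

import Mathlib

open scoped Pointwise MatrixGroups

noncomputable section

/-! ### Circles on the Riemann sphere, and reflections in them -/

/-- The Riemann sphere. -/
abbrev Sphere : Type := OnePoint ℂ

/-- Circles on the Riemann sphere: Euclidean circles, and lines (completed by `∞`). The line
`line p v` passes through `p` in the direction `v`. -/
inductive GenCircle : Type
  | circle (z : ℂ) (r : ℝ) (hr : 0 < r) : GenCircle
  | line (p v : ℂ) (hv : v ≠ 0) : GenCircle

namespace GenCircle

/-- The set of points of a generalized circle. -/
def carrier : GenCircle → Set Sphere
  | circle z r _ => (fun w : ℂ => (w : Sphere)) '' Metric.sphere z r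
  | line p v _ => insert OnePoint.infty ((fun w : ℂ => (w : Sphere)) '' {w | ((w - p) / v).im = 0})

/-- One of the two open sides: the open disc bounded by a circle, the open half-plane to the left
of a directed line. -/
def inside : GenCircle → Set Sphere
  | circle z r _ => (fun w : ℂ => (w : Sphere)) '' Metric.ball z r
  | line p v _ => (fun w : ℂ => (w : Sphere)) '' {w | 0 < ((w - p) / v).im}

/-- The other open side. -/
def outside (O : GenCircle) : Set Sphere := (O.carrier ∪ O.inside)ᶜ

/-- The (unsigned) curvature: `1 / r` for a circle of radius `r`, and `0` for a line. -/
def curvature : GenCircle → ℝ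
  | circle _ r _ => 1 / r
  | line _ _ _ => 0

open Classical in
/-- The reflection in a generalized circle, as a map of the Riemann sphere. -/
def reflFun : GenCircle → Sphere → Sphere
  | circle z r _, x =>
      x.elim (z : Sphere) fun w =>
        if w = z then OnePoint.infty
        else ((z + (r : ℂ) ^ 2 / (starRingEnd ℂ) (w - z) : ℂ) : Sphere)
  | line p v _, x =>
      x.elim OnePoint.infty fun w =>
        ((p + v / (starRingEnd ℂ) v * (starRingEnd ℂ) (w - p) : ℂ) : Sphere)

theorem reflFun_involutive (O : GenCircle) : Function.Involutive O.reflFun := by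
  intro x
  cases O with
  | circle z r hr =>
    induction x using OnePoint.rec with
    | infty => simp [reflFun]
    | coe w =>
      by_cases h : w = z
      · simp [reflFun, h]
      · have h1 : w - z ≠ 0 := sub_ne_zero.mpr h
        have h2 : (starRingEnd ℂ) (w - z) ≠ 0 := (map_ne_zero _).mpr h1
        have hr' : (r : ℂ) ≠ 0 := by exact_mod_cast hr.ne'
        have h3 : z + (r : ℂ) ^ 2 / (starRingEnd ℂ) (w - z) ≠ z := by
          intro h4
          have h5 : (r : ℂ) ^ 2 / (starRingEnd ℂ) (w - z) = 0 := by simpa using h4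
          exact (div_ne_zero (pow_ne_zero 2 hr') h2) h5
        simp only [reflFun, OnePoint.elim_some, h, if_false, h3]
        congr 1
        rw [add_sub_cancel_left, map_div₀, Complex.conj_conj, map_pow, Complex.conj_ofReal]
        field_simp
        ring
  | line p v hv =>
    induction x using OnePoint.rec with
    | infty => simp [reflFun]
    | coe w =>
      have h2 : (starRingEnd ℂ) v ≠ 0 := by simpa using hv
      simp only [reflFun, OnePoint.elim_some]
      congr 1
      rw [add_sub_cancel_left, map_mul, map_div₀, Complex.conj_conj, Complex.conj_conj]
      field_simp
      ring

/-- The reflection in a generalized circle, as a permutation of the Riemann sphere. -/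
def reflection (O : GenCircle) : Equiv.Perm Sphere := O.reflFun_involutive.toPerm

end GenCircle

/-! ### Finite families of circles in the strip `0 ≤ Im z ≤ 1` -/

/-- Finitely many circles in the strip `0 ≤ Im z ≤ 1` which bound discs with disjoint interiors. -/
structure StripCircles where
  n : ℕ
  center : Fin n → ℂ
  radius : Fin n → ℝ
  radius_pos : ∀ v, 0 < radius v
  radius_le_im : ∀ v, radius v ≤ (center v).im
  im_add_radius_le : ∀ v, (center v).im + radius v ≤ 1
  separated : ∀ v w, v ≠ w → radius v + radius w ≤ dist (center v) (center w)

/-- The labels of the circles of a configuration: the real line `base`, the line `top` given by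
`Im z = 1`, and the remaining circles. -/
inductive Label (n : ℕ) : Type
  | base : Label n
  | top : Label n
  | inner (v : Fin n) : Label n

namespace StripCircles

variable (P : StripCircles)

/-- The circles of the configuration. -/
def circ : Label P.n → GenCircle
  | .base => GenCircle.line 0 1 one_ne_zero
  | .top => GenCircle.line Complex.I 1 one_ne_zero
  | .inner v => GenCircle.circle (P.center v) (P.radius v) (P.radius_pos v)

/-- The closed discs of the configuration: the closed lower half-plane, the closed half-plane
`Im z ≥ 1` and the closed discs in the strip. -/
def disk : Label P.n → Set Sphere
  | .base => insert OnePoint.infty ((fun w : ℂ => (w : Sphere)) '' {w | w.im ≤ 0})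
  | .top => insert OnePoint.infty ((fun w : ℂ => (w : Sphere)) '' {w | 1 ≤ w.im})
  | .inner v => (fun w : ℂ => (w : Sphere)) '' Metric.closedBall (P.center v) (P.radius v)

/-- Two different circles of the configuration are tangent if they meet in exactly one point of the
Riemann sphere. -/
def Tangent (i j : Label P.n) : Prop :=
  i ≠ j ∧ ∃ p : Sphere, (P.circ i).carrier ∩ (P.circ j).carrier = {p}

/-- `P.IsTriangularGap i j k O B`: the circles `i, j, k` are mutually tangent, `O` is the dual
circle (the one through their three points of tangency), `B` is one of the two sides of `O`, and
the curvilinear triangle `B \ (disk i ∪ disk j ∪ disk k)` meets none of the other discs. -/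
def IsTriangularGap (i j k : Label P.n) (O : GenCircle) (B : Set Sphere) : Prop :=
  P.Tangent i j ∧ P.Tangent j k ∧ P.Tangent i k ∧
  (P.circ i).carrier ∩ (P.circ j).carrier ⊆ O.carrier ∧
  (P.circ j).carrier ∩ (P.circ k).carrier ⊆ O.carrier ∧
  (P.circ i).carrier ∩ (P.circ k).carrier ⊆ O.carrier ∧
  (B = O.inside ∨ B = O.outside) ∧
  ∀ l, l ≠ i → l ≠ j → l ≠ k →
    Disjoint (B \ (P.disk i ∪ P.disk j ∪ P.disk k)) (P.disk l)

end StripCircles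

/-! ### Generalized Ford configurations and the packings they generate -/

/-- A generalized Ford configuration: the lines `Im z = 0` and `Im z = 1`, two different circles of
radius `1/2` in the strip between them, tangent to the real line at `0` and at `t / 2`, and finitely
many further circles between these two, such that the discs have disjoint interiors and all the gaps
between them are curvilinear triangles. -/
structure FordConfiguration extends StripCircles where
  t : ℝ
  first : Fin n
  last : Fin n
  first_ne_last : first ≠ last
  center_first : center first = Complex.I / 2
  radius_first : radius first = 1 / 2
  center_last : center last = (t : ℂ) / 2 + Complex.I / 2
  radius_last : radius last = 1 / 2
  between : ∀ v, 0 ≤ (center v).re ∧ (center v).re ≤ t / 2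
  triangular : ∀ z : Sphere, (∀ i, z ∉ toStripCircles.disk i) →
    ∃ i j k O B, toStripCircles.IsTriangularGap i j k O B ∧
      z ∈ B \ (toStripCircles.disk i ∪ toStripCircles.disk j ∪ toStripCircles.disk k)

/-- The Möbius transformation `z ↦ (a z + b) / (c z + d)` of the Riemann sphere given by a real
matrix of determinant one. -/
def mobius (γ : SL(2, ℝ)) : Equiv.Perm Sphere :=
  MulAction.toPerm (Matrix.SpecialLinearGroup.toGL
    (Matrix.SpecialLinearGroup.map Complex.ofRealHom γ))

namespace FordConfiguration

variable (F : FordConfiguration)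

/-- The base circle: the real line. -/
def baseCircle : Set Sphere := (F.circ .base).carrier

/-- The group generated by the reflections in the dual circles of the triangular gaps. -/
def reflectionGroup : Subgroup (Equiv.Perm Sphere) :=
  Subgroup.closure {S | ∃ i j k O B, F.IsTriangularGap i j k O B ∧ S = O.reflection}

/-- The orientation preserving elements of the reflection group that fix the base circle. -/
def Gam : Set (Equiv.Perm Sphere) :=
  {σ | σ ∈ F.reflectionGroup ∧ (σ : Sphere → Sphere) '' F.baseCircle = F.baseCircle ∧
    ∃ g : GL (Fin 2) ℂ, σ = MulAction.toPerm g}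

/-- The circle packing: the images of the circles of the configuration under the reflection
group. -/
def packing : Set (Set Sphere) :=
  {C | ∃ σ ∈ F.reflectionGroup, ∃ i, C = (σ : Sphere → Sphere) '' (F.circ i).carrier}

/-- `F.IsTangentCircle T C x`: `C` is a circle of the packing, of curvature at most `T`, which is
tangent to the base circle at the real point `x`. -/
def IsTangentCircle (T : ℝ) (C : Set Sphere) (x : ℝ) : Prop :=
  C ∈ F.packing ∧ (∃ O : GenCircle, O.carrier = C ∧ O.curvature ≤ T) ∧
    C ∩ F.baseCircle = {((x : ℂ) : Sphere)}

/-- The set of (finite) points of tangency of the circles of curvature at most `T`. -/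
def tangencies (T : ℝ) : Set ℝ := {x | ∃ C, F.IsTangentCircle T C x}

/-- The circles `C` and `C'` are neighbours: both have curvature at most `T`, and their points of
tangency with the base line are different, with no other element of `F.tangencies T` between
them. -/
def AreNeighbours (T : ℝ) (C C' : Set Sphere) : Prop :=
  ∃ x y : ℝ, F.IsTangentCircle T C x ∧ F.IsTangentCircle T C' y ∧ x ≠ y ∧
    ∀ z ∈ F.tangencies T, ¬ (min x y < z ∧ z < max x y)

/-- The circles of the configuration that are tangent to the base circle. -/
def K0 : Set (Label F.n) := {i | F.Tangent i .base}

/-- `O` is the dual circle of a triangular gap bounded by the base circle and the circles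
`i` and `j`. -/
def IsDual (i j : Label F.n) (O : GenCircle) : Prop := ∃ B, F.IsTriangularGap .base i j O B

/-- The circles `i` and `j` are tangent and bound a triangular gap together with the base circle. -/
def Adjacent (i j : Label F.n) : Prop := ∃ O, F.IsDual i j O

/-- The point of tangency with the real line of a circle of radius `r` centred at `α + r i`. -/
def alpha (v : Fin F.n) : ℝ := (F.center v).re

/-- The quadratic form `(c α + d)² / r` of a circle of the configuration, resp. `2 c²` for the line
`Im z = 1`. -/
def form (c d : ℝ) : Label F.n → ℝ
  | .base => 0
  | .top => 2 * c ^ 2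
  | .inner v => (c * F.alpha v + d) ^ 2 / F.radius v

/-- The image of the circle `k` under the reflection in `O` is a circle `C(α' + r' i, r')` with
`(c α' + d)² / r' > T`. -/
def ReflectedBound (T c d : ℝ) (O : GenCircle) (k : Label F.n) : Prop :=
  ∃ (α' r' : ℝ) (hr : 0 < r'),
    (O.reflection : Sphere → Sphere) '' (F.circ k).carrier =
      (GenCircle.circle ((α' : ℂ) + (r' : ℂ) * Complex.I) r' hr).carrier ∧
    T < (c * α' + d) ^ 2 / r'

/-- The point of tangency of the circle `k` lies strictly between two real numbers. -/
def Between (k : Label F.n) (x y : ℝ) : Prop :=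
  ∃ u, k = .inner u ∧ min x y < F.alpha u ∧ F.alpha u < max x y

/-- The region for two circles with finite points of tangency. -/
def OmegaFin (T : ℝ) (v w : Fin F.n) : Set (ℝ × ℝ) :=
  {p | ∃ c d : ℝ, p = (c, d) ∧ 0 ≤ c ∧
    (c * F.alpha v + d) ^ 2 / F.radius v ≤ T ∧ (c * F.alpha w + d) ^ 2 / F.radius w ≤ T ∧
    (F.Adjacent (.inner v) (.inner w) →
      ((c * F.alpha v + d) * (c * F.alpha w + d) < 0 →
        2 * c ^ 2 > T ∧ ∀ u, u ≠ v → u ≠ w → .inner u ∈ F.K0 →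
          (c * F.alpha u + d) ^ 2 / F.radius u > T) ∧
      ((c * F.alpha v + d) * (c * F.alpha w + d) > 0 →
        ∀ O, F.IsDual (.inner v) (.inner w) O →
          ∀ k ∈ F.K0, k ≠ .inner v → k ≠ .inner w → F.ReflectedBound T c d O k)) ∧
    (¬ F.Adjacent (.inner v) (.inner w) →
      ∀ k ∈ F.K0, k ≠ .inner v → k ≠ .inner w →
        (F.Between k (F.alpha v) (F.alpha w) ∧
            (c * F.alpha v + d) * (c * F.alpha w + d) > 0 ∨
          ¬ F.Between k (F.alpha v) (F.alpha w) ∧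
            (c * F.alpha v + d) * (c * F.alpha w + d) < 0) →
        F.form c d k > T)}

/-- The region for a circle with a finite point of tangency and the line `Im z = 1`. -/
def OmegaInf (T : ℝ) (v : Fin F.n) : Set (ℝ × ℝ) :=
  {p | ∃ c d : ℝ, p = (c, d) ∧ 0 ≤ c ∧
    (c * F.alpha v + d) ^ 2 / F.radius v ≤ T ∧ 2 * c ^ 2 ≤ T ∧
    (F.Adjacent (.inner v) .top →
      (F.alpha v = 0 ∧ d > 0 ∨ F.alpha v = F.t / 2 ∧ c * F.t / 2 + d < 0 →
        ∀ u, u ≠ v → .inner u ∈ F.K0 → (c * F.alpha u + d) ^ 2 / F.radius u > T) ∧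
      (F.alpha v = 0 ∧ d < 0 ∨ F.alpha v = F.t / 2 ∧ c * F.t / 2 + d > 0 →
        ∀ O, F.IsDual (.inner v) .top O →
          ∀ u, u ≠ v → .inner u ∈ F.K0 → F.ReflectedBound T c d O (.inner u))) ∧
    (¬ F.Adjacent (.inner v) .top →
      ∀ u, u ≠ v → .inner u ∈ F.K0 →
        (F.alpha u > F.alpha v ∧ c * F.alpha v + d > 0 ∨
          F.alpha u < F.alpha v ∧ c * F.alpha v + d < 0) →
        (c * F.alpha u + d) ^ 2 / F.radius u > T)}

/-- The region attached to a pair of circles of the configuration tangent to the base circle. -/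
def Omega (T : ℝ) : Label F.n → Label F.n → Set (ℝ × ℝ)
  | .inner v, .inner w => F.OmegaFin T v w
  | .inner v, .top => F.OmegaInf T v
  | .top, .inner w => F.OmegaInf T w
  | _, _ => ∅

end FordConfiguration

end

/-! Circles become unit vectors of a Lorentzian space, with `prod` equal to 0 for orthogonal
circles, -1 for externally tangent ones and at most -1 for discs with disjoint interiors.
Reflections of the sphere become the linear maps `reflect`, real Möbius maps become `moebius`, and
for a circle touching the real line from above the coordinate 0 is the curvature. Since `moebius γ
(F.labelVec k) 0 = F.form c d k` for `k` in `K0`, every inequality on a form is a bound on the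
curvature of a circle `γ(C_k)`.

Two geometric facts carry the proof. By ping-pong (`wordOrbit_invariant`), a circle of the packing
is either a circle of the configuration or disjoint from all of them up to tangency. By
`exists_alpha_eq_or_exists_gap`, every real point is a point of tangency of the configuration or
lies inside the dual circle of a gap at the base. Hence a circle `u` of the packing that touches the
base either belongs to the configuration or sits in such a gap (`eq_or_exists_gap`).

Suppose the image of `u` touches the line between those of `C_i` and `C_j`, and `u` sits in the gap
with sides `k`, `k'`. Expanding `u` in the basis formed by the three circles of the gap and their
dual circle shows that the images of `k` and `k'` are at least as large as that of `u`
(`le_of_gap`). A side different from `i`, `j` also touches the line between them (`contact_of_gap`).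
So if `i`, `j` are not adjacent, only circles of the configuration can be the largest obstruction.

If `i`, `j` bound a gap with dual vector `b`, the image of the dual circle meets the line in the two
points of tangency, and the sign of `moebius γ b 0` tells which arc belongs to the gap. When it is
negative, all other circles of the configuration land between the two points and form the
obstruction. When it is positive, the gap lies between them, and reflecting in `b` reduces to the
negative case; this gives the reflected forms. Both cases are `forall_not_between_iff`. What remains
is to rewrite signs and positions through `c α + d`, and to treat `c = 0`, where the image of the
upper line touches the real line at infinity. The scaling statement holds because all forms are
homogeneous quadratic and all sign conditions are invariant under positive scaling. -/

noncomputable section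

/-! ### Circles as vectors of a Lorentzian space

An oriented circle `{z | A |z|² - 2 X Re z - 2 Y Im z + C = 0}` is encoded by the vector
`(A, X, Y, C)`, normalized by `X² + Y² - A C = 1`; its disc is the set where the equation is
negative. -/

/-- Coefficient vectors `(A, X, Y, C)` of circle equations. -/
abbrev CircleVec : Type := Fin 4 → ℝ

namespace CircleVec

/-- The Lorentzian form on coefficient vectors. -/
def prod (v w : CircleVec) : ℝ := v 1 * w 1 + v 2 * w 2 - (v 0 * w 3 + v 3 * w 0) / 2

/-- The left-hand side of the circle equation. -/
def eval (v : CircleVec) (z : ℂ) : ℝ :=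
  v 0 * (z.re ^ 2 + z.im ^ 2) - 2 * v 1 * z.re - 2 * v 2 * z.im + v 3

/-- The points of the Riemann sphere that satisfy the circle equation. -/
def zeroSet (v : CircleVec) : Set Sphere := {p | p.elim (v 0 = 0) fun z => eval v z = 0}

@[simp] theorem infty_mem_zeroSet {v : CircleVec} : OnePoint.infty ∈ zeroSet v ↔ v 0 = 0 := Iff.rfl

@[simp] theorem coe_mem_zeroSet {v : CircleVec} {z : ℂ} :
    ((z : ℂ) : Sphere) ∈ zeroSet v ↔ eval v z = 0 := Iff.rfl

theorem ext_coords {v w : CircleVec} (h0 : v 0 = w 0) (h1 : v 1 = w 1) (h2 : v 2 = w 2)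
    (h3 : v 3 = w 3) : v = w := by
  ext i; fin_cases i <;> assumption

theorem prod_comm (v w : CircleVec) : prod v w = prod w v := by simp only [prod]; ring

theorem prod_add (u v w : CircleVec) : prod u (v + w) = prod u v + prod u w := by
  simp only [prod, Pi.add_apply]; ring

theorem prod_smul (u v : CircleVec) (s : ℝ) : prod u (s • v) = s * prod u v := by
  simp only [prod, Pi.smul_apply, smul_eq_mul]; ring

theorem prod_sub (u v w : CircleVec) : prod u (v - w) = prod u v - prod u w := by
  simp only [prod, Pi.sub_apply]; ring

theorem prod_neg (u v : CircleVec) : prod u (-v) = -prod u v := by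
  simp only [prod, Pi.neg_apply]; ring

theorem neg_prod (u v : CircleVec) : prod (-u) v = -prod u v := by
  simp only [prod, Pi.neg_apply]; ring

theorem eval_neg (v : CircleVec) (z : ℂ) : eval (-v) z = -eval v z := by
  simp only [eval, Pi.neg_apply]; ring

theorem zeroSet_neg (v : CircleVec) : zeroSet (-v) = zeroSet v := by
  ext p
  induction p using OnePoint.rec <;> simp [eval_neg]

/-- The reflection in the hyperplane orthogonal to a unit vector. -/
def reflect (b v : CircleVec) : CircleVec := v - (2 * prod v b) • b

theorem prod_reflect (u b v : CircleVec) : prod u (reflect b v) = prod u v - 2 * prod v b * prod u b := by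
  rw [reflect, prod_sub, prod_smul]

theorem reflect_prod (u b v : CircleVec) : prod (reflect b v) u = prod v u - 2 * prod v b * prod b u := by
  rw [prod_comm, prod_reflect, prod_comm u v, prod_comm u b]

theorem prod_reflect_self {b : CircleVec} (hb : prod b b = 1) (v : CircleVec) :
    prod (reflect b v) b = -prod v b := by
  rw [reflect_prod, hb]; ring

theorem reflect_prod_reflect {b : CircleVec} (hb : prod b b = 1) (v w : CircleVec) :
    prod (reflect b v) (reflect b w) = prod v w := by
  rw [prod_reflect, prod_reflect_self hb, reflect_prod, prod_comm w b]; ring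

theorem eval_reflect (b v : CircleVec) (z : ℂ) :
    eval (reflect b v) z = eval v z - 2 * prod v b * eval b z := by
  simp only [eval, reflect, Pi.sub_apply, Pi.smul_apply, smul_eq_mul]; ring

theorem reflect_reflect {b : CircleVec} (hb : prod b b = 1) (v : CircleVec) : reflect b (reflect b v) = v := by
  rw [reflect, prod_reflect_self hb, reflect]
  ext i; simp

theorem reflect_eq_self {b v : CircleVec} (h : prod v b = 0) : reflect b v = v := by
  simp [reflect, h]

theorem reflect_neg (b v : CircleVec) : reflect (-b) v = reflect b v := by
  rw [reflect, reflect, prod_neg]; ext i; simp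

/-- Unit vectors with the same zero set agree up to sign. -/
theorem eq_or_eq_neg_of_zeroSet_eq {v w : CircleVec} (hv : prod v v = 1) (hw : prod w w = 1)
    (h : zeroSet v = zeroSet w) : w = v ∨ w = -v := by
  have key : ∀ z : ℂ, eval v z = 0 → eval w z = 0 := fun z hz => by
    have : ((z : ℂ) : Sphere) ∈ zeroSet w := h ▸ (coe_mem_zeroSet.mpr hz)
    simpa using this
  have h0 : v 0 = 0 → w 0 = 0 := fun h0 => by
    have : OnePoint.infty ∈ zeroSet w := h ▸ (infty_mem_zeroSet.mpr h0)
    simpa using this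
  -- Proportionality is enough, since two proportional unit vectors differ by a factor of square
  -- one.
  have sgn : ∀ s : ℝ, w = s • v → w = v ∨ w = -v := by
    rintro s rfl
    rw [prod_smul, prod_comm, prod_smul, hv] at hw
    have : (s - 1) * (s + 1) = 0 := by linarith
    rcases mul_eq_zero.mp this with h | h
    · left; rw [show s = 1 by linarith, one_smul]
    · right; rw [show s = -1 by linarith, neg_one_smul]
  by_cases hA : v 0 = 0
  · have hB := h0 hA
    simp only [prod, hA, hB] at hv hw
    -- The foot of the perpendicular from 0 to the line, moved by one unit in either direction along
    -- the line.
    have e1 := key ⟨v 3 / 2 * v 1 - v 2, v 3 / 2 * v 2 + v 1⟩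
      (by simp only [eval, hA]; linear_combination (-v 3) * hv)
    have e2 := key ⟨v 3 / 2 * v 1 + v 2, v 3 / 2 * v 2 - v 1⟩
      (by simp only [eval, hA]; linear_combination (-v 3) * hv)
    simp only [eval, hB] at e1 e2
    have e3 : w 1 * v 2 = w 2 * v 1 := by linarith
    refine sgn (w 1 * v 1 + w 2 * v 2) (ext_coords ?_ ?_ ?_ ?_)
    · simp [hA, hB]
    · simp only [Pi.smul_apply, smul_eq_mul]
      linear_combination (-w 1) * hv + v 2 * e3
    · simp only [Pi.smul_apply, smul_eq_mul]
      linear_combination (-w 2) * hv - v 1 * e3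
    · simp only [Pi.smul_apply, smul_eq_mul]
      linarith
  · simp only [prod] at hv
    -- The four extreme points of the circle: its centre is `(v 1 / v 0, v 2 / v 0)` and its radius
    -- is `1 / |v 0|`.
    have e1 := key ⟨(v 1 + 1) / v 0, v 2 / v 0⟩
      (by simp only [eval]; field_simp; linear_combination (-1) * hv)
    have e2 := key ⟨(v 1 - 1) / v 0, v 2 / v 0⟩
      (by simp only [eval]; field_simp; linear_combination (-1) * hv)
    have e3 := key ⟨v 1 / v 0, (v 2 + 1) / v 0⟩
      (by simp only [eval]; field_simp; linear_combination (-1) * hv)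
    have e4 := key ⟨v 1 / v 0, (v 2 - 1) / v 0⟩
      (by simp only [eval]; field_simp; linear_combination (-1) * hv)
    simp only [eval] at e1 e2 e3 e4
    field_simp at e1 e2 e3 e4
    have f1 : w 1 = w 0 / v 0 * v 1 := by
      field_simp; linarith
    have f2 : w 2 = w 0 / v 0 * v 2 := by
      field_simp; linarith
    refine sgn (w 0 / v 0) (ext_coords ?_ ?_ ?_ ?_)
    · simp; field_simp
    · simpa using f1
    · simpa using f2
    · simp only [Pi.smul_apply, smul_eq_mul]
      rw [f1, f2] at e1
      field_simp at e1 ⊢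
      apply mul_left_cancel₀ hA
      linear_combination e1 + w 0 * hv

/-- Two unit vectors with product at most `-1` and a common point are tangent there: every circle
through this point has opposite products with them. -/
theorem prod_add_prod_eq_zero {v w b : CircleVec} (hv : prod v v = 1) (hw : prod w w = 1)
    (hvw : prod v w ≤ -1) {p : Sphere} (hpv : p ∈ zeroSet v) (hpw : p ∈ zeroSet w)
    (hpb : p ∈ zeroSet b) : prod v w = -1 ∧ prod b v + prod b w = 0 := by
  induction p using OnePoint.rec with
  | infty =>
    simp only [infty_mem_zeroSet] at hpv hpw hpb
    simp only [prod, hpv, hpw, hpb] at *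
    have h1 : (v 1 + w 1) ^ 2 + (v 2 + w 2) ^ 2 ≤ 0 := by nlinarith
    have h2 : v 1 + w 1 = 0 := by nlinarith [sq_nonneg (v 1 + w 1), sq_nonneg (v 2 + w 2)]
    have h3 : v 2 + w 2 = 0 := by nlinarith [sq_nonneg (v 1 + w 1), sq_nonneg (v 2 + w 2)]
    have h4 : w 1 = -v 1 := by linarith
    have h5 : w 2 = -v 2 := by linarith
    rw [h4, h5] at *
    constructor <;> linarith
  | coe z =>
    simp only [coe_mem_zeroSet, eval] at hpv hpw hpb
    have hv3 : v 3 = 2 * v 1 * z.re + 2 * v 2 * z.im - v 0 * (z.re ^ 2 + z.im ^ 2) := by linarith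
    have hw3 : w 3 = 2 * w 1 * z.re + 2 * w 2 * z.im - w 0 * (z.re ^ 2 + z.im ^ 2) := by linarith
    have hb3 : b 3 = 2 * b 1 * z.re + 2 * b 2 * z.im - b 0 * (z.re ^ 2 + z.im ^ 2) := by linarith
    simp only [prod, hv3, hw3, hb3] at *
    set x := z.re
    set y := z.im
    -- On vectors of circles through a fixed point `z`, the form is the Euclidean product of the
    -- normals `(v 1 - v 0 x, v 2 - v 0 y)`. Two Euclidean unit vectors with product at most -1 are
    -- opposite.
    have h1 : (v 1 - v 0 * x + (w 1 - w 0 * x)) ^ 2 + (v 2 - v 0 * y + (w 2 - w 0 * y)) ^ 2 ≤ 0 := by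
      nlinarith
    have h2 : w 1 = -v 1 + v 0 * x + w 0 * x := by
      nlinarith [sq_nonneg (v 1 - v 0 * x + (w 1 - w 0 * x)),
        sq_nonneg (v 2 - v 0 * y + (w 2 - w 0 * y))]
    have h3 : w 2 = -v 2 + v 0 * y + w 0 * y := by
      nlinarith [sq_nonneg (v 1 - v 0 * x + (w 1 - w 0 * x)),
        sq_nonneg (v 2 - v 0 * y + (w 2 - w 0 * y))]
    rw [h2, h3] at *
    constructor
    · linarith
    · ring

/-- The expansion of a vector with respect to three mutually tangent circles and their dual
circle. -/
theorem expansion {w₁ w₂ w₃ b : CircleVec} (h₁ : prod w₁ w₁ = 1) (h₂ : prod w₂ w₂ = 1)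
    (h₃ : prod w₃ w₃ = 1) (hb : prod b b = 1) (h₁₂ : prod w₁ w₂ = -1) (h₂₃ : prod w₂ w₃ = -1)
    (h₁₃ : prod w₁ w₃ = -1) (hb₁ : prod b w₁ = 0) (hb₂ : prod b w₂ = 0) (hb₃ : prod b w₃ = 0)
    (u : CircleVec) :
    u = (-(prod u w₂ + prod u w₃) / 2) • w₁ + (-(prod u w₁ + prod u w₃) / 2) • w₂ +
      (-(prod u w₁ + prod u w₂) / 2) • w₃ + prod u b • b := by
  let W : Matrix (Fin 4) (Fin 4) ℝ := Matrix.of ![w₁, w₂, w₃, b]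
  let J : Matrix (Fin 4) (Fin 4) ℝ :=
    !![0, 0, 0, -1/2; 0, 1, 0, 0; 0, 0, 1, 0; -1/2, 0, 0, 0]
  have hW : ∀ i j, (W * J * W.transpose) i j = prod (W i) (W j) := by
    intro i j
    simp [J, Matrix.mul_apply, Fin.sum_univ_four, prod]
    ring
  have e1 := (prod_comm w₂ w₁).trans h₁₂
  have e2 := (prod_comm w₃ w₂).trans h₂₃
  have e3 := (prod_comm w₃ w₁).trans h₁₃
  have e4 := (prod_comm w₁ b).trans hb₁
  have e5 := (prod_comm w₂ b).trans hb₂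
  have e6 := (prod_comm w₃ b).trans hb₃
  have hG : W * J * W.transpose = !![1, -1, -1, 0; -1, 1, -1, 0; -1, -1, 1, 0; 0, 0, 0, 1] := by
    ext i j
    rw [hW]
    fin_cases i <;> fin_cases j
    exacts [h₁, h₁₂, h₁₃, e4, e1, h₂, h₂₃, e5, e3, e2, h₃, e6, hb₁, hb₂, hb₃, hb]
  -- The Gram matrix has determinant -4, so the four vectors form a basis; it suffices to compare
  -- products with them. The coefficients in the statement come from the inverse Gram matrix.
  have hdet : (W * J).det ≠ 0 := by
    intro h
    have := congrArg Matrix.det hG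
    rw [Matrix.det_mul, h, zero_mul] at this
    simp [Matrix.det_succ_row_zero, Fin.sum_univ_succ, Fin.succAbove] at this
    norm_num at this
  rw [← sub_eq_zero]
  refine Matrix.eq_zero_of_mulVec_eq_zero hdet ?_
  have hp : ∀ (i : Fin 4) (v : CircleVec), (W * J).mulVec v i = prod (W i) v := by
    intro i v
    simp [J, Matrix.mulVec, dotProduct, Matrix.mul_apply, Fin.sum_univ_four, prod]
    ring
  funext i
  rw [hp]
  have cases : W i = w₁ ∨ W i = w₂ ∨ W i = w₃ ∨ W i = b := by
    fin_cases i
    exacts [Or.inl rfl, Or.inr (Or.inl rfl), Or.inr (Or.inr (Or.inl rfl)),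
      Or.inr (Or.inr (Or.inr rfl))]
  rcases cases with h | h | h | h <;> rw [h] <;>
    simp only [prod_sub, prod_add, prod_smul, prod_comm u, h₁, h₂, h₃, hb, h₁₂, h₂₃, h₁₃, hb₁, hb₂,
      hb₃, e1, e2, e3, e4, e5, e6, Pi.zero_apply] <;> ring

theorem image_zeroSet {σ : Equiv.Perm Sphere} {v w : CircleVec}
    (h : ∀ p, σ p ∈ zeroSet w ↔ p ∈ zeroSet v) : (σ : Sphere → Sphere) '' zeroSet v = zeroSet w := by
  ext q
  obtain ⟨p, rfl⟩ := σ.surjective q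
  rw [σ.injective.mem_set_image, h]

end CircleVec

open CircleVec

/-! ### Unit vectors of circles, and reflections of the sphere as vector reflections -/

namespace GenCircle

/-- The unit vector of a circle, for which the disc `inside` is the negative side. -/
def vec : GenCircle → CircleVec
  | circle z r _ => ![1 / r, z.re / r, z.im / r, (z.re ^ 2 + z.im ^ 2 - r ^ 2) / r]
  | line p v _ => ![0, -v.im / ‖v‖, v.re / ‖v‖, 2 * (p.im * v.re - p.re * v.im) / ‖v‖]

theorem eval_vec_circle (z : ℂ) (r : ℝ) (hr : 0 < r) (w : ℂ) :
    eval (circle z r hr).vec w = ((w.re - z.re) ^ 2 + (w.im - z.im) ^ 2 - r ^ 2) / r := by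
  simp [eval, vec]
  field_simp
  ring

theorem norm_sq_eq (v : ℂ) : ‖v‖ ^ 2 = v.re ^ 2 + v.im ^ 2 := by
  rw [Complex.sq_norm, Complex.normSq_apply]; ring

theorem eval_vec_line (p v : ℂ) (hv : v ≠ 0) (w : ℂ) :
    eval (line p v hv).vec w = -2 * ‖v‖ * ((w - p) / v).im := by
  have hn : ‖v‖ ≠ 0 := norm_ne_zero_iff.mpr hv
  have h := norm_sq_eq v
  simp [eval, vec, Complex.div_im, Complex.normSq_apply]
  rw [show v.re * v.re + v.im * v.im = ‖v‖ ^ 2 by rw [h]; ring]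
  field_simp
  ring

theorem prod_vec_self (O : GenCircle) : prod O.vec O.vec = 1 := by
  cases O with
  | circle z r hr => simp [prod, vec]; field_simp; ring
  | line p v hv =>
    have hn : ‖v‖ ≠ 0 := norm_ne_zero_iff.mpr hv
    have h := norm_sq_eq v
    simp [prod, vec]
    field_simp
    linarith

theorem curvature_eq (O : GenCircle) : O.curvature = |O.vec 0| := by
  cases O with
  | circle z r hr => simp [curvature, vec, abs_of_pos hr]
  | line p v hv => simp [curvature, vec]

theorem dist_sq_eq (w z : ℂ) : dist w z ^ 2 = (w.re - z.re) ^ 2 + (w.im - z.im) ^ 2 := by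
  rw [Complex.dist_eq, norm_sq_eq]; simp

theorem coe_mem_inside (O : GenCircle) (w : ℂ) : (w : Sphere) ∈ O.inside ↔ eval O.vec w < 0 := by
  cases O with
  | circle z r hr =>
    rw [eval_vec_circle, ← dist_sq_eq, div_lt_iff₀ hr, zero_mul]
    simp only [inside, Set.mem_image, OnePoint.coe_eq_coe, exists_eq_right, Metric.mem_ball]
    rw [sub_neg, sq_lt_sq₀ dist_nonneg hr.le]
  | line p v hv =>
    have hn : 0 < ‖v‖ := norm_pos_iff.mpr hv
    rw [eval_vec_line]
    simp only [inside, Set.mem_image, OnePoint.coe_eq_coe, exists_eq_right, Set.mem_ofPred_eq]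
    constructor
    · intro h; nlinarith [mul_pos hn h]
    · intro h; by_contra! h'; nlinarith [mul_nonneg hn.le (neg_nonneg.mpr h')]

theorem carrier_eq (O : GenCircle) : O.carrier = zeroSet O.vec := by
  ext p
  cases O with
  | circle z r hr =>
    induction p using OnePoint.rec with
    | infty => simp [carrier, vec, hr.ne']
    | coe w =>
      rw [coe_mem_zeroSet, eval_vec_circle, ← dist_sq_eq, div_eq_zero_iff, or_iff_left hr.ne',
        sub_eq_zero]
      simp only [carrier, Set.mem_image, OnePoint.coe_eq_coe, exists_eq_right, Metric.mem_sphere]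
      rw [sq_eq_sq₀ dist_nonneg hr.le]
  | line q v hv =>
    induction p using OnePoint.rec with
    | infty => simp [carrier, vec]
    | coe w =>
      have hn : ‖v‖ ≠ 0 := norm_ne_zero_iff.mpr hv
      rw [coe_mem_zeroSet, eval_vec_line]
      simp [carrier, hv]

theorem coe_mem_outside (O : GenCircle) (w : ℂ) : (w : Sphere) ∈ O.outside ↔ 0 < eval O.vec w := by
  rw [outside, Set.mem_compl_iff, Set.mem_union, carrier_eq, coe_mem_inside, coe_mem_zeroSet, not_or,
    not_lt]
  constructor
  · rintro ⟨h1, h2⟩; exact lt_of_le_of_ne h2 (Ne.symm h1)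
  · intro h; exact ⟨h.ne', h.le⟩

/-- This is the link between the sphere and the Lorentzian space. An inversion multiplies the circle
equation by the nonvanishing factor `r² / |w - z|²` once the coefficient vector is reflected; a
reflection in a line leaves its value unchanged. The centre of an inversion and infinity are
exchanged, which requires separate cases. -/
theorem reflection_mem_zeroSet (O : GenCircle) (v : CircleVec) (p : Sphere) :
    O.reflection p ∈ zeroSet (reflect O.vec v) ↔ p ∈ zeroSet v := by
  change O.reflFun p ∈ _ ↔ _
  cases O with
  | circle z r hr =>
    induction p using OnePoint.rec with
    | infty =>
      simp only [reflFun, OnePoint.elim_infty, coe_mem_zeroSet, infty_mem_zeroSet]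
      have : eval (reflect (circle z r hr).vec v) z = r ^ 2 * v 0 := by
        simp [eval, reflect, vec, prod]
        field_simp
        ring
      rw [this]
      simp [hr.ne']
    | coe w =>
      by_cases h : w = z
      · subst h
        simp only [reflFun, OnePoint.elim_some, if_true, coe_mem_zeroSet, infty_mem_zeroSet]
        have : reflect (circle w r hr).vec v 0 = eval v w / r ^ 2 := by
          simp [eval, reflect, vec, prod]
          field_simp
          ring
        rw [this]
        simp [hr.ne']
      · simp only [reflFun, OnePoint.elim_some, h, if_false, coe_mem_zeroSet]
        have hD : (w.re - z.re) ^ 2 + (w.im - z.im) ^ 2 ≠ 0 := by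
          rw [← dist_sq_eq]
          exact pow_ne_zero 2 (dist_ne_zero.mpr h)
        have hD' : (w.re - z.re) * (w.re - z.re) + (w.im - z.im) * (w.im - z.im) ≠ 0 := by
          simpa only [sq] using hD
        set u : ℂ := z + (r : ℂ) ^ 2 / (starRingEnd ℂ) (w - z) with hu
        have hu' : u = z + ((r ^ 2 / ((w.re - z.re) ^ 2 + (w.im - z.im) ^ 2) : ℝ) : ℂ) * (w - z) := by
          have h1 : (starRingEnd ℂ) (w - z) ≠ 0 := (map_ne_zero _).mpr (sub_ne_zero.mpr h)
          have h2 : (w - z) * (starRingEnd ℂ) (w - z) =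
              (((w.re - z.re) ^ 2 + (w.im - z.im) ^ 2 : ℝ) : ℂ) := by
            rw [Complex.mul_conj, Complex.normSq_apply]; simp [sq]
          rw [hu, Complex.ofReal_div, ← h2]
          have h3 : w - z ≠ 0 := sub_ne_zero.mpr h
          push_cast
          field_simp
        have hre : u.re = z.re + r ^ 2 / ((w.re - z.re) ^ 2 + (w.im - z.im) ^ 2) * (w.re - z.re) := by
          rw [hu']; simp only [Complex.add_re, Complex.re_ofReal_mul, Complex.sub_re]
        have him : u.im = z.im + r ^ 2 / ((w.re - z.re) ^ 2 + (w.im - z.im) ^ 2) * (w.im - z.im) := by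
          rw [hu']; simp only [Complex.add_im, Complex.im_ofReal_mul, Complex.sub_im]
        have key : eval (reflect (circle z r hr).vec v) u *
            ((w.re - z.re) ^ 2 + (w.im - z.im) ^ 2) = r ^ 2 * eval v w := by
          rw [eval_reflect, eval_vec_circle]
          simp only [eval, hre, him]
          simp [vec, prod]
          field_simp
          ring
        constructor
        · intro h0
          rw [h0, zero_mul] at key
          exact (mul_eq_zero.mp key.symm).resolve_left (pow_ne_zero 2 hr.ne')
        · intro h0
          rw [h0, mul_zero] at key
          exact (mul_eq_zero.mp key).resolve_right hD
  | line q d hd =>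
    induction p using OnePoint.rec with
    | infty =>
      simp [reflFun, reflect, vec]
      exact Iff.rfl
    | coe w =>
      simp only [reflFun, OnePoint.elim_some, coe_mem_zeroSet]
      have hn : ‖d‖ ≠ 0 := norm_ne_zero_iff.mpr hd
      have hN := norm_sq_eq d
      have hN0 : d.re ^ 2 + d.im ^ 2 ≠ 0 := hN ▸ pow_ne_zero 2 hn
      have hN' : d.re * d.re + d.im * d.im ≠ 0 := by simpa only [sq] using hN0
      set u : ℂ := q + d / (starRingEnd ℂ) d * (starRingEnd ℂ) (w - q) with hu
      have hu' : u = q + ((1 / (d.re ^ 2 + d.im ^ 2) : ℝ) : ℂ) * (d * d * (starRingEnd ℂ) (w - q)) := by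
        have h1 : (starRingEnd ℂ) d ≠ 0 := (map_ne_zero _).mpr hd
        have h2 : d * (starRingEnd ℂ) d = ((d.re ^ 2 + d.im ^ 2 : ℝ) : ℂ) := by
          rw [Complex.mul_conj, Complex.normSq_apply]; simp [sq]
        rw [hu, Complex.ofReal_div, ← h2]
        push_cast
        field_simp
      have hre : u.re = q.re + 1 / (d.re ^ 2 + d.im ^ 2) * ((d.re ^ 2 - d.im ^ 2) * (w.re - q.re) +
          2 * d.re * d.im * (w.im - q.im)) := by
        rw [hu', Complex.add_re, Complex.re_ofReal_mul]
        simp only [Complex.mul_re, Complex.mul_im, Complex.conj_re, Complex.conj_im, Complex.sub_re,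
          Complex.sub_im]
        ring
      have him : u.im = q.im + 1 / (d.re ^ 2 + d.im ^ 2) * (2 * d.re * d.im * (w.re - q.re) -
          (d.re ^ 2 - d.im ^ 2) * (w.im - q.im)) := by
        rw [hu', Complex.add_im, Complex.im_ofReal_mul]
        simp only [Complex.mul_re, Complex.mul_im, Complex.conj_re, Complex.conj_im, Complex.sub_re,
          Complex.sub_im]
        ring
      have key : eval (reflect (line q d hd).vec v) u = eval v w := by
        have h1 : 2 * prod v (line q d hd).vec * eval (line q d hd).vec u =
            2 * (v 2 * d.re - v 1 * d.im - v 0 * (q.im * d.re - q.re * d.im)) *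
            (2 * (q.im * d.re - q.re * d.im) + 2 * d.im * u.re - 2 * d.re * u.im) /
            (d.re ^ 2 + d.im ^ 2) := by
          rw [← hN]
          simp [eval, vec, prod]
          field_simp
          ring
        rw [eval_reflect, h1]
        simp only [eval, hre, him]
        field_simp
        ring
      rw [key]

theorem reflection_image (O : GenCircle) (v : CircleVec) :
    (O.reflection : Sphere → Sphere) '' zeroSet v = zeroSet (reflect O.vec v) :=
  image_zeroSet (O.reflection_mem_zeroSet v)

end GenCircle

/-! ### Real Möbius transformations acting on circle vectors -/

namespace CircleVec

/-- The action of `SL(2, ℝ)` on circle vectors. -/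
def moebius (γ : SL(2, ℝ)) (v : CircleVec) : CircleVec :=
  ![v 0 * γ 1 1 ^ 2 + 2 * γ 1 0 * γ 1 1 * v 1 + γ 1 0 ^ 2 * v 3,
    γ 0 1 * γ 1 1 * v 0 + (γ 0 0 * γ 1 1 + γ 0 1 * γ 1 0) * v 1 + γ 0 0 * γ 1 0 * v 3,
    v 2,
    γ 0 1 ^ 2 * v 0 + 2 * γ 0 0 * γ 0 1 * v 1 + γ 0 0 ^ 2 * v 3]

theorem det_eq_one (γ : SL(2, ℝ)) : γ 0 0 * γ 1 1 - γ 0 1 * γ 1 0 = 1 := by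
  have := γ.det_coe
  rwa [Matrix.det_fin_two] at this

theorem moebius_prod_moebius (γ : SL(2, ℝ)) (v w : CircleVec) :
    prod (moebius γ v) (moebius γ w) = prod v w := by
  have h := det_eq_one γ
  simp only [prod, moebius, Matrix.cons_val_zero, Matrix.cons_val_one, Matrix.cons_val]
  generalize γ 0 0 = a at *
  generalize γ 0 1 = b at *
  generalize γ 1 0 = c at *
  generalize γ 1 1 = d at *
  linear_combination (v 1 * w 1 - (v 0 * w 3 + v 3 * w 0) / 2) * (a * d - b * c + 1) * h

theorem mobius_coe (γ : SL(2, ℝ)) (z : ℂ) :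
    mobius γ (z : Sphere) = if (γ 1 0 : ℂ) * z + γ 1 1 = 0 then OnePoint.infty
      else ((((γ 0 0 : ℂ) * z + γ 0 1) / ((γ 1 0 : ℂ) * z + γ 1 1) : ℂ) : Sphere) := by
  rw [mobius, MulAction.toPerm_apply, OnePoint.smul_some_eq_ite]
  simp

theorem mobius_infty (γ : SL(2, ℝ)) :
    mobius γ OnePoint.infty = if (γ 1 0 : ℂ) = 0 then OnePoint.infty
      else (((γ 0 0 : ℂ) / (γ 1 0 : ℂ) : ℂ) : Sphere) := by
  rw [mobius, MulAction.toPerm_apply, OnePoint.smul_infty_eq_ite]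
  simp

/-- Substituting `γ z` into the transformed equation gives the original value divided by `|c z +
d|²`. The pole and the point at infinity are handled by the coordinate 0 of the vectors. -/
theorem mobius_mem_zeroSet (γ : SL(2, ℝ)) (v : CircleVec) (p : Sphere) :
    mobius γ p ∈ zeroSet (moebius γ v) ↔ p ∈ zeroSet v := by
  have h := det_eq_one γ
  induction p using OnePoint.rec with
  | infty =>
    rw [mobius_infty]
    split_ifs with hc
    · have hc' : γ 1 0 = 0 := by exact_mod_cast hc
      rw [hc', mul_zero, sub_zero] at h
      have : γ 1 1 ≠ 0 := right_ne_zero_of_mul_eq_one h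
      simp [moebius, hc', this]
    · have hc' : γ 1 0 ≠ 0 := by exact_mod_cast hc
      rw [coe_mem_zeroSet, infty_mem_zeroSet, ← Complex.ofReal_div]
      have : eval (moebius γ v) ((γ 0 0 / γ 1 0 : ℝ) : ℂ) = v 0 / γ 1 0 ^ 2 := by
        simp [eval, moebius]
        generalize γ 0 0 = a at *
        generalize γ 0 1 = b at *
        generalize γ 1 0 = c at *
        generalize γ 1 1 = d at *
        field_simp
        linear_combination (v 0 * (a * d - b * c + 1)) * h
      rw [this]
      simp [hc']
  | coe z =>
    rw [mobius_coe]
    split_ifs with hz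
    · rw [infty_mem_zeroSet, coe_mem_zeroSet]
      have hre := congrArg Complex.re hz
      have him := congrArg Complex.im hz
      simp at hre him
      have hc : γ 1 0 ≠ 0 := by
        intro h0
        rw [h0, zero_mul, zero_add] at hre
        rw [h0, hre] at h
        simp at h
      have hi : z.im = 0 := him.resolve_left hc
      have : moebius γ v 0 = γ 1 0 ^ 2 * eval v z := by
        have hd : γ 1 1 = -(γ 1 0 * z.re) := by linarith
        simp [eval, moebius, hi, hd]
        ring
      rw [this]
      simp [hc]
    · rw [coe_mem_zeroSet, coe_mem_zeroSet]
      set u : ℂ := ((γ 0 0 : ℂ) * z + γ 0 1) / ((γ 1 0 : ℂ) * z + γ 1 1) with hu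
      have hN : (γ 1 0 * z.re + γ 1 1) ^ 2 + (γ 1 0 * z.im) ^ 2 ≠ 0 := by
        have := (Complex.normSq_pos.mpr hz).ne'
        rw [Complex.normSq_apply] at this
        simpa [sq] using this
      have hre : u.re = ((γ 0 0 * z.re + γ 0 1) * (γ 1 0 * z.re + γ 1 1) +
          γ 0 0 * γ 1 0 * z.im ^ 2) / ((γ 1 0 * z.re + γ 1 1) ^ 2 + (γ 1 0 * z.im) ^ 2) := by
        rw [hu, Complex.div_re, Complex.normSq_apply, ← add_div]
        simp
        congr 1 <;> ring
      have him : u.im = z.im / ((γ 1 0 * z.re + γ 1 1) ^ 2 + (γ 1 0 * z.im) ^ 2) := by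
        rw [hu, Complex.div_im, Complex.normSq_apply, ← sub_div]
        simp
        congr 1
        · linear_combination z.im * h
        · ring
      have key : eval (moebius γ v) u *
          ((γ 1 0 * z.re + γ 1 1) ^ 2 + (γ 1 0 * z.im) ^ 2) = eval v z := by
        simp only [eval, moebius, hre, him, Matrix.cons_val_zero, Matrix.cons_val_one,
          Matrix.cons_val]
        clear hre him hu u hz
        generalize γ 0 0 = a at *
        generalize γ 0 1 = b at *
        generalize γ 1 0 = c at *
        generalize γ 1 1 = d at *
        generalize z.re = x at *
        generalize z.im = y at *
        set N := (c * x + d) ^ 2 + (c * y) ^ 2 with hNdef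
        set P := (a * x + b) * (c * x + d) + a * c * y ^ 2 with hP
        have e : P ^ 2 + y ^ 2 = ((a * x + b) ^ 2 + (a * y) ^ 2) * N := by
          rw [hP, hNdef]
          linear_combination (-y ^ 2) * (a * d - b * c + 1) * h
        have e' : (P / N) ^ 2 + (y / N) ^ 2 = ((a * x + b) ^ 2 + (a * y) ^ 2) / N := by
          rw [div_pow, div_pow, ← add_div, e]
          field_simp
        rw [e']
        field_simp
        rw [hP, hNdef]
        linear_combination (a * d - b * c + 1) * (v 0 * (x ^ 2 + y ^ 2) - 2 * v 1 * x + v 3) * h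
      constructor
      · intro h0
        rw [← key, h0, zero_mul]
      · intro h0
        rw [h0] at key
        exact (mul_eq_zero.mp key).resolve_right hN

theorem mobius_image (γ : SL(2, ℝ)) (v : CircleVec) :
    (mobius γ : Sphere → Sphere) '' zeroSet v = zeroSet (moebius γ v) :=
  image_zeroSet (mobius_mem_zeroSet γ v)

/-! ### Ping-pong -/

/-- The images of `w` under reduced words in the reflections with normal vectors in `G`, together
with the last reflection. -/
inductive WordOrbit (G : Set CircleVec) (w : CircleVec) : Option CircleVec → CircleVec → Prop
  | nil : WordOrbit G w none w
  | cons {x : Option CircleVec} {u b : CircleVec} : WordOrbit G w x u → b ∈ G → x ≠ some b →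
      prod u b ≠ 0 → WordOrbit G w (some b) (reflect b u)

/-- Circles `w` bounding disjoint discs, and dual circles `G` bounding disjoint discs, such that a
circle and a dual circle are orthogonal or bound disjoint discs. -/
structure IsDualSystem {ι : Type*} (w : ι → CircleVec) (G : Set CircleVec) : Prop where
  unit : ∀ i, prod (w i) (w i) = 1
  disjoint : ∀ i j, i ≠ j → prod (w i) (w j) ≤ -1
  dual_unit : ∀ b ∈ G, prod b b = 1
  dual_disjoint : ∀ b ∈ G, ∀ b' ∈ G, b' ≠ b → prod b b' ≤ -1
  orthogonal_or_disjoint : ∀ b ∈ G, ∀ i, prod b (w i) = 0 ∨ prod b (w i) ≤ -1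

namespace IsDualSystem

variable {ι : Type*} {w : ι → CircleVec} {G : Set CircleVec}

/-- Reduced words reach the whole orbit: a further reflection cancels the last letter, fixes the
vector, or prolongs the word. -/
theorem wordOrbit_reflect (h : IsDualSystem w G) {i : ι} {x : Option CircleVec} {v b : CircleVec}
    (hv : WordOrbit G (w i) x v) (hb : b ∈ G) : ∃ y, WordOrbit G (w i) y (reflect b v) := by
  by_cases hx : x = some b
  · subst hx
    cases hv with
    | @cons y u _ hu _ _ _ => exact ⟨y, by rwa [reflect_reflect (h.dual_unit b hb)]⟩
  · by_cases h0 : prod v b = 0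
    · exact ⟨x, by rwa [reflect_eq_self h0]⟩
    · exact ⟨_, .cons hv hb hx h0⟩

theorem wordOrbit_unit (h : IsDualSystem w G) {i : ι} {x : Option CircleVec} {v : CircleVec}
    (hv : WordOrbit G (w i) x v) : prod v v = 1 := by
  induction hv with
  | nil => exact h.unit i
  | cons _ hb _ _ ih => rw [reflect_prod_reflect (h.dual_unit _ hb), ih]

theorem prod_dual_nonpos (h : IsDualSystem w G) {b : CircleVec} (hb : b ∈ G) (i : ι) :
    prod b (w i) ≤ 0 := by
  rcases h.orthogonal_or_disjoint b hb i with h | h <;> linarith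

/-- Ping-pong by induction on the word. After a last letter `b` the circle is on the positive side
of `b` and on the negative side of every other dual circle. A new letter `b` therefore has `prod u b
< 0`, and the correction term `-2 * prod u b * prod b _` only lowers the products with the original
circles and with the other dual circles. The bound by `-prod v b` is what makes the induction close.
-/
theorem wordOrbit_invariant (h : IsDualSystem w G) {i : ι} {x : Option CircleVec} {v : CircleVec}
    (hv : WordOrbit G (w i) x v) :
    (x = none → v = w i) ∧ ∀ b, x = some b → b ∈ G ∧ 0 < prod v b ∧
      (∀ b' ∈ G, b' ≠ b → prod v b' ≤ -prod v b) ∧ ∀ m, prod v (w m) ≤ -1 := by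
  induction hv with
  | nil => exact ⟨fun _ => rfl, fun b hb => by simp at hb⟩
  | @cons x u b hu hb hx h0 ih =>
    refine ⟨fun hn => by simp at hn, fun b₁ hb₁ => ?_⟩
    obtain rfl : b = b₁ := by simpa using hb₁
    have hself := prod_reflect_self (h.dual_unit b hb) u
    rcases x with _ | a
    · obtain rfl := ih.1 rfl
      have hle : prod (w i) b ≤ -1 := by
        rcases h.orthogonal_or_disjoint b hb i with h' | h'
        · exact absurd (by rwa [prod_comm]) h0
        · rwa [prod_comm]
      refine ⟨hb, by linarith, fun b' hb' hne => ?_, fun m => ?_⟩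
      · rw [hself, reflect_prod]
        have h1 := h.dual_disjoint b hb b' hb' hne
        have h2 := h.prod_dual_nonpos hb' i
        rw [prod_comm] at h2
        nlinarith
      · rw [reflect_prod]
        by_cases hm : i = m
        · subst hm
          rw [h.unit, prod_comm b]
          nlinarith
        · have h1 := h.disjoint i m hm
          have h2 := h.prod_dual_nonpos hb m
          nlinarith
    · obtain ⟨ha, hpos, hoth, hm⟩ := ih.2 a rfl
      have hne : b ≠ a := fun e => hx (by rw [e])
      have hba := hoth b hb hne
      refine ⟨hb, by linarith, fun b' hb' hne' => ?_, fun m => ?_⟩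
      · rw [hself, reflect_prod]
        have h1 := h.dual_disjoint b hb b' hb' hne'
        have h2 : prod u b' ≤ -prod u b := by
          by_cases e : b' = a
          · subst e; linarith
          · have := hoth b' hb' e; linarith
        nlinarith
      · rw [reflect_prod]
        have h1 := hm m
        have h2 := h.prod_dual_nonpos hb m
        nlinarith

theorem prod_le_or_eq (h : IsDualSystem w G) {i : ι} {x : Option CircleVec} {v : CircleVec}
    (hv : WordOrbit G (w i) x v) (m : ι) : prod v (w m) ≤ -1 ∨ v = w m := by
  have hi := h.wordOrbit_invariant hv
  rcases x with _ | b
  · rw [hi.1 rfl]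
    by_cases e : i = m
    · right; rw [e]
    · left; exact h.disjoint i m e
  · left; exact (hi.2 b rfl).2.2.2 m

/-- The original circles represent different orbits: after a nonempty word some dual product is
positive, whereas those of the original circles are never positive. -/
theorem eq_of_wordOrbit_eq (h : IsDualSystem w G) {i m : ι} {x : Option CircleVec}
    (hv : WordOrbit G (w i) x (w m)) : i = m := by
  have hi := h.wordOrbit_invariant hv
  rcases x with _ | b
  · by_contra e
    have h1 := h.disjoint i m e
    rw [← hi.1 rfl, h.unit] at h1
    norm_num at h1
  · have h1 := (hi.2 b rfl).2.1
    have h2 := h.prod_dual_nonpos (hi.2 b rfl).1 m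
    rw [prod_comm] at h2
    linarith

end IsDualSystem

/-! ### Dual circles of triples of mutually tangent circles -/

/-- `b` is orthogonal to three mutually tangent circles. -/
structure IsDualTriple (w₁ w₂ w₃ b : CircleVec) : Prop where
  unit₁ : prod w₁ w₁ = 1
  unit₂ : prod w₂ w₂ = 1
  unit₃ : prod w₃ w₃ = 1
  dual_unit : prod b b = 1
  tangent₁₂ : prod w₁ w₂ = -1
  tangent₂₃ : prod w₂ w₃ = -1
  tangent₁₃ : prod w₁ w₃ = -1
  orthogonal₁ : prod b w₁ = 0
  orthogonal₂ : prod b w₂ = 0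
  orthogonal₃ : prod b w₃ = 0

namespace IsDualTriple

variable {w₁ w₂ w₃ b : CircleVec}

theorem expand (h : IsDualTriple w₁ w₂ w₃ b) (u : CircleVec) :
    u = (-(prod u w₂ + prod u w₃) / 2) • w₁ + (-(prod u w₁ + prod u w₃) / 2) • w₂ +
      (-(prod u w₁ + prod u w₂) / 2) • w₃ + prod u b • b :=
  expansion h.unit₁ h.unit₂ h.unit₃ h.dual_unit h.tangent₁₂ h.tangent₂₃ h.tangent₁₃ h.orthogonal₁
    h.orthogonal₂ h.orthogonal₃ u

theorem prod_expand (h : IsDualTriple w₁ w₂ w₃ b) (u v : CircleVec) :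
    prod v u = (-(prod u w₂ + prod u w₃) / 2) * prod v w₁ +
      (-(prod u w₁ + prod u w₃) / 2) * prod v w₂ +
      (-(prod u w₁ + prod u w₂) / 2) * prod v w₃ + prod u b * prod v b := by
  conv_lhs => rw [h.expand u]
  simp only [prod_add, prod_smul]

/-- The expansion of `u`, paired with `u` itself. It yields lower bounds for `|prod u b|` as soon as
the products of `u` with the three circles have the same sign. -/
theorem sq_prod_dual (h : IsDualTriple w₁ w₂ w₃ b) (u : CircleVec) :
    prod u b ^ 2 = prod u u + prod u w₁ * prod u w₂ + prod u w₂ * prod u w₃ +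
      prod u w₁ * prod u w₃ := by
  have := h.prod_expand u u
  linarith

end IsDualTriple

end CircleVec

/-! ### Vectors of the circles of a configuration -/

namespace StripCircles

variable (P : StripCircles)

/-- The unit vectors of the circles of a configuration. -/
def labelVec : Label P.n → CircleVec
  | .base => ![0, 0, -1, 0]
  | .top => ![0, 0, 1, 2]
  | .inner v => (GenCircle.circle (P.center v) (P.radius v) (P.radius_pos v)).vec

theorem eval_labelVec_base (z : ℂ) : eval (P.labelVec .base) z = 2 * z.im := by
  simp [eval, labelVec]

theorem eval_labelVec_top (z : ℂ) : eval (P.labelVec .top) z = 2 - 2 * z.im := by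
  simp [eval, labelVec]; ring

theorem eval_labelVec_inner (v : Fin P.n) (z : ℂ) : eval (P.labelVec (.inner v)) z =
    (dist z (P.center v) ^ 2 - P.radius v ^ 2) / P.radius v := by
  rw [labelVec, GenCircle.eval_vec_circle, GenCircle.dist_sq_eq]

theorem carrier_circ (i : Label P.n) : (P.circ i).carrier = zeroSet (P.labelVec i) := by
  rw [GenCircle.carrier_eq]
  cases i with
  | base =>
    -- The disc of the base line is the lower half-plane, while `GenCircle.vec` is negative on the
    -- upper one; hence the change of sign.
    rw [← zeroSet_neg]
    congr 1
    ext i; fin_cases i <;> simp [circ, GenCircle.vec, labelVec]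
  | top =>
    congr 1
    ext i; fin_cases i <;> simp [circ, GenCircle.vec, labelVec]
  | inner v => rfl

theorem coe_mem_disk (i : Label P.n) (z : ℂ) :
    (z : Sphere) ∈ P.disk i ↔ eval (P.labelVec i) z ≤ 0 := by
  cases i with
  | base =>
    rw [eval_labelVec_base]
    simp only [disk, Set.mem_insert_iff, OnePoint.coe_ne_infty, false_or, Set.mem_image,
      OnePoint.coe_eq_coe, exists_eq_right, Set.mem_ofPred_eq]
    constructor <;> intro h <;> linarith
  | top => simp [disk, eval_labelVec_top]
  | inner v =>
    rw [eval_labelVec_inner, div_le_iff₀ (P.radius_pos v), zero_mul, sub_nonpos,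
      sq_le_sq₀ dist_nonneg (P.radius_pos v).le]
    simp [disk]

theorem labelVec_unit (i : Label P.n) : prod (P.labelVec i) (P.labelVec i) = 1 := by
  cases i with
  | base => simp [prod, labelVec]
  | top => simp [prod, labelVec]
  | inner v => exact GenCircle.prod_vec_self (.circle _ _ (P.radius_pos v))

theorem prod_labelVec_inner (v w : Fin P.n) :
    prod (P.labelVec (.inner v)) (P.labelVec (.inner w)) =
      (P.radius v ^ 2 + P.radius w ^ 2 - dist (P.center v) (P.center w) ^ 2) /
        (2 * P.radius v * P.radius w) := by
  have h1 := P.radius_pos v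
  have h2 := P.radius_pos w
  rw [GenCircle.dist_sq_eq]
  simp [prod, labelVec, GenCircle.vec]
  field_simp
  ring

theorem prod_base (u : CircleVec) : prod u (P.labelVec .base) = -u 2 := by
  simp [prod, labelVec]

theorem prod_top (u : CircleVec) : prod u (P.labelVec .top) = u 2 - u 0 := by
  simp [prod, labelVec]

theorem labelVec_inner_zero (v : Fin P.n) : P.labelVec (.inner v) 0 = 1 / P.radius v := rfl
theorem labelVec_inner_one (v : Fin P.n) :
    P.labelVec (.inner v) 1 = (P.center v).re / P.radius v := rfl
theorem labelVec_inner_two (v : Fin P.n) :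
    P.labelVec (.inner v) 2 = (P.center v).im / P.radius v := rfl
theorem labelVec_inner_three (v : Fin P.n) : P.labelVec (.inner v) 3 =
    ((P.center v).re ^ 2 + (P.center v).im ^ 2 - P.radius v ^ 2) / P.radius v := rfl

theorem prod_labelVec_le (i j : Label P.n) (hij : i ≠ j) :
    prod (P.labelVec i) (P.labelVec j) ≤ -1 := by
  have h1 : ∀ v, prod (P.labelVec (.inner v)) (P.labelVec .base) ≤ -1 := fun v => by
    rw [prod_base, labelVec_inner_two, neg_le_neg_iff, le_div_iff₀ (P.radius_pos v), one_mul]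
    exact P.radius_le_im v
  have h2 : ∀ v, prod (P.labelVec (.inner v)) (P.labelVec .top) ≤ -1 := fun v => by
    rw [prod_top, labelVec_inner_two, labelVec_inner_zero, ← sub_div, div_le_iff₀ (P.radius_pos v)]
    linarith [P.im_add_radius_le v]
  cases i with
  | base =>
    cases j with
    | base => exact absurd rfl hij
    | top => rw [prod_top]; simp [labelVec]
    | inner w => rw [prod_comm]; exact h1 w
  | top =>
    cases j with
    | base => rw [prod_base]; simp [labelVec]
    | top => exact absurd rfl hij
    | inner w => rw [prod_comm]; exact h2 w
  | inner v =>
    cases j with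
    | base => exact h1 v
    | top => exact h2 v
    | inner w =>
      have hvw : v ≠ w := fun h => hij (by rw [h])
      have hv := P.radius_pos v
      have hw := P.radius_pos w
      have hs := P.separated v w hvw
      rw [prod_labelVec_inner, div_le_iff₀ (by positivity)]
      nlinarith

/-- The open discs of a configuration are disjoint from the other closed discs. -/
theorem eval_pos_of_eval_neg {i j : Label P.n} (hij : i ≠ j) {z : ℂ}
    (h : eval (P.labelVec i) z < 0) : 0 < eval (P.labelVec j) z := by
  have hin : ∀ v, eval (P.labelVec (.inner v)) z < 0 ↔ dist z (P.center v) < P.radius v := fun v => by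
    rw [eval_labelVec_inner, div_lt_iff₀ (P.radius_pos v), zero_mul, sub_neg,
      sq_lt_sq₀ dist_nonneg (P.radius_pos v).le]
  have hout : ∀ v, 0 < eval (P.labelVec (.inner v)) z ↔ P.radius v < dist z (P.center v) :=
    fun v => by
    rw [eval_labelVec_inner, lt_div_iff₀ (P.radius_pos v), zero_mul, sub_pos,
      sq_lt_sq₀ (P.radius_pos v).le dist_nonneg]
  have him : ∀ v, |z.im - (P.center v).im| ≤ dist z (P.center v) := fun v => by
    rw [Complex.dist_eq, ← Complex.sub_im]; exact Complex.abs_im_le_norm _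
  have h1 := P.radius_le_im
  have h2 := P.im_add_radius_le
  cases i with
  | base =>
    rw [eval_labelVec_base] at h
    cases j with
    | base => exact absurd rfl hij
    | top => rw [eval_labelVec_top]; linarith
    | inner w => rw [hout]; linarith [neg_abs_le (z.im - (P.center w).im), him w, h1 w]
  | top =>
    rw [eval_labelVec_top] at h
    cases j with
    | base => rw [eval_labelVec_base]; linarith
    | top => exact absurd rfl hij
    | inner w => rw [hout]; linarith [le_abs_self (z.im - (P.center w).im), him w, h2 w]
  | inner v =>
    rw [hin] at h
    cases j with
    | base => rw [eval_labelVec_base]; linarith [neg_abs_le (z.im - (P.center v).im), him v, h1 v]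
    | top => rw [eval_labelVec_top]; linarith [le_abs_self (z.im - (P.center v).im), him v, h2 v]
    | inner w =>
      have hvw : v ≠ w := fun h => hij (by rw [h])
      rw [hout]
      have := dist_triangle_left (P.center v) (P.center w) z
      linarith [P.separated v w hvw]

/-- Discs with product at least `2` have a common point. -/
theorem exists_eval_neg (l : Label P.n) {b : CircleVec} (hb : prod b b = 1)
    (h : 2 ≤ prod b (P.labelVec l)) : ∃ z : ℂ, eval (P.labelVec l) z < 0 ∧ eval b z < 0 := by
  have hcen : 0 < b 0 → eval b ⟨b 1 / b 0, b 2 / b 0⟩ = -1 / b 0 := fun hA => by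
    simp only [prod] at hb
    simp only [eval]
    field_simp
    linarith
  have hneg : ∀ {x : ℝ}, 0 < x → -1 / x < 0 := fun hx => div_neg_of_neg_of_pos (by norm_num) hx
  cases l with
  | base =>
    rw [prod_base] at h
    rcases lt_or_ge 0 (b 0) with hA | hA
    -- If `b` bounds a Euclidean disc, its centre works; otherwise a point far enough inside the
    -- half-plane does.
    · refine ⟨_, ?_, (hcen hA).trans_lt (hneg hA)⟩
      rw [eval_labelVec_base]
      have : b 2 / b 0 < 0 := div_neg_of_neg_of_pos (by linarith) hA
      linarith
    · refine ⟨⟨0, -(|b 3| + 1)⟩, ?_, ?_⟩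
      · rw [eval_labelVec_base]
        have := abs_nonneg (b 3)
        simp only; linarith
      · simp only [eval]
        nlinarith [abs_nonneg (b 3), le_abs_self (b 3), sq_nonneg (|b 3| + 1),
          mul_nonneg (neg_nonneg.mpr hA) (sq_nonneg (|b 3| + 1)),
          mul_nonneg (sub_nonneg.mpr h) (abs_nonneg (b 3))]
  | top =>
    rw [prod_top] at h
    rcases lt_or_ge 0 (b 0) with hA | hA
    · refine ⟨_, ?_, (hcen hA).trans_lt (hneg hA)⟩
      rw [eval_labelVec_top]
      have : 1 < b 2 / b 0 := by rw [lt_div_iff₀ hA]; linarith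
      simp only; linarith
    · refine ⟨⟨0, 1 + (|b 3| + 1)⟩, ?_, ?_⟩
      · rw [eval_labelVec_top]
        have := abs_nonneg (b 3)
        simp only; linarith
      · simp only [eval]
        have h0 := abs_nonneg (b 3)
        have h1 := le_abs_self (b 3)
        generalize |b 3| = s at *
        nlinarith [mul_nonneg (neg_nonneg.mpr hA) (by positivity : 0 ≤ s * (2 + s)),
          mul_nonneg (sub_nonneg.mpr h) (by positivity : 0 ≤ 2 + s)]
  | inner v =>
    have hr := P.radius_pos v
    have e : eval b (P.center v) = -2 * P.radius v * prod b (P.labelVec (.inner v)) +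
        b 0 * P.radius v ^ 2 := by
      simp only [eval, prod, labelVec_inner_zero, labelVec_inner_one, labelVec_inner_two,
        labelVec_inner_three]
      field_simp
      ring
    -- By `e`, the centre of the circle `l` lies in the disc of `b` when `b 0 * r < 4`, since the
    -- product is at least 2. Otherwise the centre of `b` lies in the disc of `l`, because `1 - 2 *
    -- 4 * 2 < 0`.
    rcases lt_or_ge (b 0 * P.radius v) 4 with hA | hA
    · refine ⟨P.center v, ?_, ?_⟩
      · rw [eval_labelVec_inner, dist_self]
        have : (0 ^ 2 - P.radius v ^ 2) / P.radius v = -P.radius v := by field_simp; ring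
        linarith
      · rw [e]; nlinarith
    · have hA' : 0 < b 0 := by
        by_contra! h'
        nlinarith
      refine ⟨_, ?_, (hcen hA').trans_lt (hneg hA')⟩
      have e2 : b 0 ^ 2 * ((b 1 / b 0 - (P.center v).re) ^ 2 + (b 2 / b 0 - (P.center v).im) ^ 2) =
          b 0 * eval b (P.center v) + 1 := by
        simp only [prod] at hb
        simp only [eval]
        field_simp
        linear_combination hb
      rw [eval_labelVec_inner, div_lt_iff₀ hr, zero_mul, GenCircle.dist_sq_eq]
      have h3 : b 0 * eval b (P.center v) + 1 < b 0 ^ 2 * P.radius v ^ 2 := by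
        rw [e]; nlinarith
      rw [← e2] at h3
      have := lt_of_mul_lt_mul_left h3 (by positivity)
      simp only; linarith

/-! ### Gaps and their dual circles -/

/-- `b` is the vector of the dual circle of the triangular gap bounded by the circles `i, j, k`,
with the gap on the negative side. -/
def IsGapVec (i j k : Label P.n) (b : CircleVec) : Prop :=
  ∃ O B, P.IsTriangularGap i j k O B ∧ (b = O.vec ∨ b = -O.vec) ∧
    ∀ z : ℂ, (z : Sphere) ∈ B ↔ eval b z < 0

variable {P}

theorem IsTriangularGap.exists_isGapVec {i j k : Label P.n} {O : GenCircle} {B : Set Sphere}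
    (h : P.IsTriangularGap i j k O B) : ∃ b, P.IsGapVec i j k b ∧ (b = O.vec ∨ b = -O.vec) ∧
      ∀ z : ℂ, (z : Sphere) ∈ B ↔ eval b z < 0 := by
  obtain ⟨_, _, _, _, _, _, hB, _⟩ := id h
  rcases hB with hB | hB
  · have h1 : ∀ z : ℂ, (z : Sphere) ∈ B ↔ eval O.vec z < 0 := fun z => by
      rw [hB, O.coe_mem_inside]
    exact ⟨O.vec, ⟨O, B, h, Or.inl rfl, h1⟩, Or.inl rfl, h1⟩
  · have h1 : ∀ z : ℂ, (z : Sphere) ∈ B ↔ eval (-O.vec) z < 0 := fun z => by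
      rw [hB, O.coe_mem_outside, eval_neg, neg_lt_zero]
    exact ⟨-O.vec, ⟨O, B, h, Or.inr rfl, h1⟩, Or.inr rfl, h1⟩

theorem Tangent.symm {i j : Label P.n} (h : P.Tangent i j) : P.Tangent j i :=
  ⟨h.1.symm, by rw [Set.inter_comm]; exact h.2⟩

theorem IsTriangularGap.swap₁₂ {i j k : Label P.n} {O : GenCircle} {B : Set Sphere}
    (h : P.IsTriangularGap i j k O B) : P.IsTriangularGap j i k O B := by
  obtain ⟨h1, h2, h3, h4, h5, h6, h7, h8⟩ := h
  refine ⟨h1.symm, h3, h2, by rwa [Set.inter_comm], h6, h5, h7, fun l hj hi hk => ?_⟩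
  rw [Set.union_comm (P.disk j)]
  exact h8 l hi hj hk

theorem IsTriangularGap.swap₂₃ {i j k : Label P.n} {O : GenCircle} {B : Set Sphere}
    (h : P.IsTriangularGap i j k O B) : P.IsTriangularGap i k j O B := by
  obtain ⟨h1, h2, h3, h4, h5, h6, h7, h8⟩ := h
  refine ⟨h3, h2.symm, h1, h6, by rwa [Set.inter_comm], h4, h7, fun l hi hk hj => ?_⟩
  rw [Set.union_assoc, Set.union_comm (P.disk k), ← Set.union_assoc]
  exact h8 l hi hj hk

theorem IsGapVec.swap₁₂ {i j k : Label P.n} {b : CircleVec} (h : P.IsGapVec i j k b) :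
    P.IsGapVec j i k b := by
  obtain ⟨O, B, h, h'⟩ := h
  exact ⟨O, B, h.swap₁₂, h'⟩

theorem IsGapVec.swap₂₃ {i j k : Label P.n} {b : CircleVec} (h : P.IsGapVec i j k b) :
    P.IsGapVec i k j b := by
  obtain ⟨O, B, h, h'⟩ := h
  exact ⟨O, B, h.swap₂₃, h'⟩

theorem Tangent.prod_eq {i j : Label P.n} (h : P.Tangent i j) :
    prod (P.labelVec i) (P.labelVec j) = -1 := by
  obtain ⟨hij, p, hp⟩ := h
  have hp' : p ∈ (P.circ i).carrier ∩ (P.circ j).carrier := by rw [hp]; rfl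
  rw [carrier_circ, carrier_circ] at hp'
  exact (prod_add_prod_eq_zero (P.labelVec_unit i) (P.labelVec_unit j) (P.prod_labelVec_le i j hij)
    hp'.1 hp'.2 hp'.1).1

theorem Tangent.prod_add {i j : Label P.n} (h : P.Tangent i j) {b : CircleVec}
    (hb : (P.circ i).carrier ∩ (P.circ j).carrier ⊆ zeroSet b) :
    prod b (P.labelVec i) + prod b (P.labelVec j) = 0 := by
  obtain ⟨hij, p, hp⟩ := h
  have hp' : p ∈ (P.circ i).carrier ∩ (P.circ j).carrier := by rw [hp]; rfl
  have hpb := hb hp'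
  rw [carrier_circ, carrier_circ] at hp'
  exact (prod_add_prod_eq_zero (P.labelVec_unit i) (P.labelVec_unit j) (P.prod_labelVec_le i j hij)
    hp'.1 hp'.2 hpb).2

namespace IsGapVec

variable {i j k : Label P.n} {b : CircleVec}

/-- The dual circle passes through each point of tangency, so its products with the two circles
meeting there add up to zero. Three such relations force all three products to vanish. -/
theorem isDualTriple (h : P.IsGapVec i j k b) :
    IsDualTriple (P.labelVec i) (P.labelVec j) (P.labelVec k) b := by
  obtain ⟨O, B, ⟨h1, h2, h3, h4, h5, h6, -, -⟩, hb, -⟩ := h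
  have hO : O.carrier = zeroSet b := by
    rw [GenCircle.carrier_eq]
    rcases hb with rfl | rfl
    · rfl
    · rw [zeroSet_neg]
  have hu : prod b b = 1 := by
    rcases hb with rfl | rfl
    · exact O.prod_vec_self
    · rw [prod_neg, neg_prod, neg_neg, O.prod_vec_self]
  rw [hO] at h4 h5 h6
  have e1 := h1.prod_add h4
  have e2 := h2.prod_add h5
  have e3 := h3.prod_add h6
  exact ⟨P.labelVec_unit i, P.labelVec_unit j, P.labelVec_unit k, hu, h1.prod_eq, h2.prod_eq,
    h3.prod_eq, by linarith, by linarith, by linarith⟩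

theorem disjoint_disk (h : P.IsGapVec i j k b) {l : Label P.n} (hi : l ≠ i) (hj : l ≠ j)
    (hk : l ≠ k) {z : ℂ} (hz : eval b z < 0) (hzl : eval (P.labelVec l) z ≤ 0)
    (hzi : 0 < eval (P.labelVec i) z) (hzj : 0 < eval (P.labelVec j) z)
    (hzk : 0 < eval (P.labelVec k) z) : False := by
  obtain ⟨O, B, ⟨-, -, -, -, -, -, -, h8⟩, -, hB⟩ := h
  refine Set.disjoint_left.mp (h8 l hi hj hk) ⟨(hB z).mpr hz, ?_⟩ ((P.coe_mem_disk l z).mpr hzl)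
  simp only [Set.mem_union, coe_mem_disk, not_or, not_le]
  exact ⟨⟨hzi, hzj⟩, hzk⟩

/-- The discs of the other circles are disjoint from the disc of the dual circle of a gap, and not
tangent to it. -/
theorem prod_le (h : P.IsGapVec i j k b) {l : Label P.n} (hi : l ≠ i) (hj : l ≠ j) (hk : l ≠ k) :
    prod b (P.labelVec l) ≤ -2 := by
  have hd := h.isDualTriple
  have h1 := P.prod_labelVec_le l i hi
  have h2 := P.prod_labelVec_le l j hj
  have h3 := P.prod_labelVec_le l k hk
  have hs := hd.sq_prod_dual (P.labelVec l)
  rw [P.labelVec_unit, prod_comm _ b] at hs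
  -- The square is `1` plus three products of numbers that are at most -1. The sign is then decided
  -- by the gap: with product at least 2 the two discs would share a point, and this point would lie
  -- in the gap.
  have h4 : 2 ^ 2 ≤ prod b (P.labelVec l) ^ 2 := by nlinarith
  have h5 : 2 ≤ |prod b (P.labelVec l)| := by
    rw [← abs_of_pos (two_pos : (0 : ℝ) < 2)]; exact sq_le_sq.mp h4
  rcases le_abs'.mp h5 with h6 | h6
  · exact h6
  · obtain ⟨z, hz1, hz2⟩ := P.exists_eval_neg l hd.dual_unit h6
    exact (h.disjoint_disk hi hj hk hz2 hz1.le (P.eval_pos_of_eval_neg hi hz1)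
      (P.eval_pos_of_eval_neg hj hz1) (P.eval_pos_of_eval_neg hk hz1)).elim

theorem orthogonal_or (h : P.IsGapVec i j k b) (l : Label P.n) :
    prod b (P.labelVec l) = 0 ∨ prod b (P.labelVec l) ≤ -2 := by
  have hd := h.isDualTriple
  by_cases hi : l = i
  · left; rw [hi]; exact hd.orthogonal₁
  by_cases hj : l = j
  · left; rw [hj]; exact hd.orthogonal₂
  by_cases hk : l = k
  · left; rw [hk]; exact hd.orthogonal₃
  exact Or.inr (h.prod_le hi hj hk)

theorem nonpos (h : P.IsGapVec i j k b) (l : Label P.n) : prod b (P.labelVec l) ≤ 0 := by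
  rcases h.orthogonal_or l with h | h <;> linarith

/-- `sq_prod_dual` gives `|prod b b'| ≥ 1`, and the positive sign must mean equality. If a circle
orthogonal to `b'` were not orthogonal to `b`, the expansion of `b'` in the triple of `b` would
write its product with this circle, which is zero, as a sum of nonpositive terms with one negative
term. So `b` is orthogonal to the triple of `b'`, hence a multiple of `b'`. -/
theorem eq_or_prod_le {i' j' k' : Label P.n} {b' : CircleVec} (h : P.IsGapVec i j k b)
    (h' : P.IsGapVec i' j' k' b') : b' = b ∨ prod b b' ≤ -1 := by
  have hd := h.isDualTriple
  have hd' := h'.isDualTriple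
  have hs := hd'.sq_prod_dual b
  rw [hd.dual_unit] at hs
  have n1 := h.nonpos i'
  have n2 := h.nonpos j'
  have n3 := h.nonpos k'
  have h4 : 1 ^ 2 ≤ prod b b' ^ 2 := by nlinarith
  have h5 : 1 ≤ |prod b b'| := by
    rw [← abs_of_pos (one_pos : (0 : ℝ) < 1)]; exact sq_le_sq.mp h4
  rcases le_abs'.mp h5 with h6 | h6
  · exact Or.inr h6
  · left
    have key : ∀ l, prod b' (P.labelVec l) = 0 → prod b (P.labelVec l) = 0 := by
      intro l hl
      rcases h.orthogonal_or l with h7 | h7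
      · exact h7
      · exfalso
        have he := hd.prod_expand b' (P.labelVec l)
        rw [prod_comm _ b', hl, prod_comm (P.labelVec l) b, prod_comm b' b] at he
        have hl1 : l ≠ i := fun e => by rw [e, hd.orthogonal₁] at h7; norm_num at h7
        have hl2 : l ≠ j := fun e => by rw [e, hd.orthogonal₂] at h7; norm_num at h7
        have hl3 : l ≠ k := fun e => by rw [e, hd.orthogonal₃] at h7; norm_num at h7
        have m1 := P.prod_labelVec_le l i hl1
        have m2 := P.prod_labelVec_le l j hl2
        have m3 := P.prod_labelVec_le l k hl3
        have k1 := h'.nonpos i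
        have k2 := h'.nonpos j
        have k3 := h'.nonpos k
        have p1 : 0 ≤ -(prod b' (P.labelVec j) + prod b' (P.labelVec k)) / 2 := by linarith
        have p2 : 0 ≤ -(prod b' (P.labelVec i) + prod b' (P.labelVec k)) / 2 := by linarith
        have p3 : 0 ≤ -(prod b' (P.labelVec i) + prod b' (P.labelVec j)) / 2 := by linarith
        have q1 := mul_nonneg p1 (by linarith : 0 ≤ -prod (P.labelVec l) (P.labelVec i))
        have q2 := mul_nonneg p2 (by linarith : 0 ≤ -prod (P.labelVec l) (P.labelVec j))
        have q3 := mul_nonneg p3 (by linarith : 0 ≤ -prod (P.labelVec l) (P.labelVec k))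
        have q4 := mul_pos (by linarith : 0 < prod b b')
          (by linarith : 0 < -prod b (P.labelVec l))
        linarith
    have z1 := key i' hd'.orthogonal₁
    have z2 := key j' hd'.orthogonal₂
    have z3 := key k' hd'.orthogonal₃
    have he := hd'.expand b
    rw [z1, z2, z3] at he hs
    have h1 : prod b b' = 1 := by nlinarith
    rw [h1] at he
    rw [he]
    simp

end IsGapVec

end StripCircles

instance Label.instFinite (n : ℕ) : Finite (Label n) := by
  refine Finite.of_injective (β := Option (Option (Fin n)))
    (fun | .base => none | .top => some none | .inner v => some (some v)) ?_
  intro i j h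
  cases i <;> cases j <;> simp_all

/-! ### The orbit of a Ford configuration under its reflection group -/

namespace FordConfiguration

open StripCircles Filter Topology

variable (F : FordConfiguration)

/-- The vectors of the dual circles of the gaps. -/
def gapVecs : Set CircleVec := {b | ∃ i j k, F.IsGapVec i j k b}

theorem isDualSystem : IsDualSystem F.labelVec F.gapVecs where
  unit := F.labelVec_unit
  disjoint := F.prod_labelVec_le
  dual_unit := by
    rintro b ⟨i, j, k, h⟩
    exact h.isDualTriple.dual_unit
  dual_disjoint := by
    rintro b ⟨i, j, k, h⟩ b' ⟨i', j', k', h'⟩ hne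
    exact (h.eq_or_prod_le h').resolve_left hne
  orthogonal_or_disjoint := by
    rintro b ⟨i, j, k, h⟩ l
    rcases h.orthogonal_or l with h | h
    · exact Or.inl h
    · exact Or.inr (by linarith)

/-- The vectors of the circles of the packing in the orbit of the circle `i`. -/
def OrbitVec (i : Label F.n) (v : CircleVec) : Prop :=
  ∃ x, WordOrbit F.gapVecs (F.labelVec i) x v

variable {F}

theorem OrbitVec.labelVec (i : Label F.n) : F.OrbitVec i (F.labelVec i) := ⟨none, .nil⟩

theorem OrbitVec.reflect {i : Label F.n} {v b : CircleVec} (hv : F.OrbitVec i v)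
    (hb : b ∈ F.gapVecs) : F.OrbitVec i (reflect b v) :=
  F.isDualSystem.wordOrbit_reflect hv.choose_spec hb

theorem OrbitVec.unit {i : Label F.n} {v : CircleVec} (hv : F.OrbitVec i v) : prod v v = 1 :=
  F.isDualSystem.wordOrbit_unit hv.choose_spec

theorem OrbitVec.prod_le_or_eq {i : Label F.n} {v : CircleVec} (hv : F.OrbitVec i v)
    (m : Label F.n) : prod v (F.labelVec m) ≤ -1 ∨ v = F.labelVec m :=
  F.isDualSystem.prod_le_or_eq hv.choose_spec m

theorem OrbitVec.eq_of_labelVec {i m : Label F.n} (hv : F.OrbitVec i (F.labelVec m)) : i = m :=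
  F.isDualSystem.eq_of_wordOrbit_eq hv.choose_spec

/-- Reflections in dual circles are given by reflections of vectors. -/
theorem reflection_image_zeroSet {i j k : Label F.n} {O : GenCircle} {B : Set Sphere}
    (h : F.IsTriangularGap i j k O B) : ∃ b, F.IsGapVec i j k b ∧
      ∀ v, (O.reflection : Sphere → Sphere) '' zeroSet v = zeroSet (CircleVec.reflect b v) := by
  obtain ⟨b, hb, hO, -⟩ := h.exists_isGapVec
  refine ⟨b, hb, fun v => ?_⟩
  rw [O.reflection_image]
  rcases hO with rfl | rfl
  · rfl
  · rw [reflect_neg]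

/-- Induction over products of generators, using that every generator is its own inverse. It
replaces group elements by reduced words of vector reflections, to which ping-pong applies. -/
theorem exists_orbitVec {σ : Equiv.Perm Sphere} (hσ : σ ∈ F.reflectionGroup) (i : Label F.n) :
    ∃ v, F.OrbitVec i v ∧ (σ : Sphere → Sphere) '' (F.circ i).carrier = zeroSet v := by
  have step : ∀ S ∈ {S : Equiv.Perm Sphere | ∃ i j k O B, F.IsTriangularGap i j k O B ∧
      S = O.reflection}, ∀ τ : Equiv.Perm Sphere,
      (∃ v, F.OrbitVec i v ∧ (τ : Sphere → Sphere) '' (F.circ i).carrier = zeroSet v) →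
      ∃ v, F.OrbitVec i v ∧ ((S * τ : Equiv.Perm Sphere) : Sphere → Sphere) '' (F.circ i).carrier =
        zeroSet v := by
    rintro _ ⟨_, _, _, O, B, h, rfl⟩ τ ⟨v, hv, hτ⟩
    obtain ⟨b, hb, hO⟩ := reflection_image_zeroSet h
    refine ⟨CircleVec.reflect b v, hv.reflect ⟨_, _, _, hb⟩, ?_⟩
    rw [Equiv.Perm.coe_mul, Set.image_comp, hτ, hO]
  refine Subgroup.closure_induction_left
    (p := fun (σ : Equiv.Perm Sphere) _ =>
      ∃ v, F.OrbitVec i v ∧ (σ : Sphere → Sphere) '' (F.circ i).carrier = zeroSet v)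
    ⟨_, .labelVec i, ?_⟩ (fun S hS τ _ ih => step S hS τ ih) (fun S hS τ _ ih => ?_) hσ
  · rw [F.carrier_circ]; simp
  · have : S⁻¹ = S := by
      obtain ⟨_, _, _, O, B, h, rfl⟩ := hS
      rfl
    rw [this]
    exact step S hS τ ih

theorem exists_orbitVec_of_mem_packing {C : Set Sphere} (hC : C ∈ F.packing) :
    ∃ i v, F.OrbitVec i v ∧ C = zeroSet v := by
  obtain ⟨σ, hσ, i, rfl⟩ := hC
  obtain ⟨v, hv, h⟩ := exists_orbitVec hσ i
  exact ⟨i, v, hv, h⟩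

theorem prod_base_of_mem_K0 {k : Label F.n} (hk : k ∈ F.K0) :
    prod (F.labelVec k) (F.labelVec .base) = -1 :=
  Tangent.prod_eq hk

theorem labelVec_two_of_mem_K0 {k : Label F.n} (hk : k ∈ F.K0) : F.labelVec k 2 = 1 := by
  have := prod_base_of_mem_K0 hk
  rw [prod_base] at this
  linarith

theorem base_notMem_K0 : Label.base ∉ F.K0 := fun h => h.1 rfl

theorem top_mem_K0 : Label.top ∈ F.K0 := by
  refine ⟨by simp, OnePoint.infty, ?_⟩
  rw [F.carrier_circ, F.carrier_circ]
  ext p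
  induction p using OnePoint.rec with
  | infty => simp [labelVec]
  | coe z =>
    simp only [Set.mem_inter_iff, coe_mem_zeroSet, eval_labelVec_base, eval_labelVec_top,
      Set.mem_singleton_iff, OnePoint.coe_ne_infty, iff_false]
    rintro ⟨h1, h2⟩
    linarith

theorem inner_mem_K0 {v : Fin F.n} : Label.inner v ∈ F.K0 ↔ (F.center v).im = F.radius v := by
  have hr := F.radius_pos v
  constructor
  · intro h
    have := labelVec_two_of_mem_K0 h
    rw [labelVec_inner_two, div_eq_one_iff_eq hr.ne'] at this
    exact this
  · intro h
    refine ⟨by simp, (((F.center v).re : ℂ) : Sphere), ?_⟩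
    rw [F.carrier_circ, F.carrier_circ]
    ext p
    induction p using OnePoint.rec with
    | infty => simp [labelVec, GenCircle.vec, hr.ne']
    | coe z =>
      simp only [Set.mem_inter_iff, coe_mem_zeroSet, eval_labelVec_base, eval_labelVec_inner,
        Set.mem_singleton_iff, OnePoint.coe_eq_coe, div_eq_zero_iff, hr.ne', or_false,
        GenCircle.dist_sq_eq, h]
      constructor
      · rintro ⟨h1, h2⟩
        have h3 : z.im = 0 := by linarith
        have h4 : (z.re - (F.center v).re) ^ 2 = 0 := by rw [h3] at h1; linarith
        have h5 : z.re - (F.center v).re = 0 := by simpa using h4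
        exact Complex.ext (by simp; linarith) (by simpa using h3)
      · rintro rfl
        simp

theorem first_mem_K0 : Label.inner F.first ∈ F.K0 := by
  rw [inner_mem_K0, F.center_first, F.radius_first]; simp

theorem last_mem_K0 : Label.inner F.last ∈ F.K0 := by
  rw [inner_mem_K0, F.center_last, F.radius_last]; simp

theorem labelVec_inner_of_mem_K0 {v : Fin F.n} (h : Label.inner v ∈ F.K0) :
    F.labelVec (.inner v) =
      ![1 / F.radius v, F.alpha v / F.radius v, 1, F.alpha v ^ 2 / F.radius v] := by
  have h' := inner_mem_K0.mp h
  have hr := F.radius_pos v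
  refine ext_coords rfl rfl (labelVec_two_of_mem_K0 h) ?_
  rw [labelVec_inner_three, h']
  simp [alpha]

theorem eval_labelVec_pos (x : ℝ) (hx : ∀ v, Label.inner v ∈ F.K0 → F.alpha v ≠ x)
    {i : Label F.n} (hi : i ≠ .base) : 0 < eval (F.labelVec i) x := by
  cases i with
  | base => exact absurd rfl hi
  | top => rw [eval_labelVec_top]; simp
  | inner v =>
    have hr := F.radius_pos v
    have him := F.radius_le_im v
    rw [eval_labelVec_inner, GenCircle.dist_sq_eq]
    refine div_pos ?_ hr
    simp only [Complex.ofReal_re, Complex.ofReal_im]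
    rcases him.eq_or_lt with h | h
    · have : x - (F.center v).re ≠ 0 := fun e =>
        hx v (inner_mem_K0.mpr h.symm) (by rw [alpha]; linarith)
      have := pow_pos (abs_pos.mpr this) 2
      rw [sq_abs] at this
      rw [← h]; linarith
    · nlinarith [sq_nonneg (x - (F.center v).re)]

/-- The two lines and the two outer circles are already four labels. The fourth circle decides which
side of a dual circle is the gap. -/
theorem exists_label_ne (i j k : Label F.n) : ∃ l, l ≠ i ∧ l ≠ j ∧ l ≠ k := by
  by_contra! h'
  have h : ∀ l, l = i ∨ l = j ∨ l = k := fun l => by have := h' l; tauto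
  have h1 := h .base
  have h2 := h .top
  have h3 := h (.inner F.first)
  have h4 := h (.inner F.last)
  have n1 : (Label.base : Label F.n) ≠ .top := by simp
  have n2 : (Label.base : Label F.n) ≠ .inner F.first := by simp
  have n3 : (Label.base : Label F.n) ≠ .inner F.last := by simp
  have n4 : (Label.top : Label F.n) ≠ .inner F.first := by simp
  have n5 : (Label.top : Label F.n) ≠ .inner F.last := by simp
  have n6 : Label.inner F.first ≠ .inner F.last := by simp [F.first_ne_last]
  generalize (Label.base : Label F.n) = a at *
  generalize (Label.top : Label F.n) = b at *
  generalize Label.inner F.first = c at *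
  generalize Label.inner F.last = d at *
  clear h h'
  grind

/-- Three mutually tangent circles determine their dual vector up to sign, and a fourth circle has
negative product with both candidates. -/
theorem isGapVec_unique {i j k : Label F.n} {b b' : CircleVec} (h : F.IsGapVec i j k b)
    (h' : F.IsGapVec i j k b') : b' = b := by
  refine (h.eq_or_prod_le h').resolve_right fun hle => ?_
  have hd := h.isDualTriple
  obtain ⟨l, hi, hj, hk⟩ := F.exists_label_ne i j k
  have h1 := h.prod_le hi hj hk
  have h2 := h'.prod_le hi hj hk
  have he := hd.prod_expand b' (F.labelVec l)
  have hd' := h'.isDualTriple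
  rw [hd'.orthogonal₁, hd'.orthogonal₂, hd'.orthogonal₃, prod_comm (F.labelVec l) b',
    prod_comm (F.labelVec l) b, prod_comm b' b] at he
  nlinarith

theorem gapVecs_finite : F.gapVecs.Finite := by
  have : ∀ b : F.gapVecs, ∃ t : Label F.n × Label F.n × Label F.n,
      F.IsGapVec t.1 t.2.1 t.2.2 b := by
    rintro ⟨b, i, j, k, h⟩
    exact ⟨(i, j, k), h⟩
  choose f hf using this
  have : Finite F.gapVecs := Finite.of_injective f fun b b' h => by
    have h1 := hf b
    rw [h] at h1
    exact Subtype.ext (isGapVec_unique (hf b') h1)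
  exact Set.toFinite _

/-! ### Covering the real line by points of tangency and dual discs -/

theorem prod_null (z : ℂ) (v : CircleVec) :
    prod ![1, z.re, z.im, z.re ^ 2 + z.im ^ 2] v = -eval v z / 2 := by
  simp [prod, eval]; ring

/-- Every real point is the point of tangency of a circle of the configuration, or lies in the disc
of the dual circle of a gap at the base line. -/
theorem exists_alpha_eq_or_exists_gap (x : ℝ) :
    (∃ v, Label.inner v ∈ F.K0 ∧ F.alpha v = x) ∨
      ∃ j k b, F.IsGapVec .base j k b ∧ eval b x < 0 := by
  by_contra! hcon
  obtain ⟨hx, hgap⟩ := hcon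
  have hpos : ∀ {i : Label F.n}, i ≠ .base → 0 < eval (F.labelVec i) x :=
    fun hi => eval_labelVec_pos x hx hi
  have hnon : ∀ {j k b}, F.IsGapVec .base j k b → 0 < eval b x := by
    intro j k b h
    refine lt_of_le_of_ne (hgap j k b h) fun h0 => ?_
    have hd := h.isDualTriple
    -- The point `x` is a null vector, orthogonal to the base. If it were on the dual circle,
    -- `sq_prod_dual` would make the product of its values at the circles `j` and `k` vanish, but
    -- both values are positive.
    have hs := hd.sq_prod_dual ![1, (x : ℂ).re, (x : ℂ).im, (x : ℂ).re ^ 2 + (x : ℂ).im ^ 2]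
    have hj : j ≠ .base := fun e => by
      have := hd.tangent₁₂
      rw [e, F.labelVec_unit] at this
      norm_num at this
    have hk : k ≠ .base := fun e => by
      have := hd.tangent₁₃
      rw [e, F.labelVec_unit] at this
      norm_num at this
    have hn : prod ![1, (x : ℂ).re, (x : ℂ).im, (x : ℂ).re ^ 2 + (x : ℂ).im ^ 2]
        ![1, (x : ℂ).re, (x : ℂ).im, (x : ℂ).re ^ 2 + (x : ℂ).im ^ 2] = 0 := by
      rw [prod_null]; simp [eval]; ring
    rw [hn] at hs
    rw [prod_null, prod_null, prod_null, prod_null, ← h0, eval_labelVec_base, Complex.ofReal_im] at hs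
    have := mul_pos (hpos hj) (hpos hk)
    nlinarith
  have hall : ∀ b ∈ F.gapVecs, 0 < eval b x := by
    rintro b ⟨i, j, k, h⟩
    by_cases hi : Label.base = i
    · subst hi; exact hnon h
    by_cases hj : Label.base = j
    · subst hj; exact hnon h.swap₁₂
    by_cases hk : Label.base = k
    · subst hk; exact hnon h.swap₂₃.swap₁₂
    -- A gap away from the base has `b 2 ≥ 2`. Its disc cannot contain the point `x` of the base
    -- disc, and its circle misses the real line since `1 - b 2 ^ 2 < 0`.
    by_contra! hle
    have hb := h.prod_le hi hj hk
    rw [prod_base] at hb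
    have hu := h.isDualTriple.dual_unit
    rcases hle.lt_or_eq with hlt | heq
    · refine h.disjoint_disk hi hj hk hlt ?_ (hpos (Ne.symm hi)) (hpos (Ne.symm hj))
        (hpos (Ne.symm hk))
      rw [eval_labelVec_base]; simp
    · simp only [eval, Complex.ofReal_re, Complex.ofReal_im] at heq
      simp only [prod] at hu
      have h1 : (b 0 * x - b 1) ^ 2 = 1 - b 2 ^ 2 := by linear_combination b 0 * heq + hu
      nlinarith [sq_nonneg (b 0 * x - b 1)]
  -- Finitely many strict inequalities survive at `x + iε` for small `ε > 0`. That point is outside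
  -- all discs and all dual discs, contrary to the triangularity of the gaps.
  have hcont : ∀ b : CircleVec, Tendsto (fun ε : ℝ => eval b ⟨x, ε⟩) (𝓝[>] 0) (𝓝 (eval b x)) := by
    intro b
    have : Continuous fun ε : ℝ => eval b ⟨x, ε⟩ := by
      unfold eval; fun_prop
    exact (this.tendsto 0).mono_left nhdsWithin_le_nhds
  have h1 : ∀ᶠ ε in 𝓝[>] (0 : ℝ), ∀ b ∈ F.gapVecs, 0 < eval b ⟨x, ε⟩ :=
    (eventually_all_finite gapVecs_finite).mpr fun b hb =>
      (hcont b).eventually_const_lt (hall b hb)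
  have h2 : ∀ᶠ ε in 𝓝[>] (0 : ℝ), ∀ i : Label F.n, i ≠ .base → 0 < eval (F.labelVec i) ⟨x, ε⟩ :=
    eventually_all.mpr fun i => by
      by_cases hi : i = .base
      · simp [hi]
      · filter_upwards [(hcont (F.labelVec i)).eventually_const_lt (hpos hi)] with ε h _ using h
  obtain ⟨ε, h1, h2, h3⟩ := (h1.and (h2.and self_mem_nhdsWithin)).exists
  obtain ⟨i, j, k, O, B, h, hz, -⟩ := F.triangular ((⟨x, ε⟩ : ℂ) : Sphere) fun i => by
    rw [coe_mem_disk, not_le]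
    by_cases hi : i = .base
    · rw [hi, eval_labelVec_base]; exact mul_pos two_pos h3
    · exact h2 i hi
  obtain ⟨b, hb, -, hB⟩ := h.exists_isGapVec
  have := h1 b ⟨i, j, k, hb⟩
  rw [hB] at hz
  linarith

theorem mem_K0_of_isGapVec {j k : Label F.n} {b : CircleVec} (h : F.IsGapVec .base j k b) :
    j ∈ F.K0 ∧ k ∈ F.K0 := by
  obtain ⟨O, B, ⟨h1, -, h3, -⟩, -⟩ := h
  exact ⟨h1.symm, h3.symm⟩

/-! ### Tangent circles of the packing in vector form -/

/-- The data of a circle of the packing that touches the base line from above. -/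
structure IsTangentVec (F : FordConfiguration) (u : CircleVec) : Prop where
  orbit : ∃ i, F.OrbitVec i u
  prod_base : prod u (F.labelVec .base) = -1

namespace IsTangentVec

variable {u : CircleVec}

theorem of_mem_K0 {k : Label F.n} (hk : k ∈ F.K0) : F.IsTangentVec (F.labelVec k) :=
  ⟨⟨k, .labelVec k⟩, prod_base_of_mem_K0 hk⟩

theorem unit (hu : F.IsTangentVec u) : prod u u = 1 := hu.orbit.choose_spec.unit

theorem prod_le_or_eq (hu : F.IsTangentVec u) (m : Label F.n) :
    prod u (F.labelVec m) ≤ -1 ∨ u = F.labelVec m := hu.orbit.choose_spec.prod_le_or_eq m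

theorem two_eq (hu : F.IsTangentVec u) : u 2 = 1 := by
  have := hu.prod_base
  rw [StripCircles.prod_base] at this
  linarith

theorem sq_eq (hu : F.IsTangentVec u) : u 1 ^ 2 = u 0 * u 3 := by
  have := hu.unit
  simp only [prod, hu.two_eq] at this
  linarith

/-- A circle touching the base and not crossing the upper line has radius at most 1/2. -/
theorem two_le_or_eq (hu : F.IsTangentVec u) : 2 ≤ u 0 ∨ u = F.labelVec .top := by
  rcases hu.prod_le_or_eq .top with h | h
  · left
    rw [StripCircles.prod_top, hu.two_eq] at h
    linarith
  · exact Or.inr h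

theorem reflect (hu : F.IsTangentVec u) {j k : Label F.n} {b : CircleVec}
    (hb : F.IsGapVec .base j k b) : F.IsTangentVec (CircleVec.reflect b u) := by
  obtain ⟨i, hi⟩ := hu.orbit
  refine ⟨⟨i, hi.reflect ⟨_, _, _, hb⟩⟩, ?_⟩
  rw [reflect_prod, hb.isDualTriple.orthogonal₁, hu.prod_base]
  ring

/-- The covering of the real line is applied to the point of tangency. Two circles touching the line
from above at the same point have product 1, so by ping-pong they coincide; a point of tangency
inside a dual disc gives a positive product. -/
theorem eq_or_exists_gap (hu : F.IsTangentVec u) : (∃ k ∈ F.K0, u = F.labelVec k) ∨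
    ∃ j k b, F.IsGapVec .base j k b ∧ 0 < prod u b := by
  rcases hu.two_le_or_eq with h0 | h0
  · have hu0 : 0 < u 0 := by linarith
    have h2 := hu.two_eq
    have h3 := hu.sq_eq
    rcases F.exists_alpha_eq_or_exists_gap (u 1 / u 0) with ⟨v, hv, hx⟩ | ⟨j, k, b, hb, hx⟩
    · left
      refine ⟨_, hv, (hu.prod_le_or_eq _).resolve_left fun hle => ?_⟩
      have hr := F.radius_pos v
      rw [labelVec_inner_of_mem_K0 hv, hx] at hle
      simp [prod, h2] at hle
      have h4 : u 3 = u 1 ^ 2 / u 0 := by rw [h3]; field_simp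
      rw [h4] at hle
      field_simp at hle
      nlinarith [mul_pos hu0 hr]
    · right
      refine ⟨j, k, b, hb, ?_⟩
      have hb2 := hb.isDualTriple.orthogonal₁
      rw [StripCircles.prod_base] at hb2
      have hb2' : b 2 = 0 := by linarith
      have e : prod u b = -u 0 / 2 * eval b ((u 1 / u 0 : ℝ) : ℂ) := by
        have h4 : u 3 = u 1 ^ 2 / u 0 := by rw [h3]; field_simp
        simp only [prod, eval, hb2', h4, Complex.ofReal_re, Complex.ofReal_im]
        field_simp
        ring
      rw [e]
      exact mul_pos_of_neg_of_neg (by linarith) hx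
  · exact Or.inl ⟨_, top_mem_K0, h0⟩

end IsTangentVec

end FordConfiguration

/-! ### Points of tangency -/

namespace CircleVec

/-- The point of tangency with the real line of a circle tangent to it. -/
def contact (v : CircleVec) : ℝ := v 1 / v 0

/-- The product of two circles tangent to the real line from above. -/
theorem prod_eq_of_contact {v w : CircleVec} (hv : v 0 ≠ 0) (hw : w 0 ≠ 0) (hv2 : v 2 = 1)
    (hw2 : w 2 = 1) (hv3 : v 1 ^ 2 = v 0 * v 3) (hw3 : w 1 ^ 2 = w 0 * w 3) :
    prod v w = 1 - v 0 * w 0 * (contact v - contact w) ^ 2 / 2 := by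
  have h1 : v 3 = v 1 ^ 2 / v 0 := by rw [hv3]; field_simp
  have h2 : w 3 = w 1 ^ 2 / w 0 := by rw [hw3]; field_simp
  simp only [prod, contact, hv2, hw2, h1, h2]
  field_simp
  ring

/-- The product of a circle tangent to the real line with a circle orthogonal to it. -/
theorem prod_eq_eval_contact {v b : CircleVec} (hv : v 0 ≠ 0) (hv3 : v 1 ^ 2 = v 0 * v 3)
    (hb : b 2 = 0) : prod v b = -v 0 / 2 * eval b (contact v : ℂ) := by
  have h1 : v 3 = v 1 ^ 2 / v 0 := by rw [hv3]; field_simp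
  simp only [prod, eval, contact, hb, h1, Complex.ofReal_re, Complex.ofReal_im]
  field_simp
  ring

theorem mul_neg_iff_between {x y z : ℝ} : (z - x) * (z - y) < 0 ↔ min x y < z ∧ z < max x y := by
  rw [mul_neg_iff, min_lt_iff, lt_max_iff]
  constructor
  · rintro (⟨h1, h2⟩ | ⟨h1, h2⟩)
    · exact ⟨Or.inl (by linarith), Or.inr (by linarith)⟩
    · exact ⟨Or.inr (by linarith), Or.inl (by linarith)⟩
  · rintro ⟨h1 | h1, h2 | h2⟩
    · linarith
    · left; constructor <;> linarith
    · right; constructor <;> linarith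
    · linarith

end CircleVec

namespace FordConfiguration

open StripCircles

variable {F : FordConfiguration}

/-! ### Frames: comparing sizes and positions of image circles -/

/-- Isometries of the space of circle vectors which preserve the upper half-plane and for which the
images of circles of the packing tangent to the real line have nonnegative curvature. -/
structure IsFrame (F : FordConfiguration) (M : CircleVec → CircleVec) : Prop where
  prod_eq : ∀ v w, prod (M v) (M w) = prod v w
  base_eq : M (F.labelVec .base) = F.labelVec .base
  nonneg : ∀ u, F.IsTangentVec u → 0 ≤ M u 0

namespace IsFrame

variable {M : CircleVec → CircleVec}

theorem two_eq (hM : F.IsFrame M) {u : CircleVec} (hu : F.IsTangentVec u) : M u 2 = 1 := by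
  have h := hM.prod_eq u (F.labelVec .base)
  rw [hM.base_eq, hu.prod_base, StripCircles.prod_base] at h
  linarith

theorem sq_eq (hM : F.IsFrame M) {u : CircleVec} (hu : F.IsTangentVec u) :
    M u 1 ^ 2 = M u 0 * M u 3 := by
  have h := hM.prod_eq u u
  rw [hu.unit] at h
  simp only [prod, hM.two_eq hu] at h
  linarith

theorem contact_ne (hM : F.IsFrame M) {u v : CircleVec} (hu : F.IsTangentVec u)
    (hv : F.IsTangentVec v) (hu0 : M u 0 ≠ 0) (hv0 : M v 0 ≠ 0) (h : prod u v ≤ -1) :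
    contact (M u) ≠ contact (M v) := by
  intro he
  rw [← hM.prod_eq, prod_eq_of_contact hu0 hv0 (hM.two_eq hu) (hM.two_eq hv) (hM.sq_eq hu)
    (hM.sq_eq hv), he] at h
  norm_num at h

theorem gap_two_eq (hM : F.IsFrame M) {j k : Label F.n} {b : CircleVec}
    (hb : F.IsGapVec .base j k b) : M b 2 = 0 := by
  have h := hM.prod_eq b (F.labelVec .base)
  rw [hM.base_eq, hb.isDualTriple.orthogonal₁, StripCircles.prod_base] at h
  linarith

theorem prod_gap (hM : F.IsFrame M) {u : CircleVec} (hu : F.IsTangentVec u) (hu0 : M u 0 ≠ 0)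
    {j k : Label F.n} {b : CircleVec} (hb : F.IsGapVec .base j k b) :
    prod u b = -M u 0 / 2 * eval (M b) (contact (M u) : ℂ) := by
  rw [← hM.prod_eq, prod_eq_eval_contact hu0 (hM.sq_eq hu) (hM.gap_two_eq hb)]

/-- A circle tangent to the real line at infinity in a frame lies above the other ones. -/
theorem three_pos (hM : F.IsFrame M) {u : CircleVec} (hu : F.IsTangentVec u) (hu0 : M u 0 = 0)
    {i : Label F.n} (hi0 : 0 < M (F.labelVec i) 0) (hi : i ∈ F.K0) : 0 < M u 3 := by
  have hle := (hu.prod_le_or_eq i).resolve_right fun e => by rw [← e] at hi0; linarith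
  have h2 := hM.two_eq hu
  have h1 := hM.sq_eq hu
  rw [hu0, zero_mul] at h1
  have h1' : M u 1 = 0 := by simpa using h1
  rw [← hM.prod_eq] at hle
  simp only [prod, hu0, h1', h2, hM.two_eq (.of_mem_K0 hi)] at hle
  by_contra! h
  nlinarith

theorem prod_gap_of_zero (hM : F.IsFrame M) {u : CircleVec} (hu : F.IsTangentVec u)
    (hu0 : M u 0 = 0) {j k : Label F.n} {b : CircleVec} (hb : F.IsGapVec .base j k b) :
    prod u b = -(M u 3 * M b 0) / 2 := by
  have h1 := hM.sq_eq hu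
  rw [hu0, zero_mul] at h1
  have h1' : M u 1 = 0 := by simpa using h1
  rw [← hM.prod_eq]
  simp only [prod, hu0, h1', hM.gap_two_eq hb]
  ring

theorem isDualTriple (hM : F.IsFrame M) {j k : Label F.n} {b : CircleVec}
    (hb : F.IsGapVec .base j k b) :
    IsDualTriple (M (F.labelVec .base)) (M (F.labelVec j)) (M (F.labelVec k)) (M b) := by
  have h := hb.isDualTriple
  constructor <;> rw [hM.prod_eq]
  exacts [h.unit₁, h.unit₂, h.unit₃, h.dual_unit, h.tangent₁₂, h.tangent₂₃, h.tangent₁₃,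
    h.orthogonal₁, h.orthogonal₂, h.orthogonal₃]

/-- A circle in a gap between two others is smaller than both of them. -/
theorem le_of_gap (hM : F.IsFrame M) {u : CircleVec} (hu : F.IsTangentVec u)
    {j k : Label F.n} {b : CircleVec} (hb : F.IsGapVec .base j k b) (hub : 0 < prod u b)
    (hb0 : 0 ≤ M b 0) : M (F.labelVec j) 0 ≤ M u 0 := by
  have hK := mem_K0_of_isGapVec hb
  have hd := hb.isDualTriple
  have hle : ∀ m, prod b (F.labelVec m) = 0 → prod u (F.labelVec m) ≤ -1 := fun m hm =>
    (hu.prod_le_or_eq m).resolve_right fun e => by rw [e, prod_comm, hm] at hub; linarith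
  have hj := hle j hd.orthogonal₂
  have hk := hle k hd.orthogonal₃
  have he := congrFun ((hM.isDualTriple hb).expand (M u)) 0
  simp only [hM.prod_eq, hu.prod_base] at he
  rw [hM.base_eq] at he
  simp only [Pi.add_apply, Pi.smul_apply, smul_eq_mul] at he
  have hz : F.labelVec .base 0 = 0 := rfl
  rw [hz] at he
  have n1 := hM.nonneg _ (.of_mem_K0 hK.1)
  have n2 := hM.nonneg _ (.of_mem_K0 hK.2)
  -- In the expansion of `M u`, the coefficient of `j` is at least 1 because both products in it are
  -- at most -1. The base has curvature 0, and the other terms are nonnegative.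
  have p1 := mul_nonneg (by linarith : 0 ≤ -(-1 + prod u (F.labelVec k)) / 2 - 1) n1
  have p2 := mul_nonneg (by linarith : 0 ≤ -(-1 + prod u (F.labelVec j)) / 2) n2
  have p3 := mul_nonneg hub.le hb0
  rw [he]
  linarith

/-- On the real line `M b` is a quadratic that is negative at the point of `u` and nonnegative at
those of `i` and `j`. So the part of the line in the gap is an interval contained in the segment
from `i` to `j`, and the circle `k` touches the line at one of its endpoints. -/
theorem contact_of_gap (hM : F.IsFrame M) {i j : Label F.n} (hi : i ∈ F.K0) (hj : j ∈ F.K0)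
    {u : CircleVec} (hu : F.IsTangentVec u) (hi0 : 0 < M (F.labelVec i) 0)
    (hj0 : 0 < M (F.labelVec j) 0) (hu0 : 0 < M u 0)
    (hiu : contact (M (F.labelVec i)) < contact (M u))
    (huj : contact (M u) < contact (M (F.labelVec j))) {k k' : Label F.n} {b : CircleVec}
    (hb : F.IsGapVec .base k k' b) (hub : 0 < prod u b) (hki : k ≠ i) (hkj : k ≠ j) :
    0 < M (F.labelVec k) 0 ∧ M (F.labelVec k) 0 ≤ M u 0 ∧
      contact (M (F.labelVec i)) < contact (M (F.labelVec k)) ∧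
      contact (M (F.labelVec k)) < contact (M (F.labelVec j)) := by
  have hk := (mem_K0_of_isGapVec hb).1
  have tk := IsTangentVec.of_mem_K0 hk
  have ti := IsTangentVec.of_mem_K0 hi
  have tj := IsTangentVec.of_mem_K0 hj
  have hd := hb.isDualTriple
  have eu := hM.prod_gap hu hu0.ne' hb
  have ei := hM.prod_gap ti hi0.ne' hb
  have ej := hM.prod_gap tj hj0.ne' hb
  have ni := hb.nonpos i
  have nj := hb.nonpos j
  rw [prod_comm] at ni nj
  have fu : eval (M b) (contact (M u) : ℂ) < 0 := by
    by_contra! h; nlinarith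
  have fi : 0 ≤ eval (M b) (contact (M (F.labelVec i)) : ℂ) := by
    by_contra! h; nlinarith
  have fj : 0 ≤ eval (M b) (contact (M (F.labelVec j)) : ℂ) := by
    by_contra! h; nlinarith
  have hb2 := hM.gap_two_eq hb
  have ev : ∀ x : ℝ, eval (M b) (x : ℂ) = M b 0 * x ^ 2 - 2 * M b 1 * x + M b 3 := fun x => by
    simp [eval]
  rw [ev] at fu fi fj
  have hb0 : 0 < M b 0 := by
    by_contra! h
    generalize contact (M u) = y at *
    generalize contact (M (F.labelVec i)) = x at *
    generalize contact (M (F.labelVec j)) = z at *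
    nlinarith [mul_nonneg (sub_nonneg.mpr huj.le) fi, mul_nonneg (sub_nonneg.mpr hiu.le) fj,
      mul_nonneg (mul_nonneg (mul_nonneg (neg_nonneg.mpr h) (sub_nonneg.mpr huj.le))
        (sub_nonneg.mpr hiu.le)) (sub_nonneg.mpr (hiu.trans huj).le),
      mul_pos (sub_pos.mpr (hiu.trans huj)) (neg_pos.mpr fu)]
  -- A circle touching at infinity has product `-(M u 3 * M b 0) / 2` with `b`, which is nonzero
  -- here, while `k` is orthogonal to `b`.
  have hk0 : 0 < M (F.labelVec k) 0 := by
    refine lt_of_le_of_ne (hM.nonneg _ tk) fun h0 => ?_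
    have h1 := hM.prod_gap_of_zero tk h0.symm hb
    rw [prod_comm, hd.orthogonal₂] at h1
    have h2 := hM.three_pos tk h0.symm hi0 hi
    have := mul_pos h2 hb0
    linarith
  have ek := hM.prod_gap tk hk0.ne' hb
  rw [prod_comm, hd.orthogonal₂] at ek
  have fk : eval (M b) (contact (M (F.labelVec k)) : ℂ) = 0 := by
    have := mul_eq_zero.mp ek.symm
    exact this.resolve_left (by linarith)
  rw [ev] at fk
  have ci := hM.contact_ne tk ti hk0.ne' hi0.ne' (F.prod_labelVec_le k i hki)
  have cj := hM.contact_ne tk tj hk0.ne' hj0.ne' (F.prod_labelVec_le k j hkj)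
  refine ⟨hk0, hM.le_of_gap hu hb hub hb0.le, ?_, ?_⟩
  · refine lt_of_le_of_ne ?_ ci.symm
    by_contra! h
    generalize contact (M u) = y at *
    generalize contact (M (F.labelVec i)) = x at *
    generalize contact (M (F.labelVec k)) = z at *
    nlinarith [mul_nonneg (sub_nonneg.mpr (h.trans hiu).le) fi,
      mul_pos (sub_pos.mpr h) (neg_pos.mpr fu),
      mul_pos (mul_pos (mul_pos hb0 (sub_pos.mpr h)) (sub_pos.mpr hiu))
        (sub_pos.mpr (h.trans hiu))]
  · refine lt_of_le_of_ne ?_ cj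
    by_contra! h
    generalize contact (M u) = y at *
    generalize contact (M (F.labelVec j)) = x at *
    generalize contact (M (F.labelVec k)) = z at *
    nlinarith [mul_nonneg (sub_nonneg.mpr (huj.trans h).le) fj,
      mul_pos (sub_pos.mpr h) (neg_pos.mpr fu),
      mul_pos (mul_pos (mul_pos hb0 (sub_pos.mpr h)) (sub_pos.mpr huj))
        (sub_pos.mpr (huj.trans h))]

/-- If a circle of the packing touches the real line between two circles of the configuration, then
either a circle of the configuration which is at least as large does so, or the circle lies in the
gap between the two circles. -/
theorem exists_between_of_lt (hM : F.IsFrame M) {i j : Label F.n} (hi : i ∈ F.K0) (hj : j ∈ F.K0)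
    {u : CircleVec} (hu : F.IsTangentVec u) (hi0 : 0 < M (F.labelVec i) 0)
    (hj0 : 0 < M (F.labelVec j) 0) (hu0 : 0 < M u 0)
    (hiu : contact (M (F.labelVec i)) < contact (M u))
    (huj : contact (M u) < contact (M (F.labelVec j))) :
    (∃ k ∈ F.K0, k ≠ i ∧ k ≠ j ∧ 0 < M (F.labelVec k) 0 ∧ M (F.labelVec k) 0 ≤ M u 0 ∧
      contact (M (F.labelVec i)) < contact (M (F.labelVec k)) ∧
      contact (M (F.labelVec k)) < contact (M (F.labelVec j))) ∨
    ∃ b, F.IsGapVec .base i j b ∧ eval (M b) (contact (M u) : ℂ) < 0 := by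
  rcases hu.eq_or_exists_gap with ⟨k, hk, rfl⟩ | ⟨k, k', b, hb, hub⟩
  · left
    refine ⟨k, hk, ?_, ?_, hu0, le_rfl, hiu, huj⟩
    · rintro rfl; exact lt_irrefl _ hiu
    · rintro rfl; exact lt_irrefl _ huj
  · have hkk' : k ≠ k' := fun e => by
      have := hb.isDualTriple.tangent₂₃
      rw [e, F.labelVec_unit] at this
      norm_num at this
    by_cases h : k ≠ i ∧ k ≠ j
    · exact Or.inl ⟨k, (mem_K0_of_isGapVec hb).1, h.1, h.2,
        hM.contact_of_gap hi hj hu hi0 hj0 hu0 hiu huj hb hub h.1 h.2⟩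
    by_cases h' : k' ≠ i ∧ k' ≠ j
    · exact Or.inl ⟨k', (mem_K0_of_isGapVec hb).2, h'.1, h'.2,
        hM.contact_of_gap hi hj hu hi0 hj0 hu0 hiu huj hb.swap₂₃ hub h'.1 h'.2⟩
    right
    have hev : eval (M b) (contact (M u) : ℂ) < 0 := by
      have eu := hM.prod_gap hu hu0.ne' hb
      by_contra! h; nlinarith
    have : (k = i ∧ k' = j) ∨ (k = j ∧ k' = i) := by
      clear hb
      grind
    rcases this with ⟨rfl, rfl⟩ | ⟨rfl, rfl⟩
    · exact ⟨b, hb, hev⟩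
    · exact ⟨b, hb.swap₂₃, hev⟩

theorem exists_between (hM : F.IsFrame M) {i j : Label F.n} (hi : i ∈ F.K0) (hj : j ∈ F.K0)
    {u : CircleVec} (hu : F.IsTangentVec u) (hi0 : 0 < M (F.labelVec i) 0)
    (hj0 : 0 < M (F.labelVec j) 0) (hu0 : 0 < M u 0)
    (h : (contact (M u) - contact (M (F.labelVec i))) *
      (contact (M u) - contact (M (F.labelVec j))) < 0) :
    (∃ k ∈ F.K0, k ≠ i ∧ k ≠ j ∧ 0 < M (F.labelVec k) 0 ∧ M (F.labelVec k) 0 ≤ M u 0 ∧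
      (contact (M (F.labelVec k)) - contact (M (F.labelVec i))) *
      (contact (M (F.labelVec k)) - contact (M (F.labelVec j))) < 0) ∨
    ∃ b, F.IsGapVec .base i j b ∧ eval (M b) (contact (M u) : ℂ) < 0 := by
  rcases mul_neg_iff.mp h with ⟨h1, h2⟩ | ⟨h1, h2⟩
  · rcases hM.exists_between_of_lt hi hj hu hi0 hj0 hu0 (by linarith) (by linarith) with
      ⟨k, hk, h3, h4, h5, h6, h7, h8⟩ | h
    · exact Or.inl ⟨k, hk, h3, h4, h5, h6, mul_neg_of_pos_of_neg (by linarith) (by linarith)⟩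
    · exact Or.inr h
  · rcases hM.exists_between_of_lt hj hi hu hj0 hi0 hu0 (by linarith) (by linarith) with
      ⟨k, hk, h3, h4, h5, h6, h7, h8⟩ | ⟨b, hb, h⟩
    · exact Or.inl ⟨k, hk, h4, h3, h5, h6, mul_neg_of_neg_of_pos (by linarith) (by linarith)⟩
    · exact Or.inr ⟨b, hb.swap₂₃, h⟩

/-- The dual circle of the gap of two circles touches the real line in their points of tangency. -/
theorem eval_gap (hM : F.IsFrame M) {i j : Label F.n} (hij : i ≠ j) {b : CircleVec}
    (hb : F.IsGapVec .base i j b) (hi0 : 0 < M (F.labelVec i) 0)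
    (hj0 : 0 < M (F.labelVec j) 0) : M b 0 ≠ 0 ∧ ∀ x : ℝ, eval (M b) (x : ℂ) =
      M b 0 * ((x - contact (M (F.labelVec i))) * (x - contact (M (F.labelVec j)))) := by
  obtain ⟨hi, hj⟩ := mem_K0_of_isGapVec hb
  have ti := IsTangentVec.of_mem_K0 hi
  have tj := IsTangentVec.of_mem_K0 hj
  have hd := hb.isDualTriple
  have ei := hM.prod_gap ti hi0.ne' hb
  have ej := hM.prod_gap tj hj0.ne' hb
  rw [prod_comm, hd.orthogonal₂] at ei
  rw [prod_comm, hd.orthogonal₃] at ej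
  have fi := (mul_eq_zero.mp ei.symm).resolve_left (by linarith)
  have fj := (mul_eq_zero.mp ej.symm).resolve_left (by linarith)
  have ev : ∀ x : ℝ, eval (M b) (x : ℂ) = M b 0 * x ^ 2 - 2 * M b 1 * x + M b 3 := fun x => by
    simp [eval]
  have hne := hM.contact_ne ti tj hi0.ne' hj0.ne' (F.prod_labelVec_le i j hij)
  have hu := hM.prod_eq b b
  rw [hd.dual_unit] at hu
  simp only [prod, hM.gap_two_eq hb] at hu
  rw [ev] at fi fj
  generalize contact (M (F.labelVec i)) = y at *
  generalize contact (M (F.labelVec j)) = z at *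
  have h1 : (y - z) * (M b 0 * (y + z) - 2 * M b 1) = 0 := by linear_combination fi - fj
  have h2 := (mul_eq_zero.mp h1).resolve_left (sub_ne_zero.mpr hne)
  refine ⟨fun h0 => ?_, fun x => ?_⟩
  · rw [h0] at h2 hu
    have : M b 1 = 0 := by linarith
    rw [this] at hu
    norm_num at hu
  · rw [ev]
    linear_combination fi + (x - y) * h2

end IsFrame

theorem moebius_zero (γ : SL(2, ℝ)) (v : CircleVec) :
    moebius γ v 0 = v 0 * γ 1 1 ^ 2 + 2 * γ 1 0 * γ 1 1 * v 1 + γ 1 0 ^ 2 * v 3 := rfl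

theorem IsTangentVec.moebius_nonneg {u : CircleVec} (hu : F.IsTangentVec u) (γ : SL(2, ℝ)) :
    0 ≤ moebius γ u 0 := by
  rw [moebius_zero]
  rcases hu.two_le_or_eq with h | h
  · have h1 := hu.sq_eq
    have : 0 ≤ u 0 * (u 0 * γ 1 1 ^ 2 + 2 * γ 1 0 * γ 1 1 * u 1 + γ 1 0 ^ 2 * u 3) := by
      have : u 0 * (u 0 * γ 1 1 ^ 2 + 2 * γ 1 0 * γ 1 1 * u 1 + γ 1 0 ^ 2 * u 3) =
          (u 0 * γ 1 1 + γ 1 0 * u 1) ^ 2 := by linear_combination -(γ 1 0 ^ 2) * h1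
      rw [this]; positivity
    exact nonneg_of_mul_nonneg_right this (by linarith)
  · rw [h]
    simp [labelVec]
    positivity

theorem moebius_base (γ : SL(2, ℝ)) : moebius γ (F.labelVec .base) = F.labelVec .base := by
  ext i; fin_cases i <;> simp [moebius, labelVec]

theorem isFrame_moebius (γ : SL(2, ℝ)) : F.IsFrame (moebius γ) where
  prod_eq := moebius_prod_moebius γ
  base_eq := moebius_base γ
  nonneg := fun _ hu => hu.moebius_nonneg γ

/-- This second kind of frame turns statements about circles inside a gap into statements about
circles outside it. -/
theorem IsFrame.comp_reflect {M : CircleVec → CircleVec} (hM : F.IsFrame M) {j k : Label F.n}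
    {b : CircleVec} (hb : F.IsGapVec .base j k b) : F.IsFrame fun v => M (reflect b v) where
  prod_eq := fun v w => by rw [hM.prod_eq, reflect_prod_reflect hb.isDualTriple.dual_unit]
  base_eq := by
    rw [reflect_eq_self (by rw [prod_comm]; exact hb.isDualTriple.orthogonal₁), hM.base_eq]
  nonneg := fun u hu => hM.nonneg _ (hu.reflect hb)

/-- Which circles of the packing touch the real line between two circles of the configuration, in
terms of the circles of the configuration. -/
theorem forall_not_between_iff (γ : SL(2, ℝ)) (T : ℝ) {i j : Label F.n} (hij : i ≠ j)
    (hi : i ∈ F.K0) (hj : j ∈ F.K0) (hi0 : 0 < moebius γ (F.labelVec i) 0)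
    (hj0 : 0 < moebius γ (F.labelVec j) 0) :
    (∀ u, F.IsTangentVec u → 0 < moebius γ u 0 → moebius γ u 0 ≤ T →
      ¬ (contact (moebius γ u) - contact (moebius γ (F.labelVec i))) *
        (contact (moebius γ u) - contact (moebius γ (F.labelVec j))) < 0) ↔
    (∀ b, F.IsGapVec .base i j b →
      (moebius γ b 0 < 0 → ∀ k ∈ F.K0, k ≠ i → k ≠ j → T < moebius γ (F.labelVec k) 0) ∧
      (0 < moebius γ b 0 → ∀ k ∈ F.K0, k ≠ i → k ≠ j →
        T < moebius γ (reflect b (F.labelVec k)) 0)) ∧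
    ((¬ ∃ b, F.IsGapVec .base i j b) → ∀ k ∈ F.K0, k ≠ i → k ≠ j →
      0 < moebius γ (F.labelVec k) 0 →
      (contact (moebius γ (F.labelVec k)) - contact (moebius γ (F.labelVec i))) *
        (contact (moebius γ (F.labelVec k)) - contact (moebius γ (F.labelVec j))) < 0 →
      T < moebius γ (F.labelVec k) 0) := by
  have hM := F.isFrame_moebius γ
  -- `eval_gap` factors the quadratic of the dual circle over the two points of tangency, so `prod u
  -- b` having the sign of `moebius γ b 0` places `u` between them.
  have between : ∀ {b u}, F.IsGapVec .base i j b → F.IsTangentVec u →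
      moebius γ b 0 * prod u b > 0 → 0 < moebius γ u 0 ∧
      (contact (moebius γ u) - contact (moebius γ (F.labelVec i))) *
        (contact (moebius γ u) - contact (moebius γ (F.labelVec j))) < 0 := by
    intro b u hb hu h
    have hu0 : 0 < moebius γ u 0 := by
      refine lt_of_le_of_ne (hM.nonneg u hu) fun h0 => ?_
      have h1 := hM.three_pos hu h0.symm hi0 hi
      rw [hM.prod_gap_of_zero hu h0.symm hb] at h
      nlinarith [mul_nonneg h1.le (sq_nonneg (moebius γ b 0))]
    refine ⟨hu0, ?_⟩
    rw [hM.prod_gap hu hu0.ne' hb, (hM.eval_gap hij hb hi0 hj0).2] at h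
    by_contra! h2
    nlinarith [mul_nonneg (mul_nonneg hu0.le (sq_nonneg (moebius γ b 0))) h2]
  constructor
  · intro h
    refine ⟨fun b hb => ⟨fun hlt k hk hki hkj => ?_, fun hgt k hk hki hkj => ?_⟩,
      fun _ k hk _ _ hk0 hbt => ?_⟩
    · by_contra! hle
      have tk := IsTangentVec.of_mem_K0 hk
      have h1 := hb.prod_le (fun e => base_notMem_K0 (e ▸ hk)) hki hkj
      rw [prod_comm] at h1
      obtain ⟨h2, h3⟩ := between hb tk (mul_pos_of_neg_of_neg hlt (by linarith))
      exact h _ tk h2 hle h3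
    · by_contra! hle
      have tk := (IsTangentVec.of_mem_K0 hk).reflect hb
      have h1 := hb.prod_le (fun e => base_notMem_K0 (e ▸ hk)) hki hkj
      rw [prod_comm] at h1
      obtain ⟨h2, h3⟩ := between hb tk (mul_pos hgt
        (by rw [prod_reflect_self hb.isDualTriple.dual_unit]; linarith))
      exact h _ tk h2 hle h3
    · by_contra! hle
      exact h _ (.of_mem_K0 hk) hk0 hle hbt
  · rintro ⟨h1, h2⟩ u hu hu0 huT hbt
    have key := hM.exists_between hi hj hu hi0 hj0 hu0 hbt
    by_cases hadj : ∃ b, F.IsGapVec .base i j b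
    · obtain ⟨b, hb⟩ := hadj
      obtain ⟨hne, hev⟩ := hM.eval_gap hij hb hi0 hj0
      obtain ⟨h3, h4⟩ := h1 b hb
      -- Negative sign: the gap lies outside the segment, so `exists_between` yields a circle of the
      -- configuration. Positive sign: the gap lies between the two points, and `exists_between` is
      -- applied to the reflected circle in the reflected frame.
      rcases lt_or_gt_of_ne hne with hlt | hgt
      · rcases key with ⟨k, hk, hki, hkj, -, hle, -⟩ | ⟨b', hb', hneg⟩
        · linarith [h3 hlt k hk hki hkj]
        · rw [isGapVec_unique hb hb', hev] at hneg
          nlinarith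
      · have hM' := hM.comp_reflect hb
        have hd := hb.isDualTriple
        have ri : reflect b (F.labelVec i) = F.labelVec i :=
          reflect_eq_self (by rw [prod_comm]; exact hd.orthogonal₂)
        have rj : reflect b (F.labelVec j) = F.labelVec j :=
          reflect_eq_self (by rw [prod_comm]; exact hd.orthogonal₃)
        have ru := reflect_reflect hd.dual_unit u
        rcases hM'.exists_between hi hj (hu.reflect hb) (by simpa only [ri] using hi0)
          (by simpa only [rj] using hj0) (by simpa only [ru] using hu0)
          (by simpa only [ri, rj, ru] using hbt) with
          ⟨k, hk, hki, hkj, -, hle, -⟩ | ⟨b', hb', hneg⟩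
        · rw [ru] at hle
          linarith [h4 hgt k hk hki hkj]
        · obtain rfl := isGapVec_unique hb hb'
          have e := (hM'.eval_gap hij hb' (by simpa only [ri] using hi0)
            (by simpa only [rj] using hj0)).2 (contact (moebius γ u))
          -- Reflecting `b'` in itself changes its sign, so in the reflected frame the gap is
          -- outside the segment and the second alternative is impossible.
          have e0 : moebius γ (reflect b' b') 0 = - moebius γ b' 0 := by
            have : reflect b' b' = -b' := by
              rw [reflect, hd.dual_unit]; ext i; simp; ring
            rw [this, moebius_zero, moebius_zero]
            simp only [Pi.neg_apply]; ring
          simp only [ru] at hneg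
          rw [e] at hneg
          simp only [ri, rj, e0] at hneg
          nlinarith
    · rcases key with ⟨k, hk, hki, hkj, hk0, hle, hkb⟩ | ⟨b', hb', -⟩
      · linarith [h2 hadj k hk hki hkj hk0 hkb]
      · exact hadj ⟨b', hb'⟩

/-! ### Circles of the packing tangent to the base line -/

theorem OrbitVec.zeroSet_mem_packing {i : Label F.n} {v : CircleVec} (hv : F.OrbitVec i v) :
    zeroSet v ∈ F.packing := by
  obtain ⟨x, hx⟩ := hv
  induction hx with
  | nil => exact ⟨1, one_mem _, i, by rw [F.carrier_circ]; simp⟩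
  | cons _ hb _ _ ih =>
    obtain ⟨σ, hσ, m, hm⟩ := ih
    obtain ⟨j, k, l, O, B, h, hO, hB⟩ := hb
    refine ⟨O.reflection * σ, mul_mem (Subgroup.subset_closure ⟨j, k, l, O, B, h, rfl⟩) hσ, m, ?_⟩
    rw [Equiv.Perm.coe_mul, Set.image_comp, ← hm, O.reflection_image]
    rcases hO with rfl | rfl
    · rfl
    · rw [reflect_neg]

theorem image_mem_packing {σ : Equiv.Perm Sphere} (hσ : σ ∈ F.reflectionGroup) {C : Set Sphere}
    (hC : C ∈ F.packing) : (σ : Sphere → Sphere) '' C ∈ F.packing := by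
  obtain ⟨τ, hτ, i, rfl⟩ := hC
  exact ⟨σ * τ, mul_mem hσ hτ, i, by rw [Equiv.Perm.coe_mul, Set.image_comp]⟩

/-- The packing is invariant under `γ`, so its circles may be parametrized as `γ`-images of orbit
vectors. Tangency at a finite real point then amounts to positive curvature together with product -1
with the base. -/
theorem isTangentCircle_iff {γ : SL(2, ℝ)} (hγ : mobius γ ∈ F.Gam) {T : ℝ} {C : Set Sphere}
    {x : ℝ} : F.IsTangentCircle T C x ↔ ∃ u, F.IsTangentVec u ∧ C = zeroSet (moebius γ u) ∧
      0 < moebius γ u 0 ∧ moebius γ u 0 ≤ T ∧ x = contact (moebius γ u) := by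
  have hbase : F.baseCircle = zeroSet (F.labelVec .base) := F.carrier_circ _
  have hM := F.isFrame_moebius γ
  constructor
  · rintro ⟨hC, ⟨O, rfl, hOT⟩, hx⟩
    obtain ⟨i, u, hu, huC⟩ := exists_orbitVec_of_mem_packing
      (image_mem_packing (inv_mem hγ.1) hC)
    have hC' : O.carrier = zeroSet (moebius γ u) := by
      rw [← mobius_image, ← huC, ← Set.image_comp, ← Equiv.Perm.coe_mul]
      simp
    have hV := hM.prod_eq u u
    rw [hu.unit] at hV
    have h0T : |moebius γ u 0| ≤ T := by
      rw [GenCircle.curvature_eq] at hOT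
      rw [GenCircle.carrier_eq] at hC'
      rcases eq_or_eq_neg_of_zeroSet_eq O.prod_vec_self hV hC' with h | h
      · rwa [h]
      · rwa [h, Pi.neg_apply, abs_neg]
    have hb := hM.prod_eq u (F.labelVec .base)
    rw [hM.base_eq, StripCircles.prod_base] at hb
    rw [hC', hbase] at hx
    have hinf : moebius γ u 0 ≠ 0 := fun h => by
      have : (OnePoint.infty : Sphere) ∈ ({((x : ℂ) : Sphere)} : Set Sphere) := by
        rw [← hx]; exact ⟨h, rfl⟩
      simp at this
    have hx1 : ((x : ℂ) : Sphere) ∈ zeroSet (moebius γ u) := by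
      have : ((x : ℂ) : Sphere) ∈ zeroSet (moebius γ u) ∩ zeroSet (F.labelVec .base) := by
        rw [hx]; rfl
      exact this.1
    -- The other real root of the circle equation is also a common point with the base, so it
    -- coincides with `x`.
    have hx2 : ((2 * moebius γ u 1 / moebius γ u 0 - x : ℝ) : ℂ) = (x : ℂ) := by
      rw [← OnePoint.coe_eq_coe, ← Set.mem_singleton_iff, ← hx]
      refine ⟨?_, ?_⟩
      · rw [coe_mem_zeroSet] at hx1 ⊢
        simp only [eval, Complex.ofReal_re, Complex.ofReal_im] at hx1 ⊢
        obtain ⟨s, hs⟩ : ∃ s, moebius γ u 1 = s * moebius γ u 0 :=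
          ⟨moebius γ u 1 / moebius γ u 0, by field_simp⟩
        have hs' : 2 * (s * moebius γ u 0) / moebius γ u 0 = 2 * s := by field_simp
        rw [hs] at hx1 ⊢
        rw [hs']
        linear_combination hx1
      · rw [coe_mem_zeroSet, eval_labelVec_base]; simp
    have hx3 : x = moebius γ u 1 / moebius γ u 0 := by
      have := Complex.ofReal_injective hx2
      field_simp at this ⊢
      linarith
    rw [coe_mem_zeroSet] at hx1
    simp only [eval, Complex.ofReal_re, Complex.ofReal_im, hx3] at hx1
    field_simp at hx1
    have hsq : moebius γ u 2 ^ 2 = 1 := by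
      simp only [prod] at hV
      linarith
    -- The double root leaves `±1` for the product with the base. Ping-pong excludes `+1`, and the
    -- base itself is excluded because it passes through infinity.
    have ht : F.IsTangentVec u := by
      refine ⟨⟨i, hu⟩, ?_⟩
      rcases hu.prod_le_or_eq .base with h | h
      · nlinarith
      · rw [h, moebius_base] at hinf
        exact absurd rfl hinf
    have hpos : 0 < moebius γ u 0 := lt_of_le_of_ne (hM.nonneg u ht) hinf.symm
    exact ⟨u, ht, hC', hpos, (le_abs_self _).trans h0T, hx3⟩
  · rintro ⟨u, hu, rfl, h0, hT, rfl⟩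
    have h2 := hM.two_eq hu
    have h1 := hM.sq_eq hu
    refine ⟨?_, ⟨GenCircle.circle ⟨contact (moebius γ u), 1 / moebius γ u 0⟩ (1 / moebius γ u 0)
      (by positivity), ?_, ?_⟩, ?_⟩
    · rw [← mobius_image]
      exact image_mem_packing hγ.1 hu.orbit.choose_spec.zeroSet_mem_packing
    · rw [GenCircle.carrier_eq]
      congr 1
      refine ext_coords ?_ ?_ ?_ ?_
      · simp [GenCircle.vec]
      · simp [GenCircle.vec, contact, h0.ne']
      · simp [GenCircle.vec, h2, h0.ne']
      · have h3 : moebius γ u 3 = moebius γ u 1 ^ 2 / moebius γ u 0 := by rw [h1]; field_simp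
        simp [GenCircle.vec, contact, h3]
        field_simp
    · simpa [GenCircle.curvature] using hT
    · rw [hbase]
      ext p
      induction p using OnePoint.rec with
      | infty => simp [h0.ne']
      | coe z =>
        simp only [Set.mem_inter_iff, coe_mem_zeroSet, eval_labelVec_base, Set.mem_singleton_iff,
          OnePoint.coe_eq_coe]
        have h3 : moebius γ u 3 = moebius γ u 1 ^ 2 / moebius γ u 0 := by rw [h1]; field_simp
        have e : ∀ x : ℝ, eval (moebius γ u) (x : ℂ) =
            moebius γ u 0 * (x - contact (moebius γ u)) ^ 2 := fun x => by
          simp [eval, contact, h3]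
          field_simp
          ring
        constructor
        · rintro ⟨hz1, hz2⟩
          have hz : z = (z.re : ℂ) := Complex.ext (by simp) (by simp; linarith)
          rw [hz, e] at hz1
          have := (mul_eq_zero.mp hz1).resolve_left h0.ne'
          rw [hz, sub_eq_zero.mp (pow_eq_zero_iff two_ne_zero |>.mp this)]
        · rintro rfl
          rw [e]
          simp

theorem isTangentCircle_labelVec_iff {γ : SL(2, ℝ)} (hγ : mobius γ ∈ F.Gam) {T : ℝ} {k : Label F.n}
    (hk : k ∈ F.K0) {x : ℝ} :
    F.IsTangentCircle T ((mobius γ : Sphere → Sphere) '' (F.circ k).carrier) x ↔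
      0 < moebius γ (F.labelVec k) 0 ∧ moebius γ (F.labelVec k) 0 ≤ T ∧
        x = contact (moebius γ (F.labelVec k)) := by
  have hM := F.isFrame_moebius γ
  rw [F.carrier_circ, mobius_image, isTangentCircle_iff hγ]
  constructor
  · rintro ⟨u, hu, hC, h⟩
    have h1 := hM.prod_eq u u
    rw [hu.unit] at h1
    have h2 := hM.prod_eq (F.labelVec k) (F.labelVec k)
    rw [F.labelVec_unit] at h2
    rcases eq_or_eq_neg_of_zeroSet_eq h1 h2 hC.symm with e | e
    · rwa [e]
    · have := hM.nonneg _ (.of_mem_K0 hk)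
      rw [e, Pi.neg_apply] at this
      linarith [h.1]
  · rintro h
    exact ⟨_, .of_mem_K0 hk, rfl, h⟩

theorem areNeighbours_iff {γ : SL(2, ℝ)} (hγ : mobius γ ∈ F.Gam) {T : ℝ} {i j : Label F.n}
    (hij : i ≠ j) (hi : i ∈ F.K0) (hj : j ∈ F.K0) :
    F.AreNeighbours T ((mobius γ : Sphere → Sphere) '' (F.circ i).carrier)
      ((mobius γ : Sphere → Sphere) '' (F.circ j).carrier) ↔
    (0 < moebius γ (F.labelVec i) 0 ∧ moebius γ (F.labelVec i) 0 ≤ T) ∧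
    (0 < moebius γ (F.labelVec j) 0 ∧ moebius γ (F.labelVec j) 0 ≤ T) ∧
    ∀ u, F.IsTangentVec u → 0 < moebius γ u 0 → moebius γ u 0 ≤ T →
      ¬ (contact (moebius γ u) - contact (moebius γ (F.labelVec i))) *
        (contact (moebius γ u) - contact (moebius γ (F.labelVec j))) < 0 := by
  constructor
  · rintro ⟨x, y, hx, hy, -, h⟩
    rw [isTangentCircle_labelVec_iff hγ hi] at hx
    rw [isTangentCircle_labelVec_iff hγ hj] at hy
    obtain ⟨hx0, hxT, rfl⟩ := hx
    obtain ⟨hy0, hyT, rfl⟩ := hy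
    refine ⟨⟨hx0, hxT⟩, ⟨hy0, hyT⟩, fun u hu hu0 huT hb => ?_⟩
    exact h _ ⟨_, (isTangentCircle_iff hγ).mpr ⟨u, hu, rfl, hu0, huT, rfl⟩⟩
      (mul_neg_iff_between.mp hb)
  · rintro ⟨⟨hx0, hxT⟩, ⟨hy0, hyT⟩, h⟩
    refine ⟨_, _, (isTangentCircle_labelVec_iff hγ hi).mpr ⟨hx0, hxT, rfl⟩,
      (isTangentCircle_labelVec_iff hγ hj).mpr ⟨hy0, hyT, rfl⟩,
      (isFrame_moebius γ).contact_ne (.of_mem_K0 hi) (.of_mem_K0 hj) hx0.ne' hy0.ne'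
        (F.prod_labelVec_le i j hij), ?_⟩
    rintro z ⟨C, hC⟩ hz
    obtain ⟨u, hu, -, hu0, huT, rfl⟩ := (isTangentCircle_iff hγ).mp hC
    exact h u hu hu0 huT (mul_neg_iff_between.mpr hz)

/-- No element of the group maps the point of tangency of another circle to `∞`. -/
theorem moebius_labelVec_zero_ne {γ : SL(2, ℝ)} (hγ : mobius γ ∈ F.Gam) {k : Label F.n}
    (hk : k ∈ F.K0) (hkt : k ≠ .top) : moebius γ (F.labelVec k) 0 ≠ 0 := by
  intro h0
  have hM := F.isFrame_moebius γ
  have tk := IsTangentVec.of_mem_K0 hk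
  obtain ⟨v, hv, hC⟩ := exists_orbitVec hγ.1 k
  rw [F.carrier_circ, mobius_image] at hC
  have h2 := hM.prod_eq (F.labelVec k) (F.labelVec k)
  rw [F.labelVec_unit] at h2
  have hbase : v ≠ F.labelVec .base := fun e => by
    rw [e] at hv
    exact base_notMem_K0 (hv.eq_of_labelVec ▸ hk)
  have hvb := (hv.prod_le_or_eq .base).resolve_right hbase
  rw [StripCircles.prod_base] at hvb
  have ht := hM.two_eq tk
  rcases eq_or_eq_neg_of_zeroSet_eq h2 hv.unit hC with e | e
  -- A line touching the base at infinity from above has product 1 with the upper line. By ping-pong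
  -- it is the upper line, which lies only in its own orbit.
  · rcases hv.prod_le_or_eq .top with h | h
    · rw [StripCircles.prod_top, e, h0, ht] at h
      norm_num at h
    · rw [h] at hv
      exact hkt hv.eq_of_labelVec
  · rw [e, Pi.neg_apply, ht] at hvb
    norm_num at hvb

end FordConfiguration

theorem mul_neg_iff_of_pos {a b : ℝ} (ha : 0 < a) : a * b < 0 ↔ b < 0 := by
  rw [← neg_pos, ← mul_neg, mul_pos_iff_of_pos_left ha, neg_pos]

namespace FordConfiguration

open StripCircles

variable {F : FordConfiguration}

/-! ### The regions `Omega` -/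

theorem adjacent_iff {i j : Label F.n} : F.Adjacent i j ↔ ∃ b, F.IsGapVec .base i j b := by
  constructor
  · rintro ⟨O, B, h⟩
    obtain ⟨b, hb, -⟩ := h.exists_isGapVec
    exact ⟨b, hb⟩
  · rintro ⟨b, O, B, h, -⟩
    exact ⟨O, B, h⟩

/-- The reflected circle has positive product with `b`, unlike the upper line, so it is a genuine
circle touching the base at a finite point. Its vector determines `α'` and `r'`, and the bounded
form is again the curvature of its image. -/
theorem reflectedBound_iff (γ : SL(2, ℝ)) (T : ℝ) {i j k : Label F.n} {O : GenCircle}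
    (hO : F.IsDual i j O) {b : CircleVec} (hb : F.IsGapVec .base i j b) (hk : k ∈ F.K0)
    (hki : k ≠ i) (hkj : k ≠ j) : F.ReflectedBound T (γ 1 0) (γ 1 1) O k ↔
      T < moebius γ (reflect b (F.labelVec k)) 0 := by
  obtain ⟨B, hO⟩ := hO
  obtain ⟨b', hb', himg⟩ := reflection_image_zeroSet hO
  obtain rfl := isGapVec_unique hb hb'
  have hd := hb'.isDualTriple
  have hne := hb'.prod_le (fun e => base_notMem_K0 (e ▸ hk)) hki hkj
  rw [prod_comm] at hne
  have hv := (IsTangentVec.of_mem_K0 hk).reflect hb'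
  set v := reflect b' (F.labelVec k) with hvdef
  have hvb : 2 ≤ prod v b' := by rw [prod_reflect_self hd.dual_unit]; linarith
  have h0 : 2 ≤ v 0 := hv.two_le_or_eq.resolve_right fun e => by
    have := hb'.nonpos .top
    rw [e, prod_comm] at hvb
    linarith
  have hv0 : 0 < v 0 := by linarith
  have h3 : v 3 = v 1 ^ 2 / v 0 := by rw [hv.sq_eq]; field_simp
  rw [ReflectedBound, F.carrier_circ, himg, ← hvdef, moebius_zero]
  have hvec : ∀ (α' r' : ℝ) (hr : 0 < r'),
      (GenCircle.circle ((α' : ℂ) + (r' : ℂ) * Complex.I) r' hr).vec =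
        ![1 / r', α' / r', 1, α' ^ 2 / r'] := fun α' r' hr => by
    refine ext_coords ?_ ?_ ?_ ?_ <;> simp [GenCircle.vec, hr.ne']
  constructor
  · rintro ⟨α', r', hr, hC, hT⟩
    rw [GenCircle.carrier_eq] at hC
    have e : v = ![1 / r', α' / r', 1, α' ^ 2 / r'] := by
      rcases eq_or_eq_neg_of_zeroSet_eq (GenCircle.prod_vec_self _) hv.unit hC.symm with e | e
      · rw [e, hvec]
      · exfalso
        rw [e, hvec] at hv0
        simp at hv0
        linarith
    refine hT.trans_eq ?_
    rw [e]
    simp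
    field_simp
    ring
  · intro hT
    refine ⟨v 1 / v 0, 1 / v 0, by positivity, ?_, hT.trans_eq ?_⟩
    · rw [GenCircle.carrier_eq, hvec]
      congr 1
      refine ext_coords ?_ ?_ ?_ ?_
      · simp
      · simp [hv0.ne']
      · exact hv.two_eq
      · simp [h3]; field_simp
    · rw [h3]; field_simp; ring

theorem moebius_inner_zero (γ : SL(2, ℝ)) {v : Fin F.n} (hv : Label.inner v ∈ F.K0) :
    moebius γ (F.labelVec (.inner v)) 0 = (γ 1 0 * F.alpha v + γ 1 1) ^ 2 / F.radius v := by
  have hr := F.radius_pos v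
  rw [moebius_zero, labelVec_inner_of_mem_K0 hv]
  simp
  field_simp
  ring

theorem moebius_top_zero (γ : SL(2, ℝ)) : moebius γ (F.labelVec .top) 0 = 2 * γ 1 0 ^ 2 := by
  rw [moebius_zero]
  simp [labelVec]
  ring

theorem contact_inner (γ : SL(2, ℝ)) {v : Fin F.n} (hv : Label.inner v ∈ F.K0)
    (hne : γ 1 0 * F.alpha v + γ 1 1 ≠ 0) : contact (moebius γ (F.labelVec (.inner v))) =
      (γ 0 0 * F.alpha v + γ 0 1) / (γ 1 0 * F.alpha v + γ 1 1) := by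
  have hr := F.radius_pos v
  rw [contact, moebius_inner_zero γ hv, labelVec_inner_of_mem_K0 hv]
  simp [moebius]
  field_simp
  ring

theorem contact_top (γ : SL(2, ℝ)) (hne : γ 1 0 ≠ 0) :
    contact (moebius γ (F.labelVec .top)) = γ 0 0 / γ 1 0 := by
  rw [contact, moebius_top_zero]
  simp [moebius, labelVec]
  field_simp

/-- The identity `γx - γy = (x - y) / ((cx + d)(cy + d))`; it converts betweenness of image points
into signs of `c α + d`. -/
theorem contact_inner_sub_inner (γ : SL(2, ℝ)) {v w : Fin F.n} (hv : Label.inner v ∈ F.K0)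
    (hw : Label.inner w ∈ F.K0) (hne : γ 1 0 * F.alpha v + γ 1 1 ≠ 0)
    (hne' : γ 1 0 * F.alpha w + γ 1 1 ≠ 0) :
    contact (moebius γ (F.labelVec (.inner v))) - contact (moebius γ (F.labelVec (.inner w))) =
      (F.alpha v - F.alpha w) / ((γ 1 0 * F.alpha v + γ 1 1) * (γ 1 0 * F.alpha w + γ 1 1)) := by
  have h := det_eq_one γ
  rw [contact_inner γ hv hne, contact_inner γ hw hne', div_sub_div _ _ hne hne']
  congr 1
  linear_combination (F.alpha v - F.alpha w) * h

theorem contact_top_sub_inner (γ : SL(2, ℝ)) {v : Fin F.n} (hv : Label.inner v ∈ F.K0)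
    (hne : γ 1 0 * F.alpha v + γ 1 1 ≠ 0) (hc : γ 1 0 ≠ 0) :
    contact (moebius γ (F.labelVec .top)) - contact (moebius γ (F.labelVec (.inner v))) =
      1 / (γ 1 0 * (γ 1 0 * F.alpha v + γ 1 1)) := by
  have h := det_eq_one γ
  rw [contact_inner γ hv hne, contact_top γ hc, div_sub_div _ _ hc hne]
  congr 1
  linear_combination h

theorem inner_den_ne {γ : SL(2, ℝ)} (hγ : mobius γ ∈ F.Gam) {v : Fin F.n}
    (hv : Label.inner v ∈ F.K0) : γ 1 0 * F.alpha v + γ 1 1 ≠ 0 := by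
  intro h
  apply moebius_labelVec_zero_ne hγ hv (by simp)
  rw [moebius_inner_zero γ hv, h]
  simp

theorem alpha_ne {v w : Fin F.n} (hv : Label.inner v ∈ F.K0) (hw : Label.inner w ∈ F.K0)
    (hvw : v ≠ w) : F.alpha v ≠ F.alpha w := by
  intro h
  have h1 := F.prod_labelVec_le (.inner v) (.inner w) (by simpa using hvw)
  have hrv := F.radius_pos v
  have hrw := F.radius_pos w
  rw [labelVec_inner_of_mem_K0 hv, labelVec_inner_of_mem_K0 hw, h] at h1
  simp [prod] at h1
  field_simp at h1
  nlinarith [mul_pos hrv hrw]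

theorem gap_two {i j : Label F.n} {b : CircleVec} (hb : F.IsGapVec .base i j b) : b 2 = 0 := by
  have := hb.isDualTriple.orthogonal₁
  rw [StripCircles.prod_base] at this
  linarith

theorem gap_inner {v : Fin F.n} (hv : Label.inner v ∈ F.K0) {b : CircleVec} (hb2 : b 2 = 0)
    (h0 : prod b (F.labelVec (.inner v)) = 0) :
    b 0 * F.alpha v ^ 2 - 2 * b 1 * F.alpha v + b 3 = 0 := by
  have hr := F.radius_pos v
  rw [labelVec_inner_of_mem_K0 hv] at h0
  simp [prod, hb2] at h0
  field_simp at h0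
  linarith

/-- The dual circle of the gap between two circles with finite points of tangency. -/
theorem gap_inner_inner {v w : Fin F.n} (hvw : v ≠ w) {b : CircleVec}
    (hb : F.IsGapVec .base (.inner v) (.inner w) b) :
    0 < b 0 ∧ ∀ x y : ℝ, b 0 * y ^ 2 + 2 * x * y * b 1 + x ^ 2 * b 3 =
      b 0 * ((x * F.alpha v + y) * (x * F.alpha w + y)) := by
  obtain ⟨hv, hw⟩ := mem_K0_of_isGapVec hb
  have hd := hb.isDualTriple
  have hb2 := gap_two hb
  have ev := gap_inner hv hb2 hd.orthogonal₂
  have ew := gap_inner hw hb2 hd.orthogonal₃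
  -- The upper line is not a side of this gap, which forces `b 0 ≥ 2`: the dual circle is bounded.
  have ht := hb.prod_le (l := .top) (by simp) (by simp) (by simp)
  rw [StripCircles.prod_top, hb2] at ht
  refine ⟨by linarith, fun x y => ?_⟩
  have h1 : (F.alpha v - F.alpha w) * (b 0 * (F.alpha v + F.alpha w) - 2 * b 1) = 0 := by
    linear_combination ev - ew
  have h2 := (mul_eq_zero.mp h1).resolve_left (sub_ne_zero.mpr (alpha_ne hv hw hvw))
  linear_combination x ^ 2 * ev - (x * y + x ^ 2 * F.alpha v) * h2

theorem alpha_first : F.alpha F.first = 0 := by simp [alpha, F.center_first]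

theorem alpha_last : F.alpha F.last = F.t / 2 := by simp [alpha, F.center_last]

theorem t_pos : 0 < F.t := by
  have h1 := (F.between F.last).1
  have h2 := alpha_ne first_mem_K0 last_mem_K0 F.first_ne_last
  rw [alpha_first, alpha_last] at h2
  have h3 : (F.center F.last).re = F.t / 2 := alpha_last
  rw [h3] at h1
  by_contra! h
  exact h2 (by linarith)

/-- The dual circle of a gap between the two lines. -/
theorem gap_inner_top {v : Fin F.n} {b : CircleVec} (hb : F.IsGapVec .base (.inner v) .top b) :
    b 0 = 0 ∧ ((b 1 = -1 ∧ v = F.first ∧ F.alpha v = 0) ∨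
      (b 1 = 1 ∧ v = F.last ∧ F.alpha v = F.t / 2)) ∧ b 3 = 2 * b 1 * F.alpha v := by
  obtain ⟨hv, -⟩ := mem_K0_of_isGapVec hb
  have hd := hb.isDualTriple
  have hb2 := gap_two hb
  have ev := gap_inner hv hb2 hd.orthogonal₂
  have h0 := hd.orthogonal₃
  rw [StripCircles.prod_top, hb2] at h0
  have h0' : b 0 = 0 := by linarith
  have hu := hd.dual_unit
  simp only [prod, hb2, h0'] at hu
  rw [h0'] at ev
  have h3 : b 3 = 2 * b 1 * F.alpha v := by linarith
  -- Here `b` is a vertical line through `α_v` and all other circles lie strictly on one side of it.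
  -- Since the outermost circles occur in the configuration, `v` is one of them.
  have side : ∀ {u : Fin F.n}, Label.inner u ∈ F.K0 → u ≠ v →
      b 1 * (F.alpha u - F.alpha v) / F.radius u ≤ -2 := fun {u} hu huv => by
    have hr := F.radius_pos u
    have := hb.prod_le (l := .inner u) (by simp) (by simpa using huv) (by simp)
    rw [labelVec_inner_of_mem_K0 hu] at this
    simp [prod, h0', hb2, h3] at this
    have e : b 1 * (F.alpha u - F.alpha v) / F.radius u =
        b 1 * (F.alpha u / F.radius u) - 2 * b 1 * F.alpha v * (F.radius u)⁻¹ / 2 := by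
      field_simp
    linarith
  have hbet := F.between v
  change 0 ≤ F.alpha v ∧ F.alpha v ≤ F.t / 2 at hbet
  have h1 : (b 1 - 1) * (b 1 + 1) = 0 := by linarith
  refine ⟨h0', ?_, h3⟩
  rcases mul_eq_zero.mp h1 with h1 | h1
  · have h1' : b 1 = 1 := by linarith
    right
    have : v = F.last := by
      by_contra hne
      have := side last_mem_K0 (Ne.symm hne)
      rw [h1', alpha_last, F.radius_last] at this
      linarith
    exact ⟨h1', this, by rw [this, alpha_last]⟩
  · have h1' : b 1 = -1 := by linarith
    left
    have : v = F.first := by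
      by_contra hne
      have := side first_mem_K0 (Ne.symm hne)
      rw [h1', alpha_first, F.radius_first] at this
      linarith
    exact ⟨h1', this, by rw [this, alpha_first]⟩

/-- The outermost circles are adjacent to the line `Im z = 1`. -/
theorem exists_gap_top {x : ℝ} (hx : ∀ v, F.alpha v < x ∨ ∀ w, x < F.alpha w) :
    ∃ v b, F.IsGapVec .base (.inner v) .top b ∧ b 1 * (F.alpha v - x) < 0 := by
  rcases F.exists_alpha_eq_or_exists_gap x with ⟨v, hv, h⟩ | ⟨j, k, b, hb, h⟩
  · exfalso
    rcases hx v with h' | h'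
    · linarith
    · linarith [h' v]
  obtain ⟨hj, hk⟩ := mem_K0_of_isGapVec hb
  have htop : ∀ {v}, F.IsGapVec .base (.inner v) .top b → b 1 * (F.alpha v - x) < 0 := by
    intro v hb
    obtain ⟨h0, -, h3⟩ := gap_inner_top hb
    simp [eval, h0, h3] at h
    linarith
  have hjk : j ≠ k := fun e => by
    have := hb.isDualTriple.tangent₂₃
    rw [e, F.labelVec_unit] at this
    norm_num at this
  cases j with
  | base => exact absurd hj base_notMem_K0
  | top =>
    cases k with
    | base => exact absurd hk base_notMem_K0
    | top => exact absurd rfl hjk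
    | inner v => exact ⟨v, b, hb.swap₂₃, htop hb.swap₂₃⟩
  | inner v =>
    cases k with
    | base => exact absurd hk base_notMem_K0
    | top => exact ⟨v, b, hb, htop hb⟩
    | inner w =>
      exfalso
      obtain ⟨h0, he⟩ := gap_inner_inner (by simpa using hjk) hb
      have e1 := he (-1) x
      have e2 : eval b (x : ℂ) = b 0 * x ^ 2 + 2 * (-1) * x * b 1 + (-1) ^ 2 * b 3 := by
        simp [eval]; ring
      rw [e2, e1] at h
      -- The disc of this dual circle meets the real line only between `α_v` and `α_w`, but `x` is
      -- to one side of all points of tangency.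
      have hpos : 0 < (-1 * F.alpha v + x) * (-1 * F.alpha w + x) := by
        rcases hx v with h1 | h1
        · rcases hx w with h2 | h2
          · exact mul_pos (by linarith) (by linarith)
          · linarith [h2 v]
        · exact mul_pos_of_neg_of_neg (by linarith [h1 v]) (by linarith [h1 w])
      nlinarith [mul_pos h0 hpos]

theorem adjacent_last_top : F.Adjacent (.inner F.last) .top := by
  have hb : ∀ v, F.alpha v ≤ F.t / 2 := fun v => (F.between v).2
  obtain ⟨v, b, hb', h⟩ := F.exists_gap_top (x := F.t / 2 + 1)
    fun v => Or.inl (by linarith [hb v])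
  obtain ⟨-, ⟨h1, -⟩ | ⟨-, rfl, -⟩, -⟩ := gap_inner_top hb'
  · rw [h1] at h; linarith [hb v]
  · exact adjacent_iff.mpr ⟨b, hb'⟩

theorem adjacent_first_top : F.Adjacent (.inner F.first) .top := by
  have hb : ∀ v, 0 ≤ F.alpha v := fun v => (F.between v).1
  obtain ⟨v, b, hb', h⟩ := F.exists_gap_top (x := -1)
    fun v => Or.inr fun w => by linarith [hb w]
  obtain ⟨-, ⟨-, rfl, -⟩ | ⟨h1, -⟩, -⟩ := gap_inner_top hb'
  · exact adjacent_iff.mpr ⟨b, hb'⟩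
  · rw [h1] at h; linarith [hb v]

/-! ### Neighbours and the regions `OmegaFin` and `OmegaInf` -/

theorem mem_omegaFin {T c d : ℝ} {v w : Fin F.n} : (c, d) ∈ F.OmegaFin T v w ↔ 0 ≤ c ∧
    (c * F.alpha v + d) ^ 2 / F.radius v ≤ T ∧ (c * F.alpha w + d) ^ 2 / F.radius w ≤ T ∧
    (F.Adjacent (.inner v) (.inner w) →
      ((c * F.alpha v + d) * (c * F.alpha w + d) < 0 →
        2 * c ^ 2 > T ∧ ∀ u, u ≠ v → u ≠ w → .inner u ∈ F.K0 →
          (c * F.alpha u + d) ^ 2 / F.radius u > T) ∧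
      ((c * F.alpha v + d) * (c * F.alpha w + d) > 0 →
        ∀ O, F.IsDual (.inner v) (.inner w) O →
          ∀ k ∈ F.K0, k ≠ .inner v → k ≠ .inner w → F.ReflectedBound T c d O k)) ∧
    (¬ F.Adjacent (.inner v) (.inner w) →
      ∀ k ∈ F.K0, k ≠ .inner v → k ≠ .inner w →
        (F.Between k (F.alpha v) (F.alpha w) ∧
            (c * F.alpha v + d) * (c * F.alpha w + d) > 0 ∨
          ¬ F.Between k (F.alpha v) (F.alpha w) ∧
            (c * F.alpha v + d) * (c * F.alpha w + d) < 0) →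
        F.form c d k > T) := by
  constructor
  · rintro ⟨c', d', h, h'⟩
    cases h
    exact h'
  · intro h
    exact ⟨c, d, rfl, h⟩

theorem mem_omegaInf {T c d : ℝ} {v : Fin F.n} : (c, d) ∈ F.OmegaInf T v ↔ 0 ≤ c ∧
    (c * F.alpha v + d) ^ 2 / F.radius v ≤ T ∧ 2 * c ^ 2 ≤ T ∧
    (F.Adjacent (.inner v) .top →
      (F.alpha v = 0 ∧ d > 0 ∨ F.alpha v = F.t / 2 ∧ c * F.t / 2 + d < 0 →
        ∀ u, u ≠ v → .inner u ∈ F.K0 → (c * F.alpha u + d) ^ 2 / F.radius u > T) ∧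
      (F.alpha v = 0 ∧ d < 0 ∨ F.alpha v = F.t / 2 ∧ c * F.t / 2 + d > 0 →
        ∀ O, F.IsDual (.inner v) .top O →
          ∀ u, u ≠ v → .inner u ∈ F.K0 → F.ReflectedBound T c d O (.inner u))) ∧
    (¬ F.Adjacent (.inner v) .top →
      ∀ u, u ≠ v → .inner u ∈ F.K0 →
        (F.alpha u > F.alpha v ∧ c * F.alpha v + d > 0 ∨
          F.alpha u < F.alpha v ∧ c * F.alpha v + d < 0) →
        (c * F.alpha u + d) ^ 2 / F.radius u > T) := by
  constructor
  · rintro ⟨c', d', h, h'⟩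
    cases h
    exact h'
  · intro h
    exact ⟨c, d, rfl, h⟩

theorem moebius_labelVec_zero (γ : SL(2, ℝ)) {k : Label F.n} (hk : k ∈ F.K0) :
    moebius γ (F.labelVec k) 0 = F.form (γ 1 0) (γ 1 1) k := by
  cases k with
  | base => exact absurd hk base_notMem_K0
  | top => exact moebius_top_zero γ
  | inner v => exact moebius_inner_zero γ hk

theorem areNeighbours_iff_mem_omegaFin {γ : SL(2, ℝ)} (hγ : mobius γ ∈ F.Gam) (hc : 0 ≤ γ 1 0)
    (T : ℝ) {v w : Fin F.n} (hvw : v ≠ w) (hv : Label.inner v ∈ F.K0)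
    (hw : Label.inner w ∈ F.K0) :
    F.AreNeighbours T ((mobius γ : Sphere → Sphere) '' (F.circ (.inner v)).carrier)
      ((mobius γ : Sphere → Sphere) '' (F.circ (.inner w)).carrier) ↔
    (γ 1 0, γ 1 1) ∈ F.OmegaFin T v w := by
  have hij : Label.inner v ≠ Label.inner w := by simpa using hvw
  have hlv := inner_den_ne hγ hv
  have hlw := inner_den_ne hγ hw
  have hAv : 0 < moebius γ (F.labelVec (.inner v)) 0 :=
    lt_of_le_of_ne ((IsTangentVec.of_mem_K0 hv).moebius_nonneg γ)
      (moebius_labelVec_zero_ne hγ hv (by simp)).symm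
  have hAw : 0 < moebius γ (F.labelVec (.inner w)) 0 :=
    lt_of_le_of_ne ((IsTangentVec.of_mem_K0 hw).moebius_nonneg γ)
      (moebius_labelVec_zero_ne hγ hw (by simp)).symm
  rw [areNeighbours_iff hγ hij hv hw, forall_not_between_iff γ T hij hv hw hAv hAw, mem_omegaFin,
    adjacent_iff]
  simp only [hAv, hAw, hc, true_and]
  rw [moebius_inner_zero γ hv, moebius_inner_zero γ hw]
  refine and_congr_right fun _ => and_congr_right fun _ => and_congr ?_ ?_
  · have sign : ∀ b, F.IsGapVec .base (.inner v) (.inner w) b → 0 < b 0 ∧ moebius γ b 0 =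
        b 0 * ((γ 1 0 * F.alpha v + γ 1 1) * (γ 1 0 * F.alpha w + γ 1 1)) := fun b hb => by
      obtain ⟨h0, h⟩ := gap_inner_inner hvw hb
      exact ⟨h0, by rw [moebius_zero, h]⟩
    constructor
    · rintro h ⟨b, hb⟩
      obtain ⟨h1, h2⟩ := h b hb
      obtain ⟨h0, hs⟩ := sign b hb
      rw [hs] at h1 h2
      refine ⟨fun hl => ?_, fun hl O hO k hk hkv hkw => ?_⟩
      · have h3 := h1 (mul_neg_of_pos_of_neg h0 hl)
        refine ⟨?_, fun u huv huw hu => ?_⟩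
        · rw [gt_iff_lt, ← moebius_top_zero (F := F)]
          exact h3 _ top_mem_K0 (by simp) (by simp)
        · rw [gt_iff_lt, ← moebius_inner_zero γ hu]
          exact h3 _ hu (by simpa using huv) (by simpa using huw)
      · rw [reflectedBound_iff γ T hO hb hk hkv hkw]
        exact h2 (mul_pos h0 hl) k hk hkv hkw
    · intro h b hb
      obtain ⟨h1, h2⟩ := h ⟨b, hb⟩
      obtain ⟨h0, hs⟩ := sign b hb
      rw [hs]
      refine ⟨fun hl k hk hkv hkw => ?_, fun hl k hk hkv hkw => ?_⟩
      · have h3 := h1 (by by_contra! h'; nlinarith [mul_nonneg h0.le h'])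
        cases k with
        | base => exact absurd hk base_notMem_K0
        | top => rw [moebius_top_zero]; exact h3.1
        | inner u =>
          rw [moebius_inner_zero γ hk]
          exact h3.2 u (by simpa using hkv) (by simpa using hkw) hk
      · obtain ⟨O, hO⟩ := adjacent_iff.mpr ⟨b, hb⟩
        rw [← reflectedBound_iff γ T hO hb hk hkv hkw]
        exact h2 ((mul_pos_iff_of_pos_left h0).mp hl) O hO k hk hkv hkw
  · refine imp_congr_right fun _ => forall_congr' fun k => forall_congr' fun hk =>
      forall_congr' fun hkv => forall_congr' fun hkw => ?_
    rw [← moebius_labelVec_zero γ hk, gt_iff_lt, ← and_imp]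
    refine imp_congr_left ?_
    cases k with
    | base => exact absurd hk base_notMem_K0
    | top =>
      have hnb : ¬ F.Between .top (F.alpha v) (F.alpha w) := by
        rintro ⟨u, hu, -⟩; simp at hu
      simp only [hnb, false_and, false_or, not_false_eq_true, true_and]
      -- For `c = 0` both sides fail: the image of the upper line has curvature 0, and the product
      -- of the two denominators is `d²`.
      rcases hc.eq_or_lt with h0 | h0
      · rw [moebius_top_zero, ← h0]
        simp only [zero_mul, zero_add]
        constructor
        · rintro ⟨h, -⟩; norm_num at h
        · intro h; nlinarith [mul_self_nonneg (γ 1 1)]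
      · rw [moebius_top_zero, contact_top_sub_inner γ hv hlv h0.ne',
          contact_top_sub_inner γ hw hlw h0.ne']
        have e : 1 / (γ 1 0 * (γ 1 0 * F.alpha v + γ 1 1)) *
            (1 / (γ 1 0 * (γ 1 0 * F.alpha w + γ 1 1))) = 1 / γ 1 0 ^ 2 *
            (1 / ((γ 1 0 * F.alpha v + γ 1 1) * (γ 1 0 * F.alpha w + γ 1 1))) := by
          field_simp
        rw [e]
        have h1 : 0 < 1 / γ 1 0 ^ 2 := by positivity
        rw [mul_neg_iff_of_pos h1, one_div_neg]
        exact ⟨fun h => h.2, fun h => ⟨by positivity, h⟩⟩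
    | inner u =>
      have hlu := inner_den_ne hγ hk
      have huv := alpha_ne hk hv (by simpa using hkv)
      have huw := alpha_ne hk hw (by simpa using hkw)
      have hb : F.Between (.inner u) (F.alpha v) (F.alpha w) ↔
          (F.alpha u - F.alpha v) * (F.alpha u - F.alpha w) < 0 := by
        rw [mul_neg_iff_between]
        constructor
        · rintro ⟨u', hu', h⟩
          cases hu'
          exact h
        · intro h
          exact ⟨u, rfl, h⟩
      rw [hb, contact_inner_sub_inner γ hk hv hlu hlv, contact_inner_sub_inner γ hk hw hlu hlw]
      have hAu : 0 < moebius γ (F.labelVec (.inner u)) 0 :=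
        lt_of_le_of_ne ((IsTangentVec.of_mem_K0 hk).moebius_nonneg γ)
          (moebius_labelVec_zero_ne hγ hk (by simp)).symm
      have hp : (F.alpha u - F.alpha v) * (F.alpha u - F.alpha w) ≠ 0 :=
        mul_ne_zero (sub_ne_zero.mpr huv) (sub_ne_zero.mpr huw)
      have hl := mul_ne_zero hlv hlw
      -- Up to a positive square, the product of the differences of image points is the original
      -- product over the two denominators. Thus betweenness is preserved when the denominators have
      -- the same sign and reversed otherwise.
      have e : (F.alpha u - F.alpha v) / ((γ 1 0 * F.alpha u + γ 1 1) *
          (γ 1 0 * F.alpha v + γ 1 1)) * ((F.alpha u - F.alpha w) /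
          ((γ 1 0 * F.alpha u + γ 1 1) * (γ 1 0 * F.alpha w + γ 1 1))) =
          1 / (γ 1 0 * F.alpha u + γ 1 1) ^ 2 * ((F.alpha u - F.alpha v) *
          (F.alpha u - F.alpha w) /
          ((γ 1 0 * F.alpha v + γ 1 1) * (γ 1 0 * F.alpha w + γ 1 1))) := by
        field_simp
      rw [e]
      have h1 : 0 < 1 / (γ 1 0 * F.alpha u + γ 1 1) ^ 2 := by positivity
      rw [mul_neg_iff_of_pos h1, div_neg_iff, not_lt]
      simp only [hAu, true_and]
      rw [le_iff_lt_or_eq, or_iff_left hp.symm]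
      tauto

theorem radius_le_half {v : Fin F.n} (hv : Label.inner v ∈ F.K0) : F.radius v ≤ 1 / 2 := by
  have h1 := inner_mem_K0.mp hv
  have h2 := F.im_add_radius_le v
  linarith

/-- Translations do not belong to the region of a circle and the line `Im z = 1`. -/
theorem notMem_omegaInf_of_eq_zero {γ : SL(2, ℝ)} (h0 : γ 1 0 = 0) (T : ℝ) {v : Fin F.n}
    (hv : Label.inner v ∈ F.K0) : (γ 1 0, γ 1 1) ∉ F.OmegaInf T v := by
  rw [mem_omegaInf]
  rintro ⟨-, hvT, -, hadj, hnadj⟩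
  have hd : γ 1 1 ≠ 0 := fun h => by
    have := det_eq_one γ
    rw [h0, h] at this
    norm_num at this
  have hr := F.radius_pos v
  have hr2 := radius_le_half hv
  rw [h0, zero_mul, zero_add] at hvT
  have hT : 2 * γ 1 1 ^ 2 ≤ T := by
    refine le_trans ?_ hvT
    rw [le_div_iff₀ hr]
    nlinarith [sq_nonneg (γ 1 1)]
  -- For `c = 0` a circle of radius 1/2 has form `2 d²`, which is minimal since all radii are at
  -- most 1/2. Each case below finds an outer circle, or its reflection, to which the region applies
  -- a violated lower bound.
  have hbig : ∀ u, F.radius u = 1 / 2 →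
      ¬ (γ 1 0 * F.alpha u + γ 1 1) ^ 2 / F.radius u > T := fun u hu h => by
    rw [h0, hu, zero_mul, zero_add] at h
    linarith
  have hbet := F.between v
  change 0 ≤ F.alpha v ∧ F.alpha v ≤ F.t / 2 at hbet
  have ht := F.t_pos
  by_cases h : F.Adjacent (.inner v) .top
  · obtain ⟨h1, h2⟩ := hadj h
    obtain ⟨b, hb⟩ := adjacent_iff.mp h
    obtain ⟨O, hO⟩ := h
    obtain ⟨hb0, hside, -⟩ := gap_inner_top hb
    obtain ⟨u, huv, huK, hur⟩ : ∃ u, u ≠ v ∧ Label.inner u ∈ F.K0 ∧ F.radius u = 1 / 2 := by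
      by_cases hf : v = F.first
      · exact ⟨F.last, by rw [hf]; exact F.first_ne_last.symm, last_mem_K0, F.radius_last⟩
      · exact ⟨F.first, Ne.symm hf, first_mem_K0, F.radius_first⟩
    -- The dual circle is a vertical line, so reflection preserves the radius 1/2 and hence the form
    -- `2 d²`.
    have href : ¬ F.ReflectedBound T (γ 1 0) (γ 1 1) O (.inner u) := by
      have e : moebius γ (reflect b (F.labelVec (.inner u))) 0 = 2 * γ 1 1 ^ 2 := by
        have e0 : reflect b (F.labelVec (.inner u)) 0 = 2 := by
          simp [reflect, hb0, labelVec_inner_zero, hur]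
        rw [moebius_zero, h0, e0]
        ring
      rw [reflectedBound_iff γ T hO hb huK (by simpa using huv) (by simp), e, not_lt]
      exact hT
    have hcases : (F.alpha v = 0 ∧ γ 1 1 > 0 ∨
        F.alpha v = F.t / 2 ∧ γ 1 0 * F.t / 2 + γ 1 1 < 0) ∨
        (F.alpha v = 0 ∧ γ 1 1 < 0 ∨ F.alpha v = F.t / 2 ∧ γ 1 0 * F.t / 2 + γ 1 1 > 0) := by
      rw [h0, zero_mul, zero_div, zero_add]
      rcases lt_or_gt_of_ne hd with h | h <;> rcases hside with ⟨-, -, h'⟩ | ⟨-, -, h'⟩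
      · exact Or.inr (Or.inl ⟨h', h⟩)
      · exact Or.inl (Or.inr ⟨h', h⟩)
      · exact Or.inl (Or.inl ⟨h', h⟩)
      · exact Or.inr (Or.inr ⟨h', h⟩)
    rcases hcases with h3 | h3
    · exact hbig u hur (h1 h3 u huv huK)
    · exact href (h2 h3 O hO u huv huK)
  · have hlast : v ≠ F.last := fun e => h (e ▸ adjacent_last_top)
    have hfirst : v ≠ F.first := fun e => h (e ▸ adjacent_first_top)
    have n1 := alpha_ne hv last_mem_K0 hlast
    have n2 := alpha_ne hv first_mem_K0 hfirst
    rw [alpha_last] at n1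
    rw [alpha_first] at n2
    -- Now `α_v` is strictly between `0` and `t / 2`; the sign of `d` selects the outer circle that
    -- the region constrains.
    rcases lt_or_gt_of_ne hd with h3 | h3
    · refine hbig _ F.radius_first (hnadj h _ hfirst.symm first_mem_K0 (Or.inr ⟨?_, ?_⟩))
      · rw [alpha_first]; exact lt_of_le_of_ne hbet.1 n2.symm
      · rw [h0]; linarith
    · refine hbig _ F.radius_last (hnadj h _ hlast.symm last_mem_K0 (Or.inl ⟨?_, ?_⟩))
      · rw [alpha_last]; exact lt_of_le_of_ne hbet.2 n1
      · rw [h0]; linarith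

theorem areNeighbours_iff_mem_omegaInf {γ : SL(2, ℝ)} (hγ : mobius γ ∈ F.Gam) (hc : 0 ≤ γ 1 0)
    (T : ℝ) {v : Fin F.n} (hv : Label.inner v ∈ F.K0) :
    F.AreNeighbours T ((mobius γ : Sphere → Sphere) '' (F.circ (.inner v)).carrier)
      ((mobius γ : Sphere → Sphere) '' (F.circ .top).carrier) ↔
    (γ 1 0, γ 1 1) ∈ F.OmegaInf T v := by
  have hij : Label.inner v ≠ Label.top := by simp
  -- If `c = 0`, the image of the upper line has no finite point of tangency, and membership fails
  -- too by `notMem_omegaInf_of_eq_zero`.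
  rcases hc.eq_or_lt with h0 | hc0
  · refine iff_of_false ?_ (notMem_omegaInf_of_eq_zero h0.symm T hv)
    rw [areNeighbours_iff hγ hij hv top_mem_K0, moebius_top_zero, ← h0]
    rintro ⟨-, ⟨h, -⟩, -⟩
    norm_num at h
  have hlv := inner_den_ne hγ hv
  have hAv : 0 < moebius γ (F.labelVec (.inner v)) 0 :=
    lt_of_le_of_ne ((IsTangentVec.of_mem_K0 hv).moebius_nonneg γ)
      (moebius_labelVec_zero_ne hγ hv (by simp)).symm
  have hAt : 0 < moebius γ (F.labelVec .top) 0 := by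
    rw [moebius_top_zero]; positivity
  have ht := F.t_pos
  rw [areNeighbours_iff hγ hij hv top_mem_K0, forall_not_between_iff γ T hij hv top_mem_K0 hAv hAt,
    mem_omegaInf, adjacent_iff]
  simp only [hAv, hAt, hc, true_and]
  rw [moebius_inner_zero γ hv, moebius_top_zero]
  refine and_congr_right fun _ => and_congr_right fun _ => and_congr ?_ ?_
  · have sign : ∀ b, F.IsGapVec .base (.inner v) .top b →
        (moebius γ b 0 < 0 ↔ F.alpha v = 0 ∧ γ 1 1 > 0 ∨
          F.alpha v = F.t / 2 ∧ γ 1 0 * F.t / 2 + γ 1 1 < 0) ∧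
        (0 < moebius γ b 0 ↔ F.alpha v = 0 ∧ γ 1 1 < 0 ∨
          F.alpha v = F.t / 2 ∧ γ 1 0 * F.t / 2 + γ 1 1 > 0) := fun b hb => by
      obtain ⟨hb0, hside, hb3⟩ := gap_inner_top hb
      -- With `b 1 = -1` at the first circle and `b 1 = 1` at the last one, this explains the
      -- opposite sign conditions on `d` and on `c t / 2 + d`.
      have e : moebius γ b 0 = γ 1 0 * (2 * b 1 * (γ 1 0 * F.alpha v + γ 1 1)) := by
        rw [moebius_zero, hb0, hb3]; ring
      rw [e, mul_pos_iff_of_pos_left hc0, mul_neg_iff_of_pos hc0]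
      rcases hside with ⟨h1, -, h2⟩ | ⟨h1, -, h2⟩
      · have h3 : ¬ (0 = F.t / 2) := by intro h; linarith
        rw [h1, h2]
        simp only [h3, false_and, or_false, true_and]
        constructor <;> constructor <;> intro h <;> linarith
      · have h3 : ¬ (F.t / 2 = 0) := by intro h; linarith
        rw [h1, h2]
        simp only [h3, false_and, false_or, true_and]
        have e2 : γ 1 0 * (F.t / 2) = γ 1 0 * F.t / 2 := by ring
        rw [e2]
        constructor <;> constructor <;> intro h <;> linarith
    constructor
    · rintro h ⟨b, hb⟩
      obtain ⟨h1, h2⟩ := h b hb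
      obtain ⟨s1, s2⟩ := sign b hb
      refine ⟨fun hl u huv hu => ?_, fun hl O hO u huv hu => ?_⟩
      · rw [gt_iff_lt, ← moebius_inner_zero γ hu]
        exact h1 (s1.mpr hl) _ hu (by simpa using huv) (by simp)
      · rw [reflectedBound_iff γ T hO hb hu (by simpa using huv) (by simp)]
        exact h2 (s2.mpr hl) _ hu (by simpa using huv) (by simp)
    · intro h b hb
      obtain ⟨h1, h2⟩ := h ⟨b, hb⟩
      obtain ⟨s1, s2⟩ := sign b hb
      refine ⟨fun hl k hk hkv hkt => ?_, fun hl k hk hkv hkt => ?_⟩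
      · cases k with
        | base => exact absurd hk base_notMem_K0
        | top => exact absurd rfl hkt
        | inner u =>
          rw [moebius_inner_zero γ hk]
          exact h1 (s1.mp hl) u (by simpa using hkv) hk
      · cases k with
        | base => exact absurd hk base_notMem_K0
        | top => exact absurd rfl hkt
        | inner u =>
          obtain ⟨O, hO⟩ := adjacent_iff.mpr ⟨b, hb⟩
          rw [← reflectedBound_iff γ T hO hb hk hkv hkt]
          exact h2 (s2.mp hl) O hO u (by simpa using hkv) hk
  · have main : ∀ u, u ≠ v → Label.inner u ∈ F.K0 →
        ((contact (moebius γ (F.labelVec (.inner u))) - contact (moebius γ (F.labelVec (.inner v)))) *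
          (contact (moebius γ (F.labelVec (.inner u))) - contact (moebius γ (F.labelVec .top))) < 0 ↔
        F.alpha u > F.alpha v ∧ γ 1 0 * F.alpha v + γ 1 1 > 0 ∨
          F.alpha u < F.alpha v ∧ γ 1 0 * F.alpha v + γ 1 1 < 0) := fun u huv hu => by
      have hlu := inner_den_ne hγ hu
      rw [contact_inner_sub_inner γ hu hv hlu hlv, ← neg_sub (contact (moebius γ (F.labelVec .top))),
        contact_top_sub_inner γ hu hlu hc0.ne']
      -- The product of the differences is a negative multiple of `(α_u - α_v) / (c α_v + d)`, so
      -- betweenness means that numerator and denominator have the same sign.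
      have e : (F.alpha u - F.alpha v) / ((γ 1 0 * F.alpha u + γ 1 1) *
          (γ 1 0 * F.alpha v + γ 1 1)) * -(1 / (γ 1 0 * (γ 1 0 * F.alpha u + γ 1 1))) =
          -(1 / (γ 1 0 * (γ 1 0 * F.alpha u + γ 1 1) ^ 2) * ((F.alpha u - F.alpha v) /
          (γ 1 0 * F.alpha v + γ 1 1))) := by
        field_simp
      have h1 : 0 < 1 / (γ 1 0 * (γ 1 0 * F.alpha u + γ 1 1) ^ 2) := by positivity
      rw [e, neg_lt_zero, mul_pos_iff_of_pos_left h1, div_pos_iff, sub_pos, sub_neg]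
    refine imp_congr_right fun _ => ?_
    constructor
    · intro h u huv hu hcond
      have hAu : 0 < moebius γ (F.labelVec (.inner u)) 0 :=
        lt_of_le_of_ne ((IsTangentVec.of_mem_K0 hu).moebius_nonneg γ)
          (moebius_labelVec_zero_ne hγ hu (by simp)).symm
      rw [gt_iff_lt, ← moebius_inner_zero γ hu]
      exact h _ hu (by simpa using huv) (by simp) hAu ((main u huv hu).mpr hcond)
    · intro h k hk hkv hkt _ hlt
      cases k with
      | base => exact absurd hk base_notMem_K0
      | top => exact absurd rfl hkt
      | inner u =>
        have huv : u ≠ v := by simpa using hkv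
        rw [moebius_inner_zero γ hk]
        exact h u huv hk ((main u huv hk).mp hlt)

theorem areNeighbours_comm {T : ℝ} {C C' : Set Sphere} :
    F.AreNeighbours T C C' ↔ F.AreNeighbours T C' C := by
  constructor <;>
  · rintro ⟨x, y, hx, hy, hne, h⟩
    exact ⟨y, x, hy, hx, hne.symm, by rwa [min_comm, max_comm]⟩

/-! ### Scaling -/

theorem ReflectedBound.scale {T c d s : ℝ} (hs : 0 < s) {O : GenCircle} {k : Label F.n}
    (h : F.ReflectedBound T c d O k) : F.ReflectedBound (s ^ 2 * T) (s * c) (s * d) O k := by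
  obtain ⟨α', r', hr, hC, hT⟩ := h
  refine ⟨α', r', hr, hC, ?_⟩
  rw [show (s * c * α' + s * d) ^ 2 / r' = s ^ 2 * ((c * α' + d) ^ 2 / r') by ring]
  exact mul_lt_mul_of_pos_left hT (by positivity)

theorem omegaFin_scale {T c d s : ℝ} (hs : 0 < s) {v w : Fin F.n} (h : (c, d) ∈ F.OmegaFin T v w) :
    (s * c, s * d) ∈ F.OmegaFin (s ^ 2 * T) v w := by
  rw [mem_omegaFin] at h ⊢
  have hs2 : 0 < s ^ 2 := by positivity
  have e1 : ∀ x : ℝ, (s * c * x + s * d) ^ 2 = s ^ 2 * (c * x + d) ^ 2 := fun x => by ring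
  have e2 : ∀ x y : ℝ, (s * c * x + s * d) * (s * c * y + s * d) =
      s ^ 2 * ((c * x + d) * (c * y + d)) := fun x y => by ring
  have e3 : 2 * (s * c) ^ 2 = s ^ 2 * (2 * c ^ 2) := by ring
  have e4 : ∀ k, F.form (s * c) (s * d) k = s ^ 2 * F.form c d k := fun k => by
    cases k <;> simp [form] <;> ring
  simp only [e1, e2, e3, e4, mul_div_assoc, gt_iff_lt, mul_lt_mul_iff_right₀ hs2,
    mul_le_mul_iff_right₀ hs2, mul_neg_iff_of_pos hs2, mul_pos_iff_of_pos_left hs2]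
  obtain ⟨h1, h2, h3, h4, h5⟩ := h
  exact ⟨by positivity, h2, h3, fun ha => ⟨(h4 ha).1,
    fun hl O hO k hk hkv hkw => ((h4 ha).2 hl O hO k hk hkv hkw).scale hs⟩, h5⟩

theorem omegaInf_scale {T c d s : ℝ} (hs : 0 < s) {v : Fin F.n} (h : (c, d) ∈ F.OmegaInf T v) :
    (s * c, s * d) ∈ F.OmegaInf (s ^ 2 * T) v := by
  rw [mem_omegaInf] at h ⊢
  have hs2 : 0 < s ^ 2 := by positivity
  have e1 : ∀ x : ℝ, (s * c * x + s * d) ^ 2 = s ^ 2 * (c * x + d) ^ 2 := fun x => by ring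
  have e2 : ∀ x : ℝ, s * c * x + s * d = s * (c * x + d) := fun x => by ring
  have e3 : 2 * (s * c) ^ 2 = s ^ 2 * (2 * c ^ 2) := by ring
  simp only [e1, e3, mul_div_assoc, gt_iff_lt, mul_lt_mul_iff_right₀ hs2,
    mul_le_mul_iff_right₀ hs2]
  simp only [e2, mul_neg_iff_of_pos hs, mul_pos_iff_of_pos_left hs]
  simp only [mul_div_assoc] at h
  obtain ⟨h1, h2, h3, h4, h5⟩ := h
  exact ⟨by positivity, h2, h3, fun ha => ⟨(h4 ha).1,
    fun hl O hO k hk hkv => ((h4 ha).2 hl O hO k hk hkv).scale hs⟩, h5⟩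

theorem omega_scale {T c d s : ℝ} (hs : 0 < s) {i j : Label F.n} (h : (c, d) ∈ F.Omega T i j) :
    (s * c, s * d) ∈ F.Omega (s ^ 2 * T) i j := by
  cases i <;> cases j <;> simp only [Omega, Set.mem_empty_iff_false] at h ⊢
  · exact omegaInf_scale hs h
  · exact omegaInf_scale hs h
  · exact omegaFin_scale hs h

theorem omega_eq_smul {T : ℝ} (hT : 0 < T) (i j : Label F.n) :
    F.Omega T i j = Real.sqrt T • F.Omega 1 i j := by
  have hs := Real.sqrt_pos.mpr hT
  have hsq := Real.sq_sqrt hT.le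
  ext ⟨c, d⟩
  rw [Set.mem_smul_set]
  constructor
  · intro h
    refine ⟨((Real.sqrt T)⁻¹ * c, (Real.sqrt T)⁻¹ * d), ?_, ?_⟩
    · have := omega_scale (inv_pos.mpr hs) h
      rwa [inv_pow, hsq, inv_mul_cancel₀ hT.ne'] at this
    · simp [mul_inv_cancel_left₀ hs.ne']
  · rintro ⟨⟨c', d'⟩, h, he⟩
    have := omega_scale hs h
    rw [hsq, mul_one] at this
    cases he
    exact this

end FordConfiguration

end

theorem mainTheorem7 (F : FordConfiguration) (i j : Label F.n)
    (hi : i ∈ F.K0) (hj : j ∈ F.K0) (hij : i ≠ j) :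
    (∀ T : ℝ, 0 < T → ∀ γ : SL(2, ℝ), mobius γ ∈ F.Gam → 0 ≤ γ 1 0 →
      (F.AreNeighbours T ((mobius γ : Sphere → Sphere) '' (F.circ i).carrier)
          ((mobius γ : Sphere → Sphere) '' (F.circ j).carrier) ↔
        (γ 1 0, γ 1 1) ∈ F.Omega T i j)) ∧
    (∀ T : ℝ, 0 < T → F.Omega T i j = Real.sqrt T • F.Omega 1 i j) := by
  refine ⟨fun T _ γ hγ hc => ?_, fun T hT => FordConfiguration.omega_eq_smul hT i j⟩
  cases i with
  | base => exact absurd hi FordConfiguration.base_notMem_K0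
  | top =>
    cases j with
    | base => exact absurd hj FordConfiguration.base_notMem_K0
    | top => exact absurd rfl hij
    | inner w =>
      rw [FordConfiguration.areNeighbours_comm]
      exact FordConfiguration.areNeighbours_iff_mem_omegaInf hγ hc T hj
  | inner v =>
    cases j with
    | base => exact absurd hj FordConfiguration.base_notMem_K0
    | top => exact FordConfiguration.areNeighbours_iff_mem_omegaInf hγ hc T hi
    | inner w =>
      exact FordConfiguration.areNeighbours_iff_mem_omegaFin hγ hc T (by simpa using hij) hi hj
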